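/- Let $\Bbbk=\mathbb R$ or $\mathbb C$, and let $G$ be a Lie group over $\Bbbk$ (a finite-dimensional real smooth, respectively complex holomorphic, Lie group; no connectedness or countability is assumed) with Lie algebra $\mathfrak g=T_eG$, the bracket being that of left-invariant vector fields. For an open set $U\subseteq G$ let $\mathcal O(U)$ be the algebra of smooth (respectively holomorphic) functions $U\to\Bbbk$. A differential operator of order $\le n$ on $G$ is a family of $\Bbbk$-linear maps $D_U:\mathcal O(U)\to\mathcal O(U)$, one for each open $U\subseteq G$, which in local charts has the form $\sum_{|\alpha|\le n}a_\alpha\partial^\alpha$ with coefficients $a_\alpha$ that are smooth (respectively holomorphic) and do not depend on $U$. It is left-invariant (respectively right-invariant) if it commutes with the pull-back of functions by all left (respectively right) translations of $G$, and bi-invariant if it is both. Let $\mathcal D^l$ be the algebra of left-invariant differential operators on $G$ of finite order, $\mathcal D^l_n\subseteq\mathcal D^l$ the subspace of those of order $\le n$. For a Lie algebra $\mathfrak a$ over $\Bbbk$ let $\mathcal U(\mathfrak a)$ be its universal enveloping algebra, $i:\mathfrak a\to\mathcal U(\mathfrak a)$ the canonical map, and $\mathcal U_n(\mathfrak a)$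 the image of $\bigoplus_{k=0}^n\mathfrak a^{\otimes k}$ in $\mathcal U(\mathfrak a)$. 1. There is an isomorphism of $\Bbbk$-algebras $j:\mathcal U(\mathfrak g)\to\mathcal D^l$ which maps $i(X)$, for every $X\in\mathfrak g$, to the derivation $f\mapsto X^Lf$ given by the left-invariant vector field $X^L$ with $X^L(e)=X$, and which satisfies $j(\mathcal U_n(\mathfrak g))=\mathcal D^l_n$ for every $n\ge 0$; thus $j$ is an isomorphism of filtered algebras. 2. If $G$ is connected, $j$ maps the center of $\mathcal U(\mathfrak g)$ onto the subalgebra of bi-invariant differential operators on $G$. 3. (Poincaré–Birkhoff–Witt over $\mathbb R$ and $\mathbb C$.) For every Lie algebra $\mathfrak a$ over $\Bbbk$ there is an isomorphism of $\Bbbk$-algebras $S(\mathfrak a)\to\operatorname{Gr}\mathcal U(\mathfrak a)=\bigoplus_{n\ge 0}\mathcal U_n(\mathfrak a)/\mathcal U_{n-1}(\mathfrak a)$ (with $\mathcal U_{-1}=0$) which maps each $X\in\mathfrak a$ to the class of $i(X)$ in $\mathcal U_1(\mathfrak a)/\mathcal U_0(\mathfrak a)$. -/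

import Mathlib

open scoped Manifold ContDiff LieGroup DirectSum
open TopologicalSpace

noncomputable section

/-! ### The associated graded algebra of a filtered algebra -/

section AssociatedGraded

variable {R A : Type*} [CommRing R] [Ring A] [Algebra R A]

/-- The piece `F (n - 1)` preceding `F n` in an increasing filtration indexed by `ℕ`, with the
convention `F (-1) = 0`. -/
def filtrationPred (F : ℕ → Submodule R A) : ℕ → Submodule R A
  | 0 => ⊥
  | n + 1 => F n

/-- The degree `n` piece `F n / F (n - 1)` of the associated graded algebra. -/
def GrPiece (F : ℕ → Submodule R A) (n : ℕ) : Type _ :=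
  F n ⧸ (filtrationPred F n).comap (F n).subtype

instance (F : ℕ → Submodule R A) (n : ℕ) : AddCommGroup (GrPiece F n) :=
  inferInstanceAs (AddCommGroup (F n ⧸ (filtrationPred F n).comap (F n).subtype))

instance (F : ℕ → Submodule R A) (n : ℕ) : Module R (GrPiece F n) :=
  inferInstanceAs (Module R (F n ⧸ (filtrationPred F n).comap (F n).subtype))

/-- The class in `F n / F (n - 1)` of an element of `F n`. -/
def GrPiece.mk (F : ℕ → Submodule R A) (n : ℕ) : F n →ₗ[R] GrPiece F n :=
  Submodule.mkQ _

variable (F : ℕ → Submodule R A)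

theorem GrPiece.mk_surjective (n : ℕ) : Function.Surjective (GrPiece.mk F n) :=
  Submodule.mkQ_surjective _

theorem GrPiece.mk_eq_zero {n : ℕ} (a : F n) :
    GrPiece.mk F n a = 0 ↔ (a : A) ∈ filtrationPred F n := by
  exact Submodule.Quotient.mk_eq_zero _

theorem GrPiece.sigma_ext {m n : ℕ} (h : m = n) (a : F m) (b : F n) (hab : (a : A) = b) :
    GradedMonoid.mk (A := GrPiece F) m (GrPiece.mk F m a) =
      GradedMonoid.mk n (GrPiece.mk F n b) := by
  subst h
  rw [Subtype.ext hab]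

variable [IsRingFiltration F (filtrationPred F)]

theorem filtrationPred_mul_mem {i j : ℕ} {a b : A} (ha : a ∈ filtrationPred F i) (hb : b ∈ F j) :
    a * b ∈ filtrationPred F (i + j) := by
  cases i with
  | zero =>
    have h0 : a = 0 := ha
    rw [h0, zero_mul]; exact zero_mem _
  | succ i =>
    rw [Nat.succ_add_eq_add_succ i j]
    exact (SetLike.mul_mem_graded (A := F) (i := i) (j := j) ha hb : a * b ∈ F (i + j))

theorem mul_filtrationPred_mem {i j : ℕ} {a b : A} (ha : a ∈ F i) (hb : b ∈ filtrationPred F j) :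
    a * b ∈ filtrationPred F (i + j) := by
  cases j with
  | zero =>
    have h0 : b = 0 := hb
    rw [h0, mul_zero]; exact zero_mem _
  | succ j => exact (SetLike.mul_mem_graded (A := F) (i := i) (j := j) ha hb : a * b ∈ F (i + j))

/-- The product of `a ∈ F i` and `b ∈ F j`, as an element of `F (i + j)`. -/
def filtrationMul (i j : ℕ) : F i →ₗ[R] F j →ₗ[R] F (i + j) :=
  LinearMap.mk₂ R (fun a b => ⟨(a : A) * b, SetLike.mul_mem_graded a.2 b.2⟩)
    (fun _ _ _ => Subtype.ext (add_mul _ _ _))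
    (fun _ _ _ => Subtype.ext (smul_mul_assoc _ _ _))
    (fun _ _ _ => Subtype.ext (mul_add _ _ _))
    (fun _ _ _ => Subtype.ext (mul_smul_comm _ _ _))

/-- The product `F i / F (i - 1) × F j / F (j - 1) → F (i + j) / F (i + j - 1)` induced by the
product of the filtered algebra. -/
def GrPiece.mul (i j : ℕ) : GrPiece F i →ₗ[R] GrPiece F j →ₗ[R] GrPiece F (i + j) :=
  Submodule.liftQ _
    (LinearMap.flip <| Submodule.liftQ _
      ((filtrationMul F i j).compr₂ (GrPiece.mk F (i + j))).flip (by
        intro b hb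
        ext a
        exact (GrPiece.mk_eq_zero F _).2 (mul_filtrationPred_mem F a.2 hb)))
    (by
      intro a ha
      refine LinearMap.ext fun b => ?_
      obtain ⟨b, rfl⟩ := GrPiece.mk_surjective F j b
      exact (GrPiece.mk_eq_zero F _).2 (filtrationPred_mul_mem F ha b.2))

theorem GrPiece.mul_mk {i j : ℕ} (a : F i) (b : F j) :
    GrPiece.mul F i j (GrPiece.mk F i a) (GrPiece.mk F j b) =
      GrPiece.mk F (i + j) ⟨(a : A) * b, SetLike.mul_mem_graded a.2 b.2⟩ :=
  rfl

instance : GradedMonoid.GMul (GrPiece F) where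
  mul a b := GrPiece.mul F _ _ a b

instance : GradedMonoid.GOne (GrPiece F) where
  one := GrPiece.mk F 0 ⟨1, SetLike.one_mem_graded F⟩

instance : GradedMonoid.GMonoid (GrPiece F) where
  one_mul := by
    rintro ⟨i, a⟩
    obtain ⟨a, rfl⟩ := GrPiece.mk_surjective F i a
    exact GrPiece.sigma_ext F (zero_add i) _ _ (one_mul _)
  mul_one := by
    rintro ⟨i, a⟩
    obtain ⟨a, rfl⟩ := GrPiece.mk_surjective F i a
    exact GrPiece.sigma_ext F (add_zero i) _ _ (mul_one _)
  mul_assoc := by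
    rintro ⟨i, a⟩ ⟨j, b⟩ ⟨k, c⟩
    obtain ⟨a, rfl⟩ := GrPiece.mk_surjective F i a
    obtain ⟨b, rfl⟩ := GrPiece.mk_surjective F j b
    obtain ⟨c, rfl⟩ := GrPiece.mk_surjective F k c
    exact GrPiece.sigma_ext F (add_assoc i j k) _ _ (mul_assoc _ _ _)

instance : DirectSum.GRing (GrPiece F) where
  mul_zero a := map_zero (GrPiece.mul F _ _ a)
  zero_mul b := LinearMap.map_zero₂ (GrPiece.mul F _ _) b
  mul_add a b c := map_add (GrPiece.mul F _ _ a) b c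
  add_mul a b c := LinearMap.map_add₂ (GrPiece.mul F _ _) a b c
  natCast n := n • GrPiece.mk F 0 ⟨1, SetLike.one_mem_graded F⟩
  natCast_zero := zero_nsmul _
  natCast_succ n := succ_nsmul _ n
  intCast n := n • GrPiece.mk F 0 ⟨1, SetLike.one_mem_graded F⟩
  intCast_ofNat n := natCast_zsmul _ n
  intCast_negSucc_ofNat n := negSucc_zsmul _ n

instance : DirectSum.GAlgebra R (GrPiece F) where
  toFun := (LinearMap.toSpanSingleton R (GrPiece F 0)
    (GrPiece.mk F 0 ⟨1, SetLike.one_mem_graded F⟩)).toAddMonoidHom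
  map_one := one_smul R (GrPiece.mk F 0 ⟨1, SetLike.one_mem_graded F⟩)
  map_mul r s := GrPiece.sigma_ext F (zero_add 0).symm (((r * s) • ⟨1, SetLike.one_mem_graded F⟩))
    ⟨(r • (1 : A)) * (s • (1 : A)), _⟩ (by simp [smul_smul, mul_comm])
  commutes := by
    rintro r ⟨i, a⟩
    obtain ⟨a, rfl⟩ := GrPiece.mk_surjective F i a
    exact GrPiece.sigma_ext F ((zero_add i).trans (add_zero i).symm)
      ⟨(r • (1 : A)) * a, _⟩ ⟨a * (r • (1 : A)), _⟩ (by simp)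
  smul_def := by
    rintro r ⟨i, a⟩
    obtain ⟨a, rfl⟩ := GrPiece.mk_surjective F i a
    exact GrPiece.sigma_ext F (zero_add i).symm (r • a) ⟨(r • (1 : A)) * a, _⟩ (by simp)

/-- The associated graded algebra `⨁ n, F n / F (n - 1)` of a filtered algebra. -/
abbrev AssociatedGraded : Type _ := ⨁ n, GrPiece F n

end AssociatedGraded

/-! ### The universal enveloping algebra as a filtered algebra -/

section Enveloping

variable (R L : Type*) [CommRing R] [LieRing L] [LieAlgebra R L]

/-- The `n`-th piece of the canonical filtration of the universal enveloping algebra: the image of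
the sum of the tensor powers of degree `≤ n`. -/
def envFiltration (n : ℕ) : Submodule R (UniversalEnvelopingAlgebra R L) :=
  (⨆ k : Fin (n + 1), (LinearMap.range (TensorAlgebra.ι R : L →ₗ[R] TensorAlgebra R L)) ^ (k : ℕ)).map
    (UniversalEnvelopingAlgebra.mkAlgHom R L).toLinearMap

theorem envFiltration_mono : Monotone (envFiltration R L) := fun m n h =>
  Submodule.map_mono <| iSup_le fun k =>
    le_iSup (fun k : Fin (n + 1) =>
      (LinearMap.range (TensorAlgebra.ι R : L →ₗ[R] TensorAlgebra R L)) ^ (k : ℕ)) ⟨k, by omega⟩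

instance : IsRingFiltration (envFiltration R L) (filtrationPred (envFiltration R L)) where
  mono := envFiltration_mono R L
  is_le {i j} h := by
    cases j with
    | zero => omega
    | succ j => exact envFiltration_mono R L (Nat.le_of_lt_succ h)
  is_sup B j h := by
    cases j with
    | zero => exact bot_le
    | succ j => exact h j j.lt_succ_self
  one_mem := by
    refine ⟨1, Submodule.mem_iSup_of_mem ⟨0, by omega⟩ ?_,
      map_one (UniversalEnvelopingAlgebra.mkAlgHom R L)⟩
    rw [pow_zero]
    exact Submodule.one_le.1 le_rfl
  mul_mem := by
    rintro m n _ _ ⟨a, ha, rfl⟩ ⟨b, hb, rfl⟩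
    refine ⟨a * b, ?_, map_mul (UniversalEnvelopingAlgebra.mkAlgHom R L) a b⟩
    have h := Submodule.mul_mem_mul ha hb
    rw [Submodule.iSup_mul] at h
    refine (?_ : _ ≤ (_ : Submodule R (TensorAlgebra R L))) h
    refine iSup_le fun k => ?_
    rw [Submodule.mul_iSup]
    refine iSup_le fun l => ?_
    rw [← pow_add]
    exact le_iSup (fun k : Fin (m + n + 1) =>
      (LinearMap.range (TensorAlgebra.ι R : L →ₗ[R] TensorAlgebra R L)) ^ (k : ℕ))
        ⟨k + l, by omega⟩

theorem ι_mem_envFiltration (X : L) :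
    UniversalEnvelopingAlgebra.ι R X ∈ envFiltration R L 1 := by
  refine ⟨TensorAlgebra.ι R X, Submodule.mem_iSup_of_mem ⟨1, by omega⟩ ?_, rfl⟩
  rw [pow_one]
  exact LinearMap.mem_range_self _ X

/-- The degree one element of the associated graded algebra given by an element of the Lie
algebra. -/
def grι (X : L) : AssociatedGraded (envFiltration R L) :=
  DirectSum.of (GrPiece (envFiltration R L)) 1
    (GrPiece.mk _ 1 ⟨UniversalEnvelopingAlgebra.ι R X, ι_mem_envFiltration R L X⟩)

end Enveloping

/-! ### Expressions `∑ l ≤ n, B l z (D^l g z)` in a normed space -/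

section Local

variable {𝕜 E F F' : Type*} [NontriviallyNormedField 𝕜] [NormedAddCommGroup E] [NormedSpace 𝕜 E]
  [NormedAddCommGroup F] [NormedSpace 𝕜 F] [NormedAddCommGroup F'] [NormedSpace 𝕜 F']

/-- On functions `g` that are smooth on an open subset of `Ω`, the operator `Φ` is given by
`Φ g z = ∑ l ≤ n, B l z (D^l g z)` with smooth coefficients `B l` on `Ω`. -/
def IsLocalDiffOp (n : ℕ) (Ω : Set E) (Φ : (E → 𝕜) → E → F) : Prop :=
  ∃ B : ∀ l : ℕ, E → (E [×l]→L[𝕜] 𝕜) →L[𝕜] F, (∀ l, ContDiffOn 𝕜 ∞ (B l) Ω) ∧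
    ∀ V : Set E, IsOpen V → V ⊆ Ω → ∀ g : E → 𝕜, ContDiffOn 𝕜 ∞ g V → ∀ z ∈ V,
      Φ g z = ∑ l ∈ Finset.range (n + 1), B l z (iteratedFDeriv 𝕜 l g z)

namespace IsLocalDiffOp

variable {n m : ℕ} {Ω : Set E} {Φ Ψ : (E → 𝕜) → E → F}

theorem congr (h : IsLocalDiffOp n Ω Φ)
    (H : ∀ V : Set E, IsOpen V → V ⊆ Ω → ∀ g : E → 𝕜, ContDiffOn 𝕜 ∞ g V → ∀ z ∈ V,
      Ψ g z = Φ g z) : IsLocalDiffOp n Ω Ψ := by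
  obtain ⟨B, hB, h⟩ := h
  exact ⟨B, hB, fun V hV hVΩ g hg z hz => (H V hV hVΩ g hg z hz).trans (h V hV hVΩ g hg z hz)⟩

theorem mono (h : IsLocalDiffOp n Ω Φ) (hnm : n ≤ m) : IsLocalDiffOp m Ω Φ := by
  obtain ⟨B, hB, h⟩ := h
  refine ⟨fun l => if l ≤ n then B l else 0, fun l => ?_, fun V hV hVΩ g hg z hz => ?_⟩
  · dsimp only
    split_ifs
    · exact hB l
    · exact contDiffOn_const (c := 0)
  · rw [h V hV hVΩ g hg z hz, ← Finset.sum_subset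
      (Finset.range_subset_range.2 (Nat.succ_le_succ hnm))]
    · refine Finset.sum_congr rfl fun l hl => ?_
      simp only
      rw [if_pos (Nat.lt_succ_iff.1 (Finset.mem_range.1 hl))]
    · intro l _ hl
      simp only
      rw [if_neg (fun h => hl (Finset.mem_range.2 (Nat.lt_succ_of_le h)))]
      simp

theorem zero : IsLocalDiffOp n Ω (fun (_ : E → 𝕜) (_ : E) => (0 : F)) :=
  ⟨fun _ _ => 0, fun _ => contDiffOn_const, fun _ _ _ _ _ _ _ => by simp⟩

theorem add (h : IsLocalDiffOp n Ω Φ) (h' : IsLocalDiffOp n Ω Ψ) :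
    IsLocalDiffOp n Ω (fun g z => Φ g z + Ψ g z) := by
  obtain ⟨B, hB, h⟩ := h
  obtain ⟨B', hB', h'⟩ := h'
  refine ⟨fun l z => B l z + B' l z, fun l => (hB l).add (hB' l), fun V hV hVΩ g hg z hz => ?_⟩
  dsimp only
  rw [h V hV hVΩ g hg z hz, h' V hV hVΩ g hg z hz, ← Finset.sum_add_distrib]
  rfl

theorem sum {ι : Type*} (s : Finset ι) {Φ : ι → (E → 𝕜) → E → F}
    (h : ∀ i ∈ s, IsLocalDiffOp n Ω (Φ i)) :
    IsLocalDiffOp n Ω (fun g z => ∑ i ∈ s, Φ i g z) := by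
  classical
  induction s using Finset.induction_on with
  | empty => simpa using zero
  | insert i s hi ih =>
    simp only [Finset.sum_insert hi]
    exact (h i (Finset.mem_insert_self i s)).add
      (ih fun j hj => h j (Finset.mem_insert_of_mem hj))

theorem single (l : ℕ) {b : E → (E [×l]→L[𝕜] 𝕜) →L[𝕜] F} (hb : ContDiffOn 𝕜 ∞ b Ω)
    (hl : l ≤ n) : IsLocalDiffOp n Ω (fun g z => b z (iteratedFDeriv 𝕜 l g z)) := by
  refine ⟨Pi.single l b, fun k => ?_, fun V hV hVΩ g hg z hz => ?_⟩
  · by_cases hk : k = l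
    · subst hk
      rwa [Pi.single_eq_same]
    · rw [Pi.single_eq_of_ne hk]
      exact contDiffOn_const (c := 0)
  · rw [Finset.sum_eq_single l]
    · rw [Pi.single_eq_same]
    · intro k _ hk
      rw [Pi.single_eq_of_ne hk]
      rfl
    · intro h
      exact absurd (Finset.mem_range.2 (Nat.lt_succ_of_le hl)) h

theorem comp {a : E → F →L[𝕜] F'} (ha : ContDiffOn 𝕜 ∞ a Ω) (h : IsLocalDiffOp n Ω Φ) :
    IsLocalDiffOp n Ω (fun g z => a z (Φ g z)) := by
  obtain ⟨B, hB, h⟩ := h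
  refine ⟨fun l z => (a z).comp (B l z), fun l => ha.clm_comp (hB l),
    fun V hV hVΩ g hg z hz => ?_⟩
  dsimp only
  rw [h V hV hVΩ g hg z hz, map_sum]
  rfl

theorem hasFDerivAt_iteratedFDeriv {V : Set E} (hV : IsOpen V) {g : E → 𝕜}
    (hg : ContDiffOn 𝕜 ∞ g V) {z : E} (hz : z ∈ V) (l : ℕ) :
    HasFDerivAt (iteratedFDeriv 𝕜 l g)
      (continuousMultilinearCurryLeftEquiv 𝕜 (fun _ : Fin (l + 1) => E) 𝕜
        (iteratedFDeriv 𝕜 (l + 1) g z)) z := by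
  have h1 : ContDiffAt 𝕜 1 (iteratedFDeriv 𝕜 l g) z :=
    (hg.contDiffAt (hV.mem_nhds hz)).iteratedFDeriv_right (by norm_cast; exact le_top)
  have h2 := (h1.differentiableAt one_ne_zero).hasFDerivAt
  rwa [iteratedFDeriv_succ_eq_comp_left, Function.comp_apply, LinearIsometryEquiv.apply_symm_apply]

set_option maxSynthPendingDepth 3 in
theorem fderiv (hΩ : IsOpen Ω) (h : IsLocalDiffOp n Ω Φ) :
    IsLocalDiffOp (n + 1) Ω (fun g z => fderiv 𝕜 (Φ g) z) := by
  obtain ⟨B, hB, h⟩ := h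
  have hB' : ∀ l, ContDiffOn 𝕜 ∞ (_root_.fderiv 𝕜 (B l)) Ω := fun l =>
    (hB l).fderiv_of_isOpen hΩ (by simp)
  have key : IsLocalDiffOp (n + 1) Ω (fun g z => ∑ l ∈ Finset.range (n + 1),
      ((_root_.fderiv 𝕜 (B l) z).flip (iteratedFDeriv 𝕜 l g z) +
      ((ContinuousLinearMap.compL 𝕜 E _ F (B l z)).comp
        (continuousMultilinearCurryLeftEquiv 𝕜 (fun _ : Fin (l + 1) => E) 𝕜
          : _ →L[𝕜] _)) (iteratedFDeriv 𝕜 (l + 1) g z))) := by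
    refine sum _ fun l hl => add (single l ?_ (Finset.mem_range.1 hl).le)
      (single (l + 1) ?_ (Nat.succ_le_of_lt (Finset.mem_range.1 hl)))
    · exact (ContinuousLinearMap.flipₗᵢ 𝕜 E (E [×l]→L[𝕜] 𝕜) F).contDiff.comp_contDiffOn (hB' l)
    · exact (((ContinuousLinearMap.compL 𝕜 E (E [×l]→L[𝕜] 𝕜) F).contDiff).comp_contDiffOn
        (hB l)).clm_comp contDiffOn_const
  refine key.congr fun V hV hVΩ g hg z hz => ?_
  have hev : Φ g =ᶠ[nhds z]
      fun z => ∑ l ∈ Finset.range (n + 1), B l z (iteratedFDeriv 𝕜 l g z) :=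
    Filter.eventually_of_mem (hV.mem_nhds hz) fun y hy => h V hV hVΩ g hg y hy
  rw [hev.fderiv_eq]
  refine HasFDerivAt.fderiv ?_
  refine HasFDerivAt.fun_sum fun l _ => ?_
  have hBl : HasFDerivAt (B l) (_root_.fderiv 𝕜 (B l) z) z :=
    (((hB l).contDiffAt (hΩ.mem_nhds (hVΩ hz))).differentiableAt (by simp)).hasFDerivAt
  have := hBl.clm_apply (hasFDerivAt_iteratedFDeriv hV hg hz l)
  rw [add_comm]
  exact this

theorem iterated (hΩ : IsOpen Ω) (h : IsLocalDiffOp n Ω Φ) (k : ℕ) :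
    IsLocalDiffOp (n + k) Ω (fun g z => iteratedFDeriv 𝕜 k (Φ g) z) := by
  induction k with
  | zero =>
    refine (h.comp (a := fun _ => ((continuousMultilinearCurryFin0 𝕜 E F).symm : F →L[𝕜] _))
      contDiffOn_const).congr fun V _ _ g _ z _ => ?_
    rw [iteratedFDeriv_zero_eq_comp]
    rfl
  | succ k ih =>
    refine ((ih.fderiv hΩ).comp (a := fun _ =>
      ((continuousMultilinearCurryLeftEquiv 𝕜 (fun _ : Fin (k + 1) => E) F).symm : _ →L[𝕜] _))
      contDiffOn_const).congr fun V _ _ g _ z _ => ?_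
    rw [iteratedFDeriv_succ_eq_comp_left]
    rfl

end IsLocalDiffOp

end Local

/-! ### Differential operators on a manifold -/

section Manifold

variable {𝕜 E H : Type*} [NontriviallyNormedField 𝕜] [NormedAddCommGroup E] [NormedSpace 𝕜 E]
  [TopologicalSpace H] (I : ModelWithCorners 𝕜 E H) (M : Type*) [TopologicalSpace M]
  [ChartedSpace H M]

/-- Families of linear operators, one on the smooth functions `U → 𝕜` for each open subset `U`
of `M`. They form an algebra under composition. -/
abbrev LocalOperators : Type _ := ∀ U : Opens M, Module.End 𝕜 C^∞⟮I, U; 𝕜⟯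

variable {I M}

/-- The extension by zero of a function on an open subset. It is only used at points of the subset,
and only through its germ there. -/
def extendZero {U : Opens M} (f : C^∞⟮I, U; 𝕜⟯) : M → 𝕜 :=
  Function.extend (Subtype.val : U → M) f 0

/-- `D` is a differential operator of order at most `n`: around each point `x₀` there are smooth
coefficients `a 0, …, a n` such that, in the chart `φ` at `x₀`,
`(D f) (y) = ∑ k ≤ n, a k (φ y) (D^k (f ∘ φ⁻¹) (φ y))`,
where `D^k` is the `k`-th derivative, i.e. the array of all partial derivatives of order `k`, and
`a k (φ y)` is a linear form on such arrays. In coordinates, this is the usual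
`∑_{|α| ≤ n} a_α ∂^α f`. In particular `(D f) (y)` depends only on the germ of `f` at `y`, so that
`D` is compatible with restriction to smaller open subsets. -/
def HasOrderLE (n : ℕ) (D : LocalOperators I M) : Prop :=
  ∀ x₀ : M, ∃ W : Opens M, x₀ ∈ W ∧ (W : Set M) ⊆ (chartAt H x₀).source ∧
    ∃ a : ∀ k : ℕ, E → (E [×k]→L[𝕜] 𝕜) →L[𝕜] 𝕜,
      (∀ k, ContDiffOn 𝕜 ∞ (a k) (extChartAt I x₀ '' W)) ∧
      ∀ (U : Opens M) (f : C^∞⟮I, U; 𝕜⟯) (y : U), (y : M) ∈ W →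
        D U f y = ∑ k ∈ Finset.range (n + 1),
          a k (extChartAt I x₀ y)
            (iteratedFDeriv 𝕜 k (extendZero f ∘ (extChartAt I x₀).symm) (extChartAt I x₀ y))

theorem extendZero_apply {U : Opens M} (f : C^∞⟮I, U; 𝕜⟯) (y : U) : extendZero f y = f y :=
  Subtype.val_injective.extend_apply _ _ _

theorem contMDiffAt_extendZero {U : Opens M} (f : C^∞⟮I, U; 𝕜⟯) {y : M} (hy : y ∈ U) :
    ContMDiffAt I 𝓘(𝕜, 𝕜) ∞ (extendZero f) y := by
  rw [← contMDiffAt_subtype_iff (U := U) (x := ⟨y, hy⟩)]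
  have : (fun x : U => extendZero f x) = f := funext (extendZero_apply f)
  rw [this]
  exact f.contMDiff.contMDiffAt

theorem isOpen_extChartAt_image [I.Boundaryless] (x₀ : M) {W : Set M} (hW : IsOpen W)
    (hW' : W ⊆ (chartAt H x₀).source) : IsOpen (extChartAt I x₀ '' W) := by
  rw [PartialEquiv.image_eq_target_inter_inv_preimage _ (by rwa [extChartAt_source])]
  exact (continuousOn_extChartAt_symm x₀).isOpen_inter_preimage (isOpen_extChartAt_target x₀) hW

theorem contDiffOn_extendZero_comp [IsManifold I ∞ M] [I.Boundaryless] (x₀ : M) {U : Opens M}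
    (f : C^∞⟮I, U; 𝕜⟯) {W : Set M} (hW' : W ⊆ (chartAt H x₀).source) (hWU : W ⊆ U) :
    ContDiffOn 𝕜 ∞ (extendZero f ∘ (extChartAt I x₀).symm) (extChartAt I x₀ '' W) := by
  rintro _ ⟨y, hy, rfl⟩
  have hys : y ∈ (extChartAt I x₀).source := by rw [extChartAt_source]; exact hW' hy
  refine ContDiffAt.contDiffWithinAt ?_
  rw [← contMDiffAt_iff_contDiffAt]
  refine ContMDiffAt.comp (I' := I) _ ?_ ?_
  · rw [(extChartAt I x₀).left_inv hys]
    exact contMDiffAt_extendZero f (hWU hy)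
  · exact (contMDiffOn_extChartAt_symm x₀).contMDiffAt
      ((isOpen_extChartAt_target x₀).mem_nhds ((extChartAt I x₀).map_source hys))

namespace HasOrderLE

variable {D D' : LocalOperators I M} {m n : ℕ}

theorem mono (h : HasOrderLE m D) (hmn : m ≤ n) : HasOrderLE n D := by
  intro x₀
  obtain ⟨W, hx, hW, a, ha, H⟩ := h x₀
  refine ⟨W, hx, hW, fun l => if l ≤ m then a l else 0, fun l => ?_, fun U f y hy => ?_⟩
  · dsimp only
    split_ifs
    · exact ha l
    · exact contDiffOn_const (c := 0)
  · rw [H U f y hy, ← Finset.sum_subset (Finset.range_subset_range.2 (Nat.succ_le_succ hmn))]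
    · refine Finset.sum_congr rfl fun l hl => ?_
      simp only
      rw [if_pos (Nat.lt_succ_iff.1 (Finset.mem_range.1 hl))]
    · intro l _ hl
      simp only
      rw [if_neg (fun h => hl (Finset.mem_range.2 (Nat.lt_succ_of_le h)))]
      simp

theorem zero : HasOrderLE n (0 : LocalOperators I M) := fun x₀ =>
  ⟨⟨(chartAt H x₀).source, (chartAt H x₀).open_source⟩, mem_chart_source H x₀, subset_rfl,
    fun _ _ => 0, fun _ => contDiffOn_const, fun U f y _ => by simp⟩

theorem add (h : HasOrderLE n D) (h' : HasOrderLE n D') : HasOrderLE n (D + D') := by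
  intro x₀
  obtain ⟨W, hx, hW, a, ha, H⟩ := h x₀
  obtain ⟨W', hx', hW', a', ha', H'⟩ := h' x₀
  refine ⟨W ⊓ W', ⟨hx, hx'⟩, fun y hy => hW hy.1, fun k z => a k z + a' k z,
    fun k => ((ha k).mono (Set.image_mono fun y hy => hy.1)).add
      ((ha' k).mono (Set.image_mono fun y hy => hy.2)), fun U f y hy => ?_⟩
  have : (D + D') U f y = D U f y + D' U f y := rfl
  rw [this, H U f y hy.1, H' U f y hy.2, ← Finset.sum_add_distrib]
  rfl

theorem smul (c : 𝕜) (h : HasOrderLE n D) : HasOrderLE n (c • D) := by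
  intro x₀
  obtain ⟨W, hx, hW, a, ha, H⟩ := h x₀
  refine ⟨W, hx, hW, fun k z => c • a k z, fun k => (ha k).const_smul c,
    fun U f y hy => ?_⟩
  have : (c • D) U f y = c • D U f y := rfl
  rw [this, H U f y hy, Finset.smul_sum]
  rfl

theorem one : HasOrderLE n (1 : LocalOperators I M) := by
  refine HasOrderLE.mono (m := 0) ?_ (Nat.zero_le n)
  intro x₀
  refine ⟨⟨(chartAt H x₀).source, (chartAt H x₀).open_source⟩, mem_chart_source H x₀, subset_rfl,
    fun k _ => ContinuousMultilinearMap.apply 𝕜 (fun _ : Fin k => E) 𝕜 0,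
    fun _ => contDiffOn_const, fun U f y hy => ?_⟩
  have hy' : (y : M) ∈ (extChartAt I x₀).source := by rw [extChartAt_source]; exact hy
  simp only [zero_add, Finset.sum_range_one, ContinuousMultilinearMap.apply_apply,
    iteratedFDeriv_zero_apply, Function.comp_apply, (extChartAt I x₀).left_inv hy',
    extendZero_apply]
  rfl

theorem mul [IsManifold I ∞ M] [I.Boundaryless] (h : HasOrderLE m D) (h' : HasOrderLE n D') :
    HasOrderLE (m + n) (D * D') := by
  intro x₀
  obtain ⟨W₁, hx₁, hW₁, a, ha, hD⟩ := h x₀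
  obtain ⟨W₂, hx₂, hW₂, b, hb, hD'⟩ := h' x₀
  set W : Opens M := W₁ ⊓ W₂ with hWdef
  have hW : (W : Set M) ⊆ (chartAt H x₀).source := fun y hy => hW₁ hy.1
  set Ω : Set E := extChartAt I x₀ '' W with hΩdef
  have hΩ : IsOpen Ω := isOpen_extChartAt_image x₀ W.2 hW
  have ha : ∀ k, ContDiffOn 𝕜 ∞ (a k) Ω := fun k =>
    (ha k).mono (Set.image_mono fun y hy => hy.1)
  have hb : ∀ k, ContDiffOn 𝕜 ∞ (b k) Ω := fun k =>
    (hb k).mono (Set.image_mono fun y hy => hy.2)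
  let Φ : (E → 𝕜) → E → 𝕜 := fun g z =>
    ∑ l ∈ Finset.range (n + 1), b l z (iteratedFDeriv 𝕜 l g z)
  have hΦ : IsLocalDiffOp n Ω Φ := ⟨b, hb, fun _ _ _ _ _ _ _ => rfl⟩
  have hΨ : IsLocalDiffOp (m + n) Ω (fun g z => ∑ k ∈ Finset.range (m + 1),
      a k z (iteratedFDeriv 𝕜 k (Φ g) z)) :=
    IsLocalDiffOp.sum _ fun k hk => ((hΦ.iterated hΩ k).comp (ha k)).mono (by
      have := Finset.mem_range.1 hk; omega)
  obtain ⟨c, hc, hΨ⟩ := hΨ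
  refine ⟨W, ⟨hx₁, hx₂⟩, hW, c, hc, fun U f y hy => ?_⟩
  have hDD : (D * D') U f y = D U (D' U f) y := rfl
  have hVs : ((W ⊓ U : Opens M) : Set M) ⊆ (chartAt H x₀).source := fun y hy => hW hy.1
  have hV : IsOpen (extChartAt I x₀ '' ((W ⊓ U : Opens M) : Set M)) :=
    isOpen_extChartAt_image x₀ (W ⊓ U).2 hVs
  have hyV : extChartAt I x₀ y ∈ extChartAt I x₀ '' ((W ⊓ U : Opens M) : Set M) :=
    ⟨y, ⟨hy, y.2⟩, rfl⟩
  rw [hDD, hD U _ y hy.1, ← hΨ _ hV (Set.image_mono fun y hy => hy.1) _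
    (contDiffOn_extendZero_comp x₀ f hVs fun y hy => hy.2) _ hyV]
  refine Finset.sum_congr rfl fun k _ => ?_
  congr 1
  refine ((Filter.EventuallyEq.iteratedFDeriv 𝕜 ?_ k).eq_of_nhds)
  refine Filter.eventually_of_mem (hV.mem_nhds hyV) ?_
  rintro _ ⟨x, hx, rfl⟩
  have hxs : x ∈ (extChartAt I x₀).source := by rw [extChartAt_source]; exact hVs hx
  rw [Function.comp_apply, (extChartAt I x₀).left_inv hxs]
  exact (extendZero_apply _ ⟨x, hx.2⟩).trans (hD' U f ⟨x, hx.2⟩ hx.1.2)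

end HasOrderLE

/-- The pull-back `f ↦ f ∘ φ` of smooth functions on `U` to smooth functions on `φ⁻¹ U`. -/
def pullbackFun (φ : C^∞⟮I, M; I, M⟯) (U : Opens M) :
    C^∞⟮I, U; 𝕜⟯ →ₗ[𝕜] C^∞⟮I, Opens.comap ⟨φ, φ.contMDiff.continuous⟩ U; 𝕜⟯ where
  toFun f := ⟨fun x => f ⟨φ x, x.2⟩, fun x => by
    have h : ContMDiffAt I 𝓘(𝕜, 𝕜) ∞ (fun y : M => extendZero f (φ y)) x :=
      (contMDiffAt_extendZero f x.2).comp _ φ.contMDiff.contMDiffAt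
    rw [← contMDiffAt_subtype_iff] at h
    refine h.congr_of_eventuallyEq (Filter.Eventually.of_forall fun y => ?_)
    exact (extendZero_apply f ⟨φ y, y.2⟩).symm⟩
  map_add' _ _ := rfl
  map_smul' _ _ := rfl

/-- `D` commutes with the pull-back of functions by `φ`. -/
def IsInvariantUnder (φ : C^∞⟮I, M; I, M⟯) (D : LocalOperators I M) : Prop :=
  ∀ (U : Opens M) (f : C^∞⟮I, U; 𝕜⟯),
    D (Opens.comap ⟨φ, φ.contMDiff.continuous⟩ U) (pullbackFun φ U f) = pullbackFun φ U (D U f)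

/-- The operators that commute with the pull-back of functions by `φ`. -/
def invariantOperators (φ : C^∞⟮I, M; I, M⟯) : Subalgebra 𝕜 (LocalOperators I M) where
  carrier := {D | IsInvariantUnder φ D}
  mul_mem' {D D'} h h' U f := by
    have h1 : D' _ (pullbackFun φ U f) = pullbackFun φ U (D' U f) := h' U f
    change D _ (D' _ (pullbackFun φ U f)) = pullbackFun φ U (D U (D' U f))
    rw [h1]
    exact h U _
  add_mem' {D D'} h h' U f := by
    change D _ (pullbackFun φ U f) + D' _ (pullbackFun φ U f) = pullbackFun φ U (D U f + D' U f)
    rw [h U f, h' U f, map_add]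
  algebraMap_mem' c U f := (map_smul (pullbackFun φ U) c f).symm

variable (I M) in
/-- The algebra of differential operators (of finite order) on `M`. -/
def diffOps [IsManifold I ∞ M] [I.Boundaryless] : Subalgebra 𝕜 (LocalOperators I M) where
  carrier := {D | ∃ n, HasOrderLE n D}
  mul_mem' := by
    rintro D D' ⟨m, h⟩ ⟨n, h'⟩
    exact ⟨m + n, h.mul h'⟩
  add_mem' := by
    rintro D D' ⟨m, h⟩ ⟨n, h'⟩
    exact ⟨max m n, (h.mono (le_max_left m n)).add (h'.mono (le_max_right m n))⟩
  algebraMap_mem' c := ⟨0, by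
    rw [Algebra.algebraMap_eq_smul_one]
    exact HasOrderLE.one.smul c⟩

end Manifold

/-! ### Invariant differential operators on a Lie group -/

section LieGroup

variable {𝕜 E H : Type*} [RCLike 𝕜] [NormedAddCommGroup E] [NormedSpace 𝕜 E]
  [TopologicalSpace H] (I : ModelWithCorners 𝕜 E H) (G : Type*) [TopologicalSpace G]
  [ChartedSpace H G] [Group G] [LieGroup I ∞ G]

instance : LieGroup I (minSmoothness 𝕜 3) G := by
  rw [minSmoothness_of_isRCLikeNormedField]
  infer_instance

variable [I.Boundaryless]

/-- The algebra of left-invariant differential operators on `G`. -/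
def leftInvDiffOps : Subalgebra 𝕜 (LocalOperators I G) :=
  diffOps I G ⊓ ⨅ g : G, invariantOperators (𝑳 I g)

/-- The algebra of bi-invariant differential operators on `G`. -/
def biInvDiffOps : Subalgebra 𝕜 (LocalOperators I G) :=
  leftInvDiffOps I G ⊓ ⨅ g : G, invariantOperators (𝑹 I g)

/-- The left-invariant differential operators of order at most `n`. -/
def leftInvFiltration (n : ℕ) : Submodule 𝕜 (leftInvDiffOps I G) where
  carrier := {D | HasOrderLE n (D : LocalOperators I G)}
  add_mem' h h' := HasOrderLE.add h h'
  zero_mem' := HasOrderLE.zero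
  smul_mem' c _ h := HasOrderLE.smul c h

end LieGroup

end

/-! Poincaré–Birkhoff–Witt is a rewriting argument. Fix a totally ordered basis and rewrite a
descent `y x` (with `x < y`) inside a word as `x y + [y, x]`. The swap removes an inversion and the
bracket shortens the word, so this terminates in increasing words. The result does not depend on the
descent chosen (`map_tensorWord_descent_eq`): disjoint descents commute, and overlapping ones are
reconciled by the Jacobi identity. Hence the normal form kills all relators, and the coefficient of
each increasing word becomes a linear form on the enveloping algebra (`exists_envCoeff`). These
forms kill shorter words and are dual to the increasing words, so the images of the monomials of the
symmetric algebra are independent in the graded algebra. Surjectivity only uses that the graded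
algebra is commutative and generated in degree one.

The map `j` extends the Lie homomorphism `X ↦ X^L` by the universal property. A left-invariant
operator is determined by its values at the identity. If its order is at most `n`, those values
depend only on the Taylor polynomial of degree `n`, that is, on the monomials of degree at most `n`
in coordinates `x_i` vanishing at the identity. On the algebraic side, derivations dual to the `x_i`
act on these monomials triangularly: a word shorter than the degree of a monomial gives `0` at the
identity, and increasing words of the same length give `0` or a product of factorials. In
characteristic zero this pairing is therefore nondegenerate on `𝒰_n` and realizes arbitrary values
(`eq_zero_of_ev_monomial`, `exists_ev_monomial_eq`). This yields injectivity, surjectivity and the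
equality of filtrations; it needs only that ordered words span, not that they are independent.

For the center, put `ψ(h) = D(f ∘ c_h)(1)`, where `c_h` is conjugation by `h` and `D` is
left-invariant. Its derivative at the identity along `Y` is `(Y D f - D Y f)(1)`
(`mfderiv_chartFunctional_conj`). If `D` is bi-invariant, `ψ` is constant, so `D` commutes with
every `Y`. If `D` commutes with every `Y`, the derivative of `ψ` vanishes at the identity and,
replacing `f` by its conjugates, everywhere; connectedness makes `ψ` constant, which together with
left-invariance is right-invariance. -/

noncomputable section

/-! ### Normal forms of words in a basis of a Lie algebra -/

section NormalForm

/-- The number of inversions of a word in an ordered alphabet. -/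
def List.inversionCount {Λ : Type*} [LinearOrder Λ] : List Λ → ℕ
  | [] => 0
  | a :: l => l.countP (· < a) + inversionCount l

/-- Exchanging two adjacent letters does not affect their position relative to any other letter, so
only the inversion of the pair itself disappears. -/
theorem List.inversionCount_swap_lt {Λ : Type*} [LinearOrder Λ] (u v : List Λ) {a b : Λ}
    (h : a < b) : (u ++ a :: b :: v).inversionCount < (u ++ b :: a :: v).inversionCount := by
  induction u with
  | nil =>
    simp only [List.nil_append, List.inversionCount, List.countP_cons, h, h.asymm]
    simp
    omega
  | cons c u ih =>
    simp only [List.cons_append, List.inversionCount, List.countP_append, List.countP_cons]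
    omega

theorem List.Pairwise.not_descent {Λ : Type*} [LinearOrder Λ] {w : List Λ}
    (hw : w.Pairwise (· ≤ ·)) :
    ¬ ∃ (u : List Λ) (b a : Λ) (v : List Λ), w = u ++ b :: a :: v ∧ a < b := by
  rintro ⟨u, b, a, v, rfl, hab⟩
  have := (List.pairwise_append.1 hw).2.1
  exact absurd (List.rel_of_pairwise_cons this List.mem_cons_self) (not_le.2 hab)

variable {Λ R L : Type*} [LinearOrder Λ] [CommRing R] [LieRing L] [LieAlgebra R L]
  (b : Module.Basis Λ R L)

open Classical in
/-- The normal form of a word in the basis elements, a linear combination of weakly increasing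
words. A weakly increasing word is encoded by the multiset of its letters. -/
def normalWord : List Λ → (Multiset Λ →₀ R)
  | w =>
    -- The descent to rewrite is picked by choice; independence of this choice is the content of
    -- `normalForm_tensorRelator_basis`.
    if h : ∃ (u : List Λ) (y x : Λ) (v : List Λ), w = u ++ y :: x :: v ∧ x < y then
      have h1 : (h.choose ++ h.choose_spec.choose_spec.choose :: h.choose_spec.choose ::
          h.choose_spec.choose_spec.choose_spec.choose).length = w.length ∧
          (h.choose ++ h.choose_spec.choose_spec.choose :: h.choose_spec.choose ::
          h.choose_spec.choose_spec.choose_spec.choose).inversionCount < w.inversionCount := by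
        obtain ⟨hw, hlt⟩ := h.choose_spec.choose_spec.choose_spec.choose_spec
        constructor
        · conv_rhs => rw [hw]
          simp
        · conv_rhs => rw [hw]
          exact List.inversionCount_swap_lt _ _ hlt
      have h2 : ∀ z : Λ, (h.choose ++ z :: h.choose_spec.choose_spec.choose_spec.choose).length
          < w.length := fun z => by
        obtain ⟨hw, hlt⟩ := h.choose_spec.choose_spec.choose_spec.choose_spec
        conv_rhs => rw [hw]
        simp
      normalWord (h.choose ++ h.choose_spec.choose_spec.choose :: h.choose_spec.choose ::
          h.choose_spec.choose_spec.choose_spec.choose) +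
        (b.repr ⁅b h.choose_spec.choose, b h.choose_spec.choose_spec.choose⁆).sum fun z r =>
          r • normalWord (h.choose ++ z :: h.choose_spec.choose_spec.choose_spec.choose)
    else Finsupp.single (w : Multiset Λ) 1
-- Lexicographic order: the swap keeps the length and loses an inversion, while the bracket terms
-- are shorter but may have any number of inversions.
termination_by w => (w.length, w.inversionCount)
decreasing_by
  · exact Prod.Lex.right' _ h1.1.le h1.2
  · exact Prod.Lex.left _ _ (h2 z)

theorem normalWord_of_pairwise {w : List Λ} (hw : w.Pairwise (· ≤ ·)) :
    normalWord b w = Finsupp.single (w : Multiset Λ) 1 := by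
  rw [normalWord, dif_neg hw.not_descent]

/-- Hides the choices in the recursion: all that is used later is that the rewriting rule holds at
some descent. -/
theorem exists_normalWord_eq (w : List Λ)
    (h : ∃ (u : List Λ) (y x : Λ) (v : List Λ), w = u ++ y :: x :: v ∧ x < y) :
    ∃ (u : List Λ) (y x : Λ) (v : List Λ), w = u ++ y :: x :: v ∧ x < y ∧
      normalWord b w = normalWord b (u ++ x :: y :: v) +
        (b.repr ⁅b y, b x⁆).sum fun z r => r • normalWord b (u ++ z :: v) := by
  obtain ⟨hw, hlt⟩ := h.choose_spec.choose_spec.choose_spec.choose_spec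
  refine ⟨_, _, _, _, hw, hlt, ?_⟩
  conv_lhs => rw [normalWord, dif_pos h]

/-- The product of a word of elements of a module in its tensor algebra. -/
abbrev tensorWord (R : Type*) {L : Type*} [CommRing R] [AddCommGroup L] [Module R L]
    (w : List L) : TensorAlgebra R L :=
  (w.map (TensorAlgebra.ι R)).prod

theorem Module.Basis.tensorAlgebra_apply {Λ R M : Type*} [CommRing R] [AddCommGroup M]
    [Module R M] (b : Module.Basis Λ R M) (w : List Λ) :
    b.tensorAlgebra (FreeMonoid.ofList w) = tensorWord R (w.map b) := by
  have h : FreeAlgebra.equivMonoidAlgebraFreeMonoid.symm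
      (MonoidAlgebra.single (FreeMonoid.ofList w) (1 : R)) = (w.map (FreeAlgebra.ι R)).prod := by
    simp [FreeAlgebra.equivMonoidAlgebraFreeMonoid, FreeMonoid.lift_apply]
  have h' : b.tensorAlgebra (FreeMonoid.ofList w) = (TensorAlgebra.equivFreeAlgebra b).symm
      (FreeAlgebra.equivMonoidAlgebraFreeMonoid.symm
        (MonoidAlgebra.single (FreeMonoid.ofList w) (1 : R))) := by
    simp [Module.Basis.tensorAlgebra, FreeAlgebra.basisFreeMonoid]
  rw [h', h, map_list_prod, List.map_map, tensorWord, List.map_map]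
  congr 1
  refine List.map_congr_left fun a _ => ?_
  simp

/-- The linear extension of `normalWord` to the tensor algebra. -/
def normalForm : TensorAlgebra R L →ₗ[R] (Multiset Λ →₀ R) :=
  b.tensorAlgebra.constr R fun w => normalWord b w.toList

theorem normalForm_tensorWord (w : List Λ) :
    normalForm b (tensorWord R (w.map b)) = normalWord b w := by
  rw [← b.tensorAlgebra_apply, normalForm, Module.Basis.constr_basis]
  rfl

/-- The element `u (y x - x y - [y, x]) v` of the tensor algebra. -/
def tensorRelator (u : List L) (y x : L) (v : List L) : TensorAlgebra R L :=
  tensorWord R u * (TensorAlgebra.ι R y * TensorAlgebra.ι R x -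
    TensorAlgebra.ι R x * TensorAlgebra.ι R y - TensorAlgebra.ι R ⁅y, x⁆) * tensorWord R v

theorem tensorRelator_eq (u : List L) (y x : L) (v : List L) :
    (tensorRelator u y x v : TensorAlgebra R L) = tensorWord R (u ++ y :: x :: v) -
      tensorWord R (u ++ x :: y :: v) - tensorWord R (u ++ ⁅y, x⁆ :: v) := by
  simp only [tensorRelator, tensorWord, List.map_append, List.prod_append, List.map_cons,
    List.prod_cons]
  noncomm_ring

/-- Antisymmetry, together with the vanishing on equal arguments below, reduces all relators between
basis words to those at a descent. -/
theorem tensorRelator_swap (u : List L) (y x : L) (v : List L) :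
    (tensorRelator u x y v : TensorAlgebra R L) = -tensorRelator u y x v := by
  simp only [tensorRelator, ← lie_skew x y, map_neg]
  noncomm_ring

theorem tensorRelator_self (u : List L) (x : L) (v : List L) :
    (tensorRelator u x x v : TensorAlgebra R L) = 0 := by
  simp [tensorRelator]

/-- Expanding the bracket in the basis shows that killing the relator is the same as obeying the
rewriting rule at this descent. -/
theorem normalForm_tensorRelator (u : List Λ) (y x : Λ) (v : List Λ) :
    normalForm b (tensorRelator (u.map b) (b y) (b x) (v.map b)) =
      normalWord b (u ++ y :: x :: v) - (normalWord b (u ++ x :: y :: v) +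
        (b.repr ⁅b y, b x⁆).sum fun z r => r • normalWord b (u ++ z :: v)) := by
  have h : (tensorWord R (u.map b ++ ⁅b y, b x⁆ :: v.map b)) =
      (b.repr ⁅b y, b x⁆).sum fun z r => r • tensorWord R ((u ++ z :: v).map b) := by
    conv_lhs => rw [← b.linearCombination_repr ⁅b y, b x⁆]
    simp only [tensorWord, List.map_append, List.map_cons, List.prod_append, List.prod_cons,
      Finsupp.linearCombination_apply, Finsupp.sum, map_sum, Finset.sum_mul, Finset.mul_sum,
      map_smul, smul_mul_assoc, mul_smul_comm]
  rw [tensorRelator_eq, h, map_sub, map_sub, map_finsuppSum]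
  have e : ∀ (p q : Λ), u.map b ++ b p :: b q :: v.map b = (u ++ p :: q :: v).map b := by
    intro p q; simp
  rw [e, e, normalForm_tensorWord, normalForm_tensorWord, sub_sub]
  simp only [map_smul, normalForm_tensorWord]

/-- Multilinear expansion preserves the length, which lets inductions on the length pass from basis
words to arbitrary words. -/
theorem tensorWord_mem_span {Λ R M : Type*} [CommRing R] [AddCommGroup M]
    [Module R M] (b : Module.Basis Λ R M) (u : List M) :
    tensorWord R u ∈ Submodule.span R
      {t | ∃ u' : List Λ, u'.length = u.length ∧ tensorWord R (u'.map b) = t} := by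
  induction u with
  | nil => exact Submodule.subset_span ⟨[], rfl, rfl⟩
  | cons x u ih =>
    have hx : x ∈ Submodule.span R (Set.range b) := by simp [b.span_eq]
    rw [tensorWord, List.map_cons, List.prod_cons]
    change TensorAlgebra.ι R x * tensorWord R u ∈ _
    generalize tensorWord R u = t at ih
    induction hx using Submodule.span_induction with
    | mem x hx =>
      obtain ⟨i, rfl⟩ := hx
      induction ih using Submodule.span_induction with
      | mem t ht =>
        obtain ⟨u', hu', rfl⟩ := ht
        exact Submodule.subset_span ⟨i :: u', by simp [hu'], by simp [tensorWord]⟩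
      | zero => simp
      | add s t _ _ hs ht => rw [mul_add]; exact add_mem hs ht
      | smul r t _ ht => rw [mul_smul_comm]; exact Submodule.smul_mem _ _ ht
    | zero => simp
    | add y z _ _ hy hz => rw [map_add, add_mul]; exact add_mem hy hz
    | smul r y _ hy => rw [map_smul, smul_mul_assoc]; exact Submodule.smul_mem _ _ hy

/-- A linear map vanishing on all relators between basis words of given lengths vanishes on all
relators between words of these lengths. -/
theorem map_tensorRelator_eq_zero {V : Type*} [AddCommGroup V] [Module R V]
    (N : TensorAlgebra R L →ₗ[R] V) (u v : List L)
    (h : ∀ (u' v' : List Λ) (y x : Λ), u'.length = u.length → v'.length = v.length → x < y →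
      N (tensorRelator (u'.map b) (b y) (b x) (v'.map b)) = 0) (y x : L) :
    N (tensorRelator u y x v) = 0 := by
  -- The condition `x < y` is dropped by antisymmetry; what remains is multilinearity in all
  -- entries.
  have h : ∀ (u' v' : List Λ) (y x : Λ), u'.length = u.length → v'.length = v.length →
      N (tensorRelator (u'.map b) (b y) (b x) (v'.map b)) = 0 := by
    intro u' v' y x hu hv
    rcases lt_trichotomy x y with hxy | rfl | hxy
    · exact h u' v' y x hu hv hxy
    · rw [tensorRelator_self, map_zero]
    · rw [tensorRelator_swap, map_neg, h u' v' x y hu hv hxy, neg_zero]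
  have hu := tensorWord_mem_span b u
  have hv := tensorWord_mem_span b v
  have hx : x ∈ Submodule.span R (Set.range b) := by simp [b.span_eq]
  have hy : y ∈ Submodule.span R (Set.range b) := by simp [b.span_eq]
  unfold tensorRelator
  generalize tensorWord R u = s at hu
  generalize tensorWord R v = t at hv
  induction hu using Submodule.span_induction with
  | zero => simp
  | add s s' _ _ hs hs' => rw [add_mul, add_mul, map_add, hs, hs', add_zero]
  | smul r s _ hs => rw [smul_mul_assoc, smul_mul_assoc, map_smul, hs, smul_zero]
  | mem s hs =>
    obtain ⟨u', hu', rfl⟩ := hs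
    induction hv using Submodule.span_induction with
    | zero => simp
    | add s s' _ _ hs hs' => rw [mul_add, map_add, hs, hs', add_zero]
    | smul r s _ hs => rw [mul_smul_comm, map_smul, hs, smul_zero]
    | mem t ht =>
      obtain ⟨v', hv', rfl⟩ := ht
      induction hx using Submodule.span_induction with
      | zero => simp
      | add x x' _ _ hx hx' =>
        have := congr_arg₂ (· + ·) hx hx'
        simp only [← map_add, add_zero] at this
        rw [← this]
        congr 1
        simp only [lie_add, map_add]
        noncomm_ring
      | smul r x _ hx =>
        have := congr_arg (r • ·) hx
        simp only [← map_smul, smul_zero] at this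
        rw [← this]
        congr 1
        simp only [lie_smul, map_smul, smul_mul_assoc, mul_smul_comm, ← smul_sub]
      | mem x hx =>
        obtain ⟨x, rfl⟩ := hx
        induction hy using Submodule.span_induction with
        | zero => simp
        | add x x' _ _ hx hx' =>
          have := congr_arg₂ (· + ·) hx hx'
          simp only [← map_add, add_zero] at this
          rw [← this]
          congr 1
          simp only [add_lie, map_add]
          noncomm_ring
        | smul r x _ hx =>
          have := congr_arg (r • ·) hx
          simp only [← map_smul, smul_zero] at this
          rw [← this]
          congr 1
          simp only [smul_lie, map_smul, smul_mul_assoc, mul_smul_comm, ← smul_sub]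
        | mem y hy =>
          obtain ⟨y, rfl⟩ := hy
          exact h u' v' y x hu' hv'

/-! ### Confluence of the rewriting. -/

theorem map_tensorRelator_eq_zero_iff {V : Type*} [AddCommGroup V] [Module R V]
    (N : TensorAlgebra R L →ₗ[R] V) (u v : List L) (y x : L) :
    N (tensorRelator u y x v) = 0 ↔ N (tensorWord R (u ++ y :: x :: v)) =
      N (tensorWord R (u ++ x :: y :: v)) + N (tensorWord R (u ++ ⁅y, x⁆ :: v)) := by
  rw [tensorRelator_eq, map_sub, map_sub, sub_sub, sub_eq_zero]

theorem map_tensorWord_add {V : Type*} [AddCommGroup V] [Module R V]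
    (N : TensorAlgebra R L →ₗ[R] V) (u v : List L) (y x : L) :
    N (tensorWord R (u ++ (y + x) :: v)) =
      N (tensorWord R (u ++ y :: v)) + N (tensorWord R (u ++ x :: v)) := by
  rw [← map_add]
  congr 1
  simp only [tensorWord, List.map_append, List.prod_append, List.map_cons, List.prod_cons, map_add]
  noncomm_ring

/-- Two descents of a word give the same result, if the first one is not to the right of the second
one and all relators of smaller words are mapped to zero. -/
theorem map_tensorWord_descent_eq {V : Type*} [AddCommGroup V] [Module R V]
    (N : TensorAlgebra R L →ₗ[R] V) {n k : ℕ}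
    (hn : ∀ (u v : List L) (y x : L), u.length + v.length + 2 < n →
      N (tensorRelator u y x v) = 0)
    (hk : ∀ (u v : List Λ) (y x : Λ), (u ++ y :: x :: v).length = n →
      (u ++ y :: x :: v).inversionCount < k → x < y →
      N (tensorRelator (u.map b) (b y) (b x) (v.map b)) = 0)
    {u v u' v' : List Λ} {y x y' x' : Λ} (hxy : x < y) (hxy' : x' < y')
    (hw : (u ++ y :: x :: v).length = n) (hw' : (u ++ y :: x :: v).inversionCount = k)
    {t : List Λ} (hu : u' = u ++ t) (hv : y :: x :: v = t ++ y' :: x' :: v') :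
    N (tensorWord R ((u ++ x :: y :: v).map b)) +
        N (tensorWord R (u.map b ++ ⁅b y, b x⁆ :: v.map b)) =
      N (tensorWord R ((u' ++ x' :: y' :: v').map b)) +
        N (tensorWord R (u'.map b ++ ⁅b y', b x'⁆ :: v'.map b)) := by
  simp only [map_tensorRelator_eq_zero_iff] at hn hk
  -- `t` is the offset between the descents: none if they coincide, one letter if they overlap, at
  -- least two if they are disjoint.
  match t, hv with
  | [], hv =>
    simp only [List.nil_append, List.cons.injEq] at hv
    obtain ⟨rfl, rfl, rfl⟩ := hv
    simp [hu]
  | [c], hv =>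
    simp only [List.cons_append, List.nil_append, List.cons.injEq] at hv
    obtain ⟨rfl, rfl, rfl⟩ := hv
    subst hu
    have i1 := List.inversionCount_swap_lt u (x' :: v') hxy
    have i2 := List.inversionCount_swap_lt (u ++ [x]) v' (hxy'.trans hxy)
    have i3 := List.inversionCount_swap_lt (u ++ [y]) v' hxy'
    have i4 := List.inversionCount_swap_lt u (x :: v') (hxy'.trans hxy)
    simp only [List.append_assoc, List.cons_append, List.nil_append] at i1 i2 i3 i4
    -- The overlap is `y x x'` with `x' < x < y`. Both branches are sorted to `x' x y`: `e1`, `e2`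
    -- continue the branch that swapped `y x`, and `e3`, `e4` the one that swapped `x x'`. All these
    -- words have fewer inversions.
    have e1 := hk (u ++ [x]) v' y x' (by simp at hw ⊢; omega) (by simp; omega) (hxy'.trans hxy)
    have e2 := hk u (y :: v') x x' (by simp at hw ⊢; omega) (by omega) hxy'
    have e3 := hk u (x :: v') y x' (by simp at hw ⊢; omega) (by omega) (hxy'.trans hxy)
    have e4 := hk (u ++ [x']) v' y x (by simp at hw ⊢; omega) (by simp; omega) hxy
    have f1 := hn (u.map b) (v'.map b) ⁅b x, b x'⁆ (b y) (by simp at hw ⊢; omega)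
    have f2 := hn (u.map b) (v'.map b) ⁅b y, b x⁆ (b x') (by simp at hw ⊢; omega)
    have f3 := hn (u.map b) (v'.map b) ⁅b y, b x'⁆ (b x) (by simp at hw ⊢; omega)
    -- After `f1`, `f2`, `f3` reorder the shorter words containing one bracket, the branches differ
    -- exactly by these double brackets.
    have jac : ⁅⁅b y, b x'⁆, b x⁆ = ⁅⁅b x, b x'⁆, b y⁆ + ⁅⁅b y, b x⁆, b x'⁆ := by
      rw [← lie_skew ⁅b y, b x'⁆ (b x), leibniz_lie, ← lie_skew (b y) ⁅b x, b x'⁆,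
        ← lie_skew (b x) (b y), neg_lie]
      abel
    rw [jac, map_tensorWord_add] at f3
    simp only [List.map_append, List.map_cons, List.map_nil, List.append_assoc, List.cons_append,
      List.nil_append] at e1 e2 e3 e4 ⊢
    rw [e1, e2, e3, e4, f1, f2, f3]
    abel
  | c :: d :: t, hv =>
    simp only [List.cons_append, List.cons.injEq] at hv
    obtain ⟨rfl, rfl, rfl⟩ := hv
    subst hu
    have i1 := List.inversionCount_swap_lt u (t ++ y' :: x' :: v') hxy
    have i2 := List.inversionCount_swap_lt (u ++ y :: x :: t) v' hxy'
    simp only [List.append_assoc, List.cons_append] at i1 i2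
    -- Each rewriting remains possible after the other: after a swap because inversions dropped
    -- (`e1`, `e2`), after a bracket because the word is shorter (`f1`, `f2`).
    have e1 := hk (u ++ x :: y :: t) v' y' x' (by simp at hw ⊢; omega) (by simp; omega) hxy'
    have e2 := hk u (t ++ x' :: y' :: v') y x (by simp at hw ⊢; omega) (by omega) hxy
    have f1 := hn (u.map b ++ ⁅b y, b x⁆ :: t.map b) (v'.map b) (b y') (b x')
      (by simp at hw ⊢; omega)
    have f2 := hn (u.map b) (t.map b ++ ⁅b y', b x'⁆ :: v'.map b) (b y) (b x)
      (by simp at hw ⊢; omega)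
    simp only [List.map_append, List.map_cons, List.append_assoc, List.cons_append] at e1 e2 f1 f2 ⊢
    rw [e1, e2, f1, f2]
    abel

/-- A diamond lemma, by induction on the length and then on the number of inversions. The normal
form obeys the rule at its own chosen descent by definition, and the comparison of two descents
transfers the rule to any other. -/
theorem normalForm_tensorRelator_basis (n : ℕ) : ∀ (k : ℕ) (u v : List Λ) (y x : Λ),
    (u ++ y :: x :: v).length = n → (u ++ y :: x :: v).inversionCount = k → x < y →
      normalForm b (tensorRelator (u.map b) (b y) (b x) (v.map b)) = 0 := by
  induction n using Nat.strong_induction_on with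
  | _ n ihn =>
  have hn : ∀ (u v : List L) (y x : L), u.length + v.length + 2 < n →
      normalForm b (tensorRelator u y x v) = 0 := fun u v y x h =>
    map_tensorRelator_eq_zero b _ u v (fun u' v' y x hu hv hxy =>
      ihn (u' ++ y :: x :: v').length (by simp; omega) _ u' v' y x rfl rfl hxy) y x
  intro k
  induction k using Nat.strong_induction_on with
  | _ k ihk =>
  have hk : ∀ (u v : List Λ) (y x : Λ), (u ++ y :: x :: v).length = n →
      (u ++ y :: x :: v).inversionCount < k → x < y →
      normalForm b (tensorRelator (u.map b) (b y) (b x) (v.map b)) = 0 :=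
    fun u v y x h1 h2 h3 => ihk _ h2 u v y x h1 rfl h3
  intro u v y x hw hw' hxy
  obtain ⟨u', y', x', v', he, hxy', hN⟩ := exists_normalWord_eq b _ ⟨u, y, x, v, rfl, hxy⟩
  have h1 := normalForm_tensorRelator b u' y' x' v'
  rw [← he, hN, sub_self, map_tensorRelator_eq_zero_iff] at h1
  rw [map_tensorRelator_eq_zero_iff]
  have e : ∀ (u v : List Λ) (p q : Λ), u.map b ++ b p :: b q :: v.map b = (u ++ p :: q :: v).map b :=
    by intros; simp
  rw [e, e] at h1 ⊢
  rw [he, h1]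
  -- Either of the given and the chosen descent may be the left one.
  rcases List.append_eq_append_iff.1 he with ⟨t, h2, h3⟩ | ⟨t, h2, h3⟩
  · exact (map_tensorWord_descent_eq b _ hn hk hxy hxy' hw hw' h2 h3).symm
  · exact map_tensorWord_descent_eq b _ hn hk hxy' hxy (he ▸ hw) (he ▸ hw') h2 h3

theorem normalForm_tensorRelator_eq_zero (u v : List L) (y x : L) :
    normalForm b (tensorRelator u y x v) = 0 :=
  map_tensorRelator_eq_zero b _ u v
    (fun u' v' y x _ _ hxy => normalForm_tensorRelator_basis b _ _ u' v' y x rfl rfl hxy) y x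

/-- Rewriting never lengthens a word; this makes the coefficient of an increasing word vanish on all
shorter words. -/
theorem normalWord_card_le (n : ℕ) : ∀ (k : ℕ) (w : List Λ), w.length = n → w.inversionCount = k →
    ∀ s ∈ (normalWord b w).support, Multiset.card s ≤ n := by
  induction n using Nat.strong_induction_on with
  | _ n ihn =>
  intro k
  induction k using Nat.strong_induction_on with
  | _ k ihk =>
  intro w hw hk s hs
  by_cases h : ∃ (u : List Λ) (y x : Λ) (v : List Λ), w = u ++ y :: x :: v ∧ x < y
  · obtain ⟨u, y, x, v, rfl, hxy, hN⟩ := exists_normalWord_eq b w h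
    rw [hN] at hs
    classical
    rcases Finset.mem_union.1 (Finsupp.support_add hs) with hs | hs
    · exact ihk _ (hk ▸ List.inversionCount_swap_lt u v hxy) _ (by simpa using hw) rfl s hs
    · rw [Finsupp.sum] at hs
      obtain ⟨z, -, hz⟩ := Finset.mem_biUnion.1 (Finsupp.support_finsetSum hs)
      have := ihn (u ++ z :: v).length (by simp at hw ⊢; omega) _ _ rfl rfl s
        (Finsupp.support_smul hz)
      simp at hw this
      omega
  · rw [normalWord, dif_neg h] at hs
    have := Finset.mem_singleton.1 (Finsupp.support_single_subset hs)
    simp [this, hw]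

/-- The congruence on the tensor algebra given by the largest two-sided ideal in the kernel of the
linear map `N`. -/
def kerRingCon {V : Type*} [AddCommGroup V] [Module R V] (N : TensorAlgebra R L →ₗ[R] V) :
    RingCon (TensorAlgebra R L) where
  r a c := ∀ s t, N (s * a * t) = N (s * c * t)
  iseqv := ⟨fun _ _ _ => rfl, fun h s t => (h s t).symm, fun h h' s t => (h s t).trans (h' s t)⟩
  add' h h' s t := by
    simp only [mul_add, add_mul, map_add]
    rw [h, h']
  mul' {w x y z} h h' s t := by
    have h1 := h s (y * t)
    have h2 := h' (s * x) t
    simp only [mul_assoc] at h1 h2 ⊢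
    rw [h1, h2]

/-- The outer factors `s`, `t` in the congruence are combinations of words, so it is enough to test
relators placed between words. -/
theorem kerRingCon_of_tensorRelator {V : Type*} [AddCommGroup V] [Module R V]
    (N : TensorAlgebra R L →ₗ[R] V) (h : ∀ (u v : List L) (y x : L), N (tensorRelator u y x v) = 0)
    (y x : L) : kerRingCon N (TensorAlgebra.ι R ⁅y, x⁆)
      (TensorAlgebra.ι R y * TensorAlgebra.ι R x - TensorAlgebra.ι R x * TensorAlgebra.ι R y) := by
  have span : ∀ t : TensorAlgebra R L,
      t ∈ Submodule.span R (Set.range (tensorWord R : List L → TensorAlgebra R L)) := by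
    intro t
    induction t using TensorAlgebra.induction with
    | algebraMap r =>
      rw [Algebra.algebraMap_eq_smul_one]
      exact Submodule.smul_mem _ _ (Submodule.subset_span ⟨[], rfl⟩)
    | ι x => exact Submodule.subset_span ⟨[x], by simp [tensorWord]⟩
    | add a c ha hc => exact add_mem ha hc
    | mul a c ha hc =>
      have := Submodule.mul_mem_mul ha hc
      rw [Submodule.span_mul_span] at this
      refine Submodule.span_mono ?_ this
      rintro _ ⟨_, ⟨u, rfl⟩, _, ⟨v, rfl⟩, rfl⟩
      exact ⟨u ++ v, by simp [tensorWord]⟩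
  intro s t
  rw [eq_comm, ← sub_eq_zero, ← map_sub]
  have : s * (TensorAlgebra.ι R y * TensorAlgebra.ι R x - TensorAlgebra.ι R x *
      TensorAlgebra.ι R y) * t - s * TensorAlgebra.ι R ⁅y, x⁆ * t = s * (TensorAlgebra.ι R y *
      TensorAlgebra.ι R x - TensorAlgebra.ι R x * TensorAlgebra.ι R y -
      TensorAlgebra.ι R ⁅y, x⁆) * t := by noncomm_ring
  rw [this]
  induction span s using Submodule.span_induction with
  | zero => simp
  | add s s' _ _ hs hs' =>
    rw [add_mul, add_mul, map_add, hs (by noncomm_ring), hs' (by noncomm_ring), add_zero]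
  | smul r s _ hs => rw [smul_mul_assoc, smul_mul_assoc, map_smul, hs (by noncomm_ring), smul_zero]
  | mem s hs =>
    obtain ⟨u, rfl⟩ := hs
    induction span t using Submodule.span_induction with
    | zero => simp
    | add s s' _ _ hs hs' =>
      rw [mul_add, map_add, hs (by noncomm_ring), hs' (by noncomm_ring), add_zero]
    | smul r s _ hs => rw [mul_smul_comm, map_smul, hs (by noncomm_ring), smul_zero]
    | mem t ht =>
      obtain ⟨v, rfl⟩ := ht
      exact h u v y x

/-- The product of a word of elements of a Lie algebra in its enveloping algebra. -/
abbrev envWord (R : Type*) {L : Type*} [CommRing R] [LieRing L] [LieAlgebra R L]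
    (w : List L) : UniversalEnvelopingAlgebra R L :=
  (w.map (UniversalEnvelopingAlgebra.ι R)).prod

attribute [local instance 100] LieRing.ofAssociativeRing in
/-- A linear map on the tensor algebra that vanishes on all relators factors through the enveloping
algebra. -/
theorem exists_linearMap_envWord {V : Type*} [AddCommGroup V] [Module R V]
    (N : TensorAlgebra R L →ₗ[R] V)
    (h : ∀ (u v : List L) (y x : L), N (tensorRelator u y x v) = 0) :
    ∃ N' : UniversalEnvelopingAlgebra R L →ₗ[R] V, ∀ w : List L,
      N' (envWord R w) = N (tensorWord R w) := by
  -- `N` is not multiplicative, so the universal property does not apply to it directly. It applies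
  -- to the map into the quotient algebra by the largest ideal inside `ker N`, and `N` descends to
  -- that quotient.
  let c := kerRingCon N
  let f : L →ₗ⁅R⁆ c.Quotient :=
    { (RingCon.mkₐ R c).toLinearMap.comp (TensorAlgebra.ι R) with
      map_lie' := fun {y x} => by
        have := (RingCon.eq c).2 (kerRingCon_of_tensorRelator N h y x)
        rw [LieRing.of_associative_ring_bracket]
        exact this }
  let g : c.Quotient →+ V :=
    { toFun := fun q => Quotient.liftOn' q N fun a a' haa => by
        have := (show c a a' from haa) 1 1
        simpa using this
      map_zero' := map_zero N
      map_add' := by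
        rintro ⟨a⟩ ⟨a'⟩
        exact map_add N a a' }
  let g' : c.Quotient →ₗ[R] V :=
    { g with
      map_smul' := by
        rintro r ⟨a⟩
        exact map_smul N r a }
  refine ⟨g'.comp (UniversalEnvelopingAlgebra.lift R f).toLinearMap, fun w => ?_⟩
  have e : UniversalEnvelopingAlgebra.lift R f (envWord R w) = RingCon.mkₐ R c (tensorWord R w) := by
    rw [envWord, tensorWord, map_list_prod, map_list_prod, List.map_map, List.map_map]
    congr 1
    refine List.map_congr_left fun x _ => ?_
    exact UniversalEnvelopingAlgebra.lift_ι_apply R f x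
  rw [LinearMap.comp_apply, AlgHom.toLinearMap_apply, e]
  rfl

/-- Existence of normal forms in the enveloping algebra: the linear form "coefficient of the
increasing word `s` in the normal form". -/
theorem exists_envCoeff (s : Multiset Λ) :
    ∃ N : UniversalEnvelopingAlgebra R L →ₗ[R] R,
      (∀ w : List L, w.length < Multiset.card s → N (envWord R w) = 0) ∧
      ∀ w : List Λ, w.Pairwise (· ≤ ·) → N (envWord R (w.map b)) = if (w : Multiset Λ) = s then 1 else 0 := by
  classical
  obtain ⟨N, hN⟩ := exists_linearMap_envWord (normalForm b) (normalForm_tensorRelator_eq_zero b)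
  refine ⟨(Finsupp.lapply s).comp N, fun w hw => ?_, fun w hw => ?_⟩
  · rw [LinearMap.comp_apply, hN, Finsupp.lapply_apply]
    have hw' := tensorWord_mem_span b w
    generalize tensorWord R w = t at hw'
    induction hw' using Submodule.span_induction with
    | zero => simp
    | add x y _ _ hx hy => simp [hx, hy]
    | smul r x _ hx => simp [hx]
    | mem t ht =>
      obtain ⟨u, hu, rfl⟩ := ht
      rw [normalForm_tensorWord]
      by_contra hne
      have := normalWord_card_le b _ _ u rfl rfl s (Finsupp.mem_support_iff.2 hne)
      omega
  · rw [LinearMap.comp_apply, hN, Finsupp.lapply_apply, normalForm_tensorWord,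
      normalWord_of_pairwise b hw, Finsupp.single_apply]

end NormalForm

/-! ### The filtration of the enveloping algebra by words -/

section Filtration

variable {R L : Type*} [CommRing R] [LieRing L] [LieAlgebra R L]

theorem range_ι_pow_eq_span {R M : Type*} [CommRing R] [AddCommGroup M] [Module R M] (k : ℕ) :
    (LinearMap.range (TensorAlgebra.ι R : M →ₗ[R] TensorAlgebra R M)) ^ k =
      Submodule.span R (tensorWord R '' {w : List M | w.length = k}) := by
  induction k with
  | zero =>
    rw [pow_zero, Submodule.one_eq_span]
    congr 1
    ext t
    simp [tensorWord]
  | succ k ih =>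
    rw [pow_succ', ih]
    conv_lhs => rw [← Submodule.span_eq (LinearMap.range (TensorAlgebra.ι R)),
      Submodule.span_mul_span]
    congr 1
    ext t
    constructor
    · rintro ⟨_, ⟨x, rfl⟩, _, ⟨w, hw, rfl⟩, rfl⟩
      exact ⟨x :: w, by simpa using hw, by simp [tensorWord]⟩
    · rintro ⟨_ | ⟨x, w⟩, hw, rfl⟩
      · simp at hw
      · exact ⟨_, ⟨x, rfl⟩, _, ⟨w, by simpa using hw, rfl⟩, by simp [tensorWord]⟩

theorem mkAlgHom_tensorWord (w : List L) :
    UniversalEnvelopingAlgebra.mkAlgHom R L (tensorWord R w) = envWord R w := by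
  rw [tensorWord, map_list_prod, List.map_map]
  rfl

theorem envFiltration_eq_span (n : ℕ) :
    envFiltration R L n = Submodule.span R (envWord R '' {w : List L | w.length ≤ n}) := by
  have h : (⨆ k : Fin (n + 1), (LinearMap.range (TensorAlgebra.ι R : L →ₗ[R] TensorAlgebra R L)) ^
      (k : ℕ)) = Submodule.span R (tensorWord R '' {w : List L | w.length ≤ n}) := by
    simp only [range_ι_pow_eq_span, ← Submodule.span_iUnion]
    congr 1
    ext t
    simp only [Set.mem_iUnion]
    constructor
    · rintro ⟨k, w, hw, rfl⟩
      exact ⟨w, by have := k.2; simp at hw ⊢; omega, rfl⟩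
    · rintro ⟨w, hw, rfl⟩
      exact ⟨⟨w.length, Nat.lt_succ_of_le hw⟩, w, rfl, rfl⟩
  rw [envFiltration, h, Submodule.map_span, ← Set.image_comp]
  congr 1
  refine Set.image_congr fun w _ => mkAlgHom_tensorWord w

theorem envWord_mem {w : List L} {n : ℕ} (h : w.length ≤ n) :
    envWord R w ∈ envFiltration R L n := by
  rw [envFiltration_eq_span]
  exact Submodule.subset_span ⟨w, h, rfl⟩

theorem envWord_mem_pred {w : List L} {n : ℕ} (h : w.length < n) :
    envWord R w ∈ filtrationPred (envFiltration R L) n := by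
  cases n with
  | zero => omega
  | succ n => exact envWord_mem (Nat.le_of_lt_succ h)

theorem filtrationPred_mono {R A : Type*} [CommRing R] [Ring A] [Algebra R A]
    (F : ℕ → Submodule R A) (hF : Monotone F) : Monotone (filtrationPred F) := by
  intro m n h
  cases m with
  | zero => exact bot_le
  | succ m =>
    cases n with
    | zero => omega
    | succ n => exact hF (Nat.le_of_succ_le_succ h)

theorem filtrationPred_envFiltration_eq_span (n : ℕ) :
    filtrationPred (envFiltration R L) n =
      Submodule.span R (envWord R '' {w : List L | w.length < n}) := by
  cases n with
  | zero => simp [filtrationPred]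
  | succ n =>
    rw [filtrationPred, envFiltration_eq_span]
    simp

/-- An adjacent swap changes the product by a word in which two letters are replaced by their
bracket, hence by a shorter one. -/
theorem envWord_perm {w w' : List L} (h : w.Perm w') :
    envWord R w - envWord R w' ∈ filtrationPred (envFiltration R L) w.length := by
  induction h with
  | nil => simp
  | cons x h ih =>
    have h1 := mul_filtrationPred_mem (envFiltration R L) (envWord_mem (R := R) (w := [x]) le_rfl) ih
    simp only [List.length_cons, List.length_nil, mul_sub, zero_add] at h1 ⊢
    rw [add_comm]
    simpa [envWord] using h1
  | swap x y w =>
    have : envWord R (y :: x :: w) - envWord R (x :: y :: w) = envWord R (⁅y, x⁆ :: w) := by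
      simp only [envWord, List.map_cons, List.prod_cons, LieHom.map_lie,
        LieRing.of_associative_ring_bracket]
      noncomm_ring
    rw [this]
    exact envWord_mem_pred (by simp)
  | trans h h' ih ih' =>
    rw [← h.length_eq] at ih'
    simpa using add_mem ih ih'

theorem exists_mem_envFiltration (u : UniversalEnvelopingAlgebra R L) :
    ∃ n, u ∈ envFiltration R L n := by
  obtain ⟨t, rfl⟩ : ∃ t, UniversalEnvelopingAlgebra.mkAlgHom R L t = u := by
    unfold UniversalEnvelopingAlgebra.mkAlgHom
    exact RingCon.mkₐ_surjective _ u
  induction t using TensorAlgebra.induction with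
  | algebraMap r =>
    refine ⟨0, ?_⟩
    rw [AlgHom.commutes, Algebra.algebraMap_eq_smul_one]
    exact Submodule.smul_mem _ _ (envWord_mem (w := []) le_rfl)
  | ι x => exact ⟨1, ι_mem_envFiltration R L x⟩
  | mul a c ha hc =>
    obtain ⟨m, hm⟩ := ha
    obtain ⟨n, hn⟩ := hc
    exact ⟨m + n, by rw [map_mul]; exact SetLike.mul_mem_graded hm hn⟩
  | add a c ha hc =>
    obtain ⟨m, hm⟩ := ha
    obtain ⟨n, hn⟩ := hc
    refine ⟨max m n, ?_⟩
    rw [map_add]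
    exact add_mem (envFiltration_mono R L (le_max_left m n) hm)
      (envFiltration_mono R L (le_max_right m n) hn)

/-- The product in the enveloping algebra of the increasing word in the basis with the given
multiset of letters. -/
def orderedWord {Λ : Type*} [LinearOrder Λ] (b : Module.Basis Λ R L) (s : Multiset Λ) :
    UniversalEnvelopingAlgebra R L :=
  envWord R ((s.sort (· ≤ ·)).map b)

theorem orderedWord_mem {Λ : Type*} [LinearOrder Λ] (b : Module.Basis Λ R L) {s : Multiset Λ}
    {n : ℕ} (h : Multiset.card s ≤ n) : orderedWord b s ∈ envFiltration R L n :=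
  envWord_mem (by simpa using h)

theorem envWord_mem_span_basis {Λ : Type*} (b : Module.Basis Λ R L) (w : List L) :
    envWord R w ∈ Submodule.span R
      ((fun u : List Λ => envWord R (u.map b)) '' {u | u.length = w.length}) := by
  have := Submodule.mem_map_of_mem (f := (UniversalEnvelopingAlgebra.mkAlgHom R L).toLinearMap)
    (tensorWord_mem_span b w)
  rw [AlgHom.toLinearMap_apply, mkAlgHom_tensorWord, Submodule.map_span] at this
  refine Submodule.span_mono ?_ this
  rintro _ ⟨_, ⟨u, hu, rfl⟩, rfl⟩
  exact ⟨u, hu, (mkAlgHom_tensorWord _).symm⟩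

/-- The ordered words of length `n` span the `n`-th piece of the filtration modulo the
preceding one. -/
theorem envFiltration_le_orderedWord {Λ : Type*} [LinearOrder Λ] (b : Module.Basis Λ R L) (n : ℕ) :
    envFiltration R L n ≤ Submodule.span R (orderedWord b '' {s | Multiset.card s = n}) ⊔
      filtrationPred (envFiltration R L) n := by
  rw [envFiltration_eq_span, Submodule.span_le]
  rintro _ ⟨w, hw, rfl⟩
  rcases lt_or_eq_of_le (show w.length ≤ n from hw) with hw | hw
  · exact Submodule.mem_sup_right (envWord_mem_pred hw)
  · refine Submodule.span_le.2 ?_ (envWord_mem_span_basis b w)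
    rintro _ ⟨u, hu, rfl⟩
    have hu : u.length = n := (show u.length = w.length from hu).trans hw
    have h1 := envWord_perm (R := R) ((Multiset.coe_eq_coe.1
      (Multiset.sort_eq (u : Multiset Λ) (· ≤ ·))).symm.map b)
    rw [List.length_map, hu] at h1
    have := add_mem (Submodule.mem_sup_right h1) (Submodule.mem_sup_left (Submodule.subset_span
      (Set.mem_image_of_mem (orderedWord b) (show (u : Multiset Λ) ∈ {s | Multiset.card s = n} by
        simpa using hu))))
    rwa [orderedWord, sub_add_cancel] at this

end Filtration

/-! ### The Poincaré–Birkhoff–Witt theorem -/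

section PBW

variable {R L : Type*} [CommRing R] [LieRing L] [LieAlgebra R L]

/-- On words, the two products are permutations of one concatenated word. This is what makes the
graded algebra commutative. -/
theorem commutator_mem_filtrationPred {m n : ℕ} {a c : UniversalEnvelopingAlgebra R L}
    (ha : a ∈ envFiltration R L m) (hc : c ∈ envFiltration R L n) :
    a * c - c * a ∈ filtrationPred (envFiltration R L) (m + n) := by
  rw [envFiltration_eq_span] at ha hc
  induction ha using Submodule.span_induction with
  | zero => simp
  | add x y _ _ hx hy =>
    have := add_mem hx hy
    convert this using 1
    noncomm_ring
  | smul r x _ hx =>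
    rw [smul_mul_assoc, mul_smul_comm, ← smul_sub]
    exact Submodule.smul_mem _ _ hx
  | mem x hx =>
    obtain ⟨w, hw, rfl⟩ := hx
    induction hc using Submodule.span_induction with
    | zero => simp
    | add x y _ _ hx hy =>
      have := add_mem hx hy
      convert this using 1
      noncomm_ring
    | smul r x _ hx =>
      rw [smul_mul_assoc, mul_smul_comm, ← smul_sub]
      exact Submodule.smul_mem _ _ hx
    | mem x hx =>
      obtain ⟨w', hw', rfl⟩ := hx
      have h := envWord_perm (R := R) (List.perm_append_comm (l₁ := w) (l₂ := w'))
      refine filtrationPred_mono _ (envFiltration_mono R L) ?_ (?_ : _ ∈ filtrationPred _ (w ++ w').length)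
      · simp at hw hw' ⊢; omega
      · simpa [envWord] using h

theorem associatedGraded_mul_comm (p q : AssociatedGraded (envFiltration R L)) :
    p * q = q * p := by
  induction p using DirectSum.induction_on with
  | zero => simp
  | add x y hx hy => rw [add_mul, mul_add, hx, hy]
  | of m p =>
    induction q using DirectSum.induction_on with
    | zero => simp
    | add x y hx hy => rw [add_mul, mul_add, hx, hy]
    | of n q =>
      obtain ⟨a, rfl⟩ := GrPiece.mk_surjective _ m p
      obtain ⟨c, rfl⟩ := GrPiece.mk_surjective _ n q
      rw [DirectSum.of_mul_of, DirectSum.of_mul_of]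
      refine DirectSum.of_eq_of_gradedMonoid_eq ?_
      change GradedMonoid.mk (A := GrPiece (envFiltration R L)) (m + n)
        (GrPiece.mk _ (m + n) ⟨(a * c : UniversalEnvelopingAlgebra R L),
          SetLike.mul_mem_graded a.2 c.2⟩) = GradedMonoid.mk (n + m)
        (GrPiece.mk _ (n + m) ⟨(c * a : UniversalEnvelopingAlgebra R L),
          SetLike.mul_mem_graded c.2 a.2⟩)
      -- The two products lie in the pieces indexed by `m + n` and `n + m`; one is moved to the
      -- other index before they can be subtracted.
      have hca : (c * a : UniversalEnvelopingAlgebra R L) ∈ envFiltration R L (m + n) := by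
        rw [add_comm]; exact SetLike.mul_mem_graded c.2 a.2
      rw [← GrPiece.sigma_ext (envFiltration R L) (add_comm m n) ⟨c * a, hca⟩
        ⟨c * a, SetLike.mul_mem_graded c.2 a.2⟩ rfl]
      congr 1
      rw [← sub_eq_zero, ← map_sub, GrPiece.mk_eq_zero]
      exact commutator_mem_filtrationPred a.2 c.2

instance : CommRing (AssociatedGraded (envFiltration R L)) :=
  { (inferInstance : Ring (AssociatedGraded (envFiltration R L))) with
    mul_comm := associatedGraded_mul_comm }

variable (R L) in
/-- The canonical homomorphism from the symmetric algebra to the associated graded algebra of the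
enveloping algebra. -/
def symmetricToGraded : SymmetricAlgebra R L →ₐ[R] AssociatedGraded (envFiltration R L) :=
  SymmetricAlgebra.lift
    ((DirectSum.lof R ℕ (GrPiece (envFiltration R L)) 1).comp ((GrPiece.mk _ 1).comp
      (((UniversalEnvelopingAlgebra.mkAlgHom R L).toLinearMap.comp (TensorAlgebra.ι R)).codRestrict
        _ (ι_mem_envFiltration R L))))

theorem symmetricToGraded_ι (X : L) :
    symmetricToGraded R L (SymmetricAlgebra.ι R L X) = grι R L X := by
  rw [symmetricToGraded, SymmetricAlgebra.lift_ι_apply]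
  rfl

/-- Symbols of degree one multiply to the symbol, in degree exactly `n`, of the product in the
enveloping algebra. -/
theorem prod_grι (w : List L) {n : ℕ} (h : w.length = n) :
    (w.map (grι R L)).prod = DirectSum.of (GrPiece (envFiltration R L)) n
      (GrPiece.mk _ n ⟨envWord R w, envWord_mem h.le⟩) := by
  induction w generalizing n with
  | nil =>
    subst h
    rfl
  | cons X w ih =>
    subst h
    rw [List.map_cons, List.prod_cons, ih rfl, grι, DirectSum.of_mul_of]
    exact DirectSum.of_eq_of_gradedMonoid_eq (GrPiece.sigma_ext _ (add_comm 1 w.length)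
      (filtrationMul _ 1 w.length ⟨_, ι_mem_envFiltration R L X⟩ ⟨_, envWord_mem le_rfl⟩) _
      (by simp only [envWord, List.map_cons, List.prod_cons]; rfl))

/-- A graded piece is spanned by classes of words: those of full length are products of degree-one
classes, the shorter ones vanish. -/
theorem symmetricToGraded_surjective : Function.Surjective (symmetricToGraded R L) := by
  rw [← AlgHom.range_eq_top, eq_top_iff]
  rintro p -
  induction p using DirectSum.induction_on with
  | zero => exact zero_mem _
  | add x y hx hy => exact add_mem hx hy
  | of n p =>
    obtain ⟨⟨a, ha⟩, rfl⟩ := GrPiece.mk_surjective _ n p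
    have ha' := ha
    rw [envFiltration_eq_span] at ha'
    induction ha' using Submodule.span_induction with
    | zero =>
      rw [show (⟨0, ha⟩ : envFiltration R L n) = 0 from rfl, map_zero, map_zero]
      exact zero_mem _
    | add x y hx hy ihx ihy =>
      rw [← envFiltration_eq_span] at hx hy
      have := add_mem (ihx hx) (ihy hy)
      rwa [← map_add, ← map_add] at this
    | smul r x hx ihx =>
      rw [← envFiltration_eq_span] at hx
      have := Subalgebra.smul_mem _ (ihx hx) r
      rwa [← DirectSum.lof_eq_of R, ← map_smul, ← map_smul] at this
    | mem x hx =>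
      obtain ⟨w, hw, rfl⟩ := hx
      rcases lt_or_eq_of_le (show w.length ≤ n from hw) with hw | hw
      · rw [(GrPiece.mk_eq_zero _ _).2 (envWord_mem_pred hw), map_zero]
        exact zero_mem _
      · rw [← prod_grι w hw]
        refine Subalgebra.list_prod_mem _ fun q hq => ?_
        obtain ⟨X, -, rfl⟩ := List.mem_map.1 hq
        exact ⟨_, symmetricToGraded_ι X⟩

/-- The monomials in a basis span the symmetric algebra. -/
theorem symmetricAlgebra_span {Λ : Type*} (b : Module.Basis Λ R L) :
    Submodule.span R (Set.range fun s : Multiset Λ =>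
      (s.map fun i => SymmetricAlgebra.ι R L (b i)).prod) = ⊤ := by
  rw [eq_top_iff]
  rintro p -
  induction p using SymmetricAlgebra.induction with
  | algebraMap r =>
    rw [Algebra.algebraMap_eq_smul_one]
    exact Submodule.smul_mem _ _ (Submodule.subset_span ⟨0, by simp⟩)
  | ι x =>
    have hx : x ∈ Submodule.span R (Set.range b) := by simp [b.span_eq]
    induction hx using Submodule.span_induction with
    | zero => simp
    | add x y _ _ hx hy => rw [map_add]; exact add_mem hx hy
    | smul r x _ hx => rw [map_smul]; exact Submodule.smul_mem _ _ hx
    | mem x hx =>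
      obtain ⟨i, rfl⟩ := hx
      exact Submodule.subset_span ⟨{i}, by simp⟩
  | add a c ha hc => exact add_mem ha hc
  | mul a c ha hc =>
    have := Submodule.mul_mem_mul ha hc
    rw [Submodule.span_mul_span] at this
    refine Submodule.span_mono ?_ this
    rintro _ ⟨_, ⟨u, rfl⟩, _, ⟨v, rfl⟩, rfl⟩
    exact ⟨u + v, by simp⟩

theorem symmetricToGraded_injective {Λ : Type*} [LinearOrder Λ] (b : Module.Basis Λ R L) :
    Function.Injective (symmetricToGraded R L) := by
  have key : ∀ s : Multiset Λ, ∃ c : AssociatedGraded (envFiltration R L) →ₗ[R] R,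
      ∀ t : Multiset Λ, c (symmetricToGraded R L
        (t.map fun i => SymmetricAlgebra.ι R L (b i)).prod) = if t = s then 1 else 0 := by
    intro s
    obtain ⟨N, hN, hN'⟩ := exists_envCoeff b s
    have hker : (filtrationPred (envFiltration R L) (Multiset.card s)).comap
        (envFiltration R L (Multiset.card s)).subtype ≤
          LinearMap.ker (N.comp (envFiltration R L (Multiset.card s)).subtype) := by
      have hle : filtrationPred (envFiltration R L) (Multiset.card s) ≤ LinearMap.ker N := by
        rw [filtrationPred_envFiltration_eq_span, Submodule.span_le]
        rintro _ ⟨w, hw, rfl⟩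
        exact hN w hw
      exact fun a ha => hle ha
    let c : GrPiece (envFiltration R L) (Multiset.card s) →ₗ[R] R := Submodule.liftQ _ _ hker
    have hc : ∀ (n : ℕ) (a : envFiltration R L n),
        c (DirectSum.component R ℕ (GrPiece (envFiltration R L)) (Multiset.card s)
          (DirectSum.of (GrPiece (envFiltration R L)) n (GrPiece.mk _ n a))) =
        if n = Multiset.card s then N a else 0 := by
      intro n a
      rw [← DirectSum.lof_eq_of R]
      split_ifs with hn
      · subst hn
        rw [DirectSum.component.lof_self]
        rfl
      · rw [DirectSum.component.of, dif_neg hn, map_zero]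
    refine ⟨c.comp (DirectSum.component R ℕ (GrPiece (envFiltration R L)) (Multiset.card s)),
      fun t => ?_⟩
    -- By commutativity the factors of the monomial may be multiplied in increasing order, which
    -- gives the class of the ordered word.
    have ht : symmetricToGraded R L (t.map fun i => SymmetricAlgebra.ι R L (b i)).prod =
        DirectSum.of (GrPiece (envFiltration R L)) (Multiset.card t)
          (GrPiece.mk _ _ ⟨orderedWord b t, orderedWord_mem b le_rfl⟩) := by
      have := prod_grι (R := R) ((t.sort (· ≤ ·)).map b) (n := Multiset.card t) (by simp)
      refine Eq.trans ?_ this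
      conv_lhs => rw [← Multiset.sort_eq t (· ≤ ·)]
      rw [Multiset.map_coe, Multiset.prod_coe, map_list_prod, List.map_map, List.map_map]
      congr 1
      refine List.map_congr_left fun i _ => symmetricToGraded_ι (b i)
    have hs := hN' (t.sort (· ≤ ·)) (Multiset.pairwise_sort t _)
    rw [Multiset.sort_eq] at hs
    rw [ht, LinearMap.comp_apply, hc]
    simp only [orderedWord, hs]
    split_ifs with h1 h2 h2
    · rfl
    · rfl
    · exact absurd (congr_arg Multiset.card h2) h1
    · rfl
  rw [injective_iff_map_eq_zero]
  intro p hp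
  have hpm : p ∈ Submodule.span R (Set.range fun s : Multiset Λ =>
      (s.map fun i => SymmetricAlgebra.ι R L (b i)).prod) := by
    rw [symmetricAlgebra_span b]; trivial
  obtain ⟨f, rfl⟩ := (Finsupp.mem_span_range_iff_exists_finsupp).1 hpm
  have hf : f = 0 := by
    ext s
    obtain ⟨c, hc⟩ := key s
    have := congr_arg c hp
    rw [Finsupp.sum, map_sum, map_sum, map_zero] at this
    simpa [hc] using this
  simp [hf]

variable (R L) in
/-- The Poincaré–Birkhoff–Witt theorem. -/
theorem symmetricToGraded_bijective [Module.Free R L] :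
    Function.Bijective (symmetricToGraded R L) := by
  obtain ⟨⟨Λ, b⟩⟩ := Module.Free.exists_basis (R := R) (M := L)
  classical
  -- Any total order on the basis serves; termination counts inversions in finite words and does not
  -- use well-foundedness of the alphabet.
  let _ : LinearOrder Λ := linearOrderOfSTO WellOrderingRel
  exact ⟨symmetricToGraded_injective b, symmetricToGraded_surjective⟩

end PBW

/-! ### Enveloping algebras acting by derivations -/

section Pairing

variable {K L A Λ : Type*} [Field K] [LieRing L] [LieAlgebra K L] [CommRing A] [Algebra K A]

/-- A derivation lowers the order of vanishing by at most one. -/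
theorem leibniz_mem_pow {D : Module.End K A} (hD : ∀ a c, D (a * c) = a * D c + c * D a)
    (m : Ideal A) (k : ℕ) {a : A} (ha : a ∈ m ^ (k + 1)) : D a ∈ m ^ k := by
  induction k generalizing a with
  | zero => simp
  | succ k ih =>
    rw [pow_succ] at ha
    induction ha using Submodule.mul_induction_on' with
    | mem_mul_mem x hx y hy =>
      rw [hD]
      refine add_mem (Ideal.mul_mem_right _ _ hx) ?_
      rw [pow_succ']
      exact Ideal.mul_mem_mul hy (ih hx)
    | add x _ y _ hx hy => rw [map_add]; exact add_mem hx hy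

variable (J : UniversalEnvelopingAlgebra K L →ₐ[K] Module.End K A)
  (hJ : ∀ X a c, J (UniversalEnvelopingAlgebra.ι K X) (a * c) =
    a * J (UniversalEnvelopingAlgebra.ι K X) c + c * J (UniversalEnvelopingAlgebra.ι K X) a)

include hJ in
theorem envWord_apply_mem_pow (m : Ideal A) (w : List L) {n k : ℕ} (h : w.length + k ≤ n) {a : A}
    (ha : a ∈ m ^ n) : J (envWord K w) a ∈ m ^ k := by
  induction w generalizing k with
  | nil =>
    simp only [envWord, List.map_nil, List.prod_nil, map_one]
    exact Ideal.pow_le_pow_right (by simpa using h) ha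
  | cons X w ih =>
    simp only [envWord, List.map_cons, List.prod_cons, map_mul]
    exact leibniz_mem_pow (hJ X) m k (ih (k := k + 1) (by simp at h; omega))

include hJ in
-- Fewer than `n` derivations cannot exhaust vanishing of order `n`. This is the triangularity of
-- the pairing with monomials.
theorem filtrationPred_apply_mem (m : Ideal A) {n : ℕ} {a : A} (ha : a ∈ m ^ n)
    {u : UniversalEnvelopingAlgebra K L} (hu : u ∈ filtrationPred (envFiltration K L) n) :
    J u a ∈ m := by
  rw [filtrationPred_envFiltration_eq_span] at hu
  induction hu using Submodule.span_induction with
  | mem u hu =>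
    obtain ⟨w, hw, rfl⟩ := hu
    simpa using envWord_apply_mem_pow J hJ m w (k := 1) (Nat.succ_le_of_lt hw) ha
  | zero => simp
  | add u v _ _ hu hv => rw [map_add]; exact add_mem hu hv
  | smul r u _ hu =>
    rw [map_smul, LinearMap.smul_apply, Algebra.smul_def]
    exact Ideal.mul_mem_left _ _ hu

theorem monomial_mem_pow (m : Ideal A) {x : Λ → A} (hx : ∀ i, x i ∈ m) (s : Multiset Λ) :
    (s.map x).prod ∈ m ^ Multiset.card s := by
  induction s using Multiset.induction_on with
  | empty => simp
  | cons i s ih =>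
    rw [Multiset.map_cons, Multiset.prod_cons, Multiset.card_cons, pow_succ']
    exact Ideal.mul_mem_mul (hx i) ih

/-- As `D x_j ≡ δ_ij` modulo `m`, the derivation acts on monomials like `∂/∂x_i`, with an error one
order higher than the main term. -/
theorem leibniz_monomial [DecidableEq Λ] {D : Module.End K A}
    (hD : ∀ a c, D (a * c) = a * D c + c * D a)
    (m : Ideal A) {x : Λ → A} (hx : ∀ i, x i ∈ m) (i : Λ)
    (hDx : ∀ j, D (x j) - (if i = j then 1 else 0) ∈ m) (s : Multiset Λ) :
    D (s.map x).prod - s.count i • ((s.erase i).map x).prod ∈ m ^ Multiset.card s := by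
  induction s using Multiset.induction_on with
  | empty => simp
  | cons j s ih =>
    have h1 := Ideal.mul_mem_mul (hx j) ih
    have h2 := Ideal.mul_mem_mul (hDx j) (monomial_mem_pow m hx s)
    rw [← pow_succ'] at h1 h2
    rw [Multiset.card_cons]
    convert add_mem h1 h2 using 1
    rw [Multiset.map_cons, Multiset.prod_cons, hD]
    by_cases hij : i = j
    · subst hij
      rw [Multiset.count_cons_self, Multiset.erase_cons_head, if_pos rfl]
      by_cases hi : i ∈ s
      · rw [← Multiset.prod_map_erase hi]
        simp only [nsmul_eq_mul]
        push_cast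
        ring
      · rw [Multiset.count_eq_zero_of_notMem hi]
        simp only [nsmul_eq_mul]
        push_cast
        ring
    · rw [Multiset.count_cons_of_ne hij, Multiset.erase_cons_tail _ (Ne.symm hij), if_neg hij,
        Multiset.map_cons, Multiset.prod_cons]
      simp only [nsmul_eq_mul]
      ring

/-- The product of the factorials of the multiplicities of a multiset. -/
def multiplicityFactorial [Fintype Λ] [DecidableEq Λ] (s : Multiset Λ) : ℕ :=
  ∏ i, (s.count i).factorial

theorem multiplicityFactorial_erase [Fintype Λ] [DecidableEq Λ] {s : Multiset Λ} {i : Λ}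
    (hi : i ∈ s) :
    multiplicityFactorial s = s.count i * multiplicityFactorial (s.erase i) := by
  have h1 := Multiset.count_pos.2 hi
  rw [multiplicityFactorial, multiplicityFactorial, ← Finset.mul_prod_erase _ _ (Finset.mem_univ i),
    ← Finset.mul_prod_erase (a := i) _ (fun j => ((s.erase i).count j).factorial)
      (Finset.mem_univ i), Multiset.count_erase_self, ← mul_assoc, Nat.mul_factorial_pred h1.ne']
  congr 1
  refine Finset.prod_congr rfl fun j hj => ?_
  rw [Multiset.count_erase_of_ne (Finset.ne_of_mem_erase hj)]

variable [Fintype Λ] [LinearOrder Λ] (b : Module.Basis Λ K L) (ev : A →ₐ[K] K) (x : Λ → A)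
  (hx : ∀ i, ev (x i) = 0)
  (hbx : ∀ i j, ev (J (UniversalEnvelopingAlgebra.ι K (b i)) (x j)) = if i = j then 1 else 0)

include hJ hx hbx in
-- The last letter of a word acts first, hence the induction from the right. It acts as `∂/∂x_i` up
-- to an error in `m ^ card s`, which the remaining `card s - 1` letters leave inside `m`. The
-- successive multiplicities accumulate to factorials.
theorem ev_envWord_monomial (l : List Λ) (s : Multiset Λ) (h : l.length = Multiset.card s) :
    ev (J (envWord K (l.map b)) (s.map x).prod) =
      if (l : Multiset Λ) = s then (multiplicityFactorial s : K) else 0 := by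
  induction l using List.reverseRecOn generalizing s with
  | nil =>
    obtain rfl := Multiset.card_eq_zero.1 h.symm
    simp [multiplicityFactorial, envWord]
  | append_singleton l i ih =>
    have hDx : ∀ j, J (UniversalEnvelopingAlgebra.ι K (b i)) (x j) - (if i = j then 1 else 0) ∈
        RingHom.ker ev := by
      intro j
      rw [RingHom.mem_ker, map_sub, hbx]
      split_ifs <;> simp
    have h1 := envWord_apply_mem_pow J hJ (RingHom.ker ev) (l.map b) (k := 1)
      (by simp at h ⊢; omega)
      (leibniz_monomial (hJ (b i)) (RingHom.ker ev) hx i hDx s)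
    rw [pow_one, RingHom.mem_ker, map_sub, map_sub, sub_eq_zero, map_nsmul, map_nsmul] at h1
    have h2 : envWord K ((l ++ [i]).map b) =
        envWord K (l.map b) * UniversalEnvelopingAlgebra.ι K (b i) := by
      simp [envWord]
    rw [h2, map_mul, Module.End.mul_apply, h1]
    by_cases hi : i ∈ s
    · have hc : Multiset.card (s.erase i) = Multiset.card s - 1 := Multiset.card_erase_of_mem hi
      rw [ih _ (by simp at h; omega), multiplicityFactorial_erase hi]
      have : ((l ++ [i] : List Λ) : Multiset Λ) = s ↔ (l : Multiset Λ) = s.erase i := by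
        rw [← Multiset.coe_add, Multiset.coe_singleton, add_comm, Multiset.singleton_add]
        constructor
        · rintro rfl
          simp
        · intro h
          rw [h, Multiset.cons_erase hi]
      simp only [this]
      split_ifs <;> simp
    · rw [Multiset.count_eq_zero_of_notMem hi, zero_smul, if_neg]
      rintro rfl
      simp at hi

include hJ hx hbx in
theorem ev_orderedWord_monomial (s t : Multiset Λ) (h : Multiset.card s = Multiset.card t) :
    ev (J (orderedWord b s) (t.map x).prod) =
      if s = t then (multiplicityFactorial t : K) else 0 := by
  rw [orderedWord, ev_envWord_monomial J hJ b ev x hx hbx _ _ (by simpa using h),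
    Multiset.sort_eq]

theorem multiplicityFactorial_cast_ne_zero [CharZero K] (s : Multiset Λ) :
    (multiplicityFactorial s : K) ≠ 0 := by
  rw [Nat.cast_ne_zero, multiplicityFactorial, Finset.prod_ne_zero_iff]
  exact fun i _ => Nat.factorial_ne_zero _

include hJ hx hbx in
/-- An element of the enveloping algebra of order at most `n` whose action annihilates all monomials
of degree at most `n` at the base point vanishes. -/
theorem eq_zero_of_ev_monomial [CharZero K] (n : ℕ) {u : UniversalEnvelopingAlgebra K L}
    (hu : u ∈ envFiltration K L n)
    (h : ∀ s : Multiset Λ, Multiset.card s ≤ n → ev (J u (s.map x).prod) = 0) : u = 0 := by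
  -- Pairing with monomials of degree exactly `n` isolates the coefficients of the ordered words of
  -- length `n` in `u`, up to nonzero factorials. They all vanish, so `u` drops one step in the
  -- filtration.
  have key : u ∈ filtrationPred (envFiltration K L) n := by
    obtain ⟨v, hv, w, hw, rfl⟩ := Submodule.mem_sup.1 (envFiltration_le_orderedWord b n hu)
    obtain ⟨f, hf, rfl⟩ := (Finsupp.mem_span_image_iff_linearCombination K).1 hv
    have hf0 : f = 0 := by
      ext t
      by_cases ht : t ∈ f.support
      · have htn : Multiset.card t = n := hf ht
        have h0 := h t htn.le
        have hw0 : ev (J w (t.map x).prod) = 0 :=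
          filtrationPred_apply_mem J hJ (RingHom.ker ev)
            (htn ▸ monomial_mem_pow (RingHom.ker ev) hx t) hw
        rw [map_add, LinearMap.add_apply, map_add, hw0, add_zero,
          Finsupp.linearCombination_apply, Finsupp.sum, map_sum, LinearMap.sum_apply, map_sum,
          Finset.sum_eq_single t] at h0
        · rw [map_smul, LinearMap.smul_apply, map_smul, ev_orderedWord_monomial J hJ b ev x hx hbx
            _ _ rfl, if_pos rfl, smul_eq_mul] at h0
          exact (mul_eq_zero.1 h0).resolve_right (multiplicityFactorial_cast_ne_zero t)
        · intro s hs hst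
          have hsn : Multiset.card s = n := hf hs
          rw [map_smul, LinearMap.smul_apply, map_smul, ev_orderedWord_monomial J hJ b ev x hx hbx
            _ _ (hsn.trans htn.symm), if_neg hst, smul_zero]
        · intro h
          exact absurd ht h
      · exact Finsupp.notMem_support_iff.1 ht
    simpa [hf0] using hw
  -- The piece before degree `0` is `⊥`, so the descent ends with `u = 0`.
  cases n with
  | zero => exact key
  | succ n => exact eq_zero_of_ev_monomial n key fun s hs => h s (hs.trans n.le_succ)

include hJ hx hbx in
/-- The values at the base point of the action on the monomials of degree at most `n` can be
prescribed. -/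
theorem exists_ev_monomial_eq [CharZero K] (n : ℕ) (c : Multiset Λ → K) :
    ∃ u ∈ envFiltration K L n, ∀ s : Multiset Λ, Multiset.card s ≤ n →
      ev (J u (s.map x).prod) = c s := by
  -- The triangular system is solved from the top degree downwards: after `r` steps the degrees
  -- above `n - r` are matched.
  suffices H : ∀ r ≤ n + 1, ∃ u ∈ envFiltration K L n, ∀ s : Multiset Λ, Multiset.card s ≤ n →
      n < Multiset.card s + r → ev (J u (s.map x).prod) = c s by
    obtain ⟨u, hu, h⟩ := H (n + 1) le_rfl
    exact ⟨u, hu, fun s hs => h s hs (by omega)⟩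
  intro r hr
  induction r with
  | zero => exact ⟨0, zero_mem _, fun s hs hs' => by omega⟩
  | succ r ih =>
    obtain ⟨u, hu, h⟩ := ih (by omega)
    -- The correction uses ordered words of length `n - r`: they pair diagonally with monomials of
    -- that degree and trivially with higher ones, so earlier matches survive.
    refine ⟨u + ∑ s : Sym Λ (n - r), ((c s.1 - ev (J u (s.1.map x).prod)) /
      (multiplicityFactorial s.1 : K)) • orderedWord b s.1,
      add_mem hu (sum_mem fun s _ => Submodule.smul_mem _ _ (orderedWord_mem b ?_)),
      fun t ht ht' => ?_⟩
    · exact s.2.le.trans (Nat.sub_le n r)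
    · rw [map_add, LinearMap.add_apply, map_add, map_sum, LinearMap.sum_apply, map_sum]
      rcases (show n - r = Multiset.card t ∨ n - r < Multiset.card t by omega) with htr | htr
      · rw [Finset.sum_eq_single ⟨t, htr.symm⟩]
        · rw [map_smul, LinearMap.smul_apply, map_smul]
          rw [ev_orderedWord_monomial J hJ b ev x hx hbx _ _ rfl, if_pos rfl, smul_eq_mul,
            div_mul_cancel₀ _ (multiplicityFactorial_cast_ne_zero t)]
          exact add_sub_cancel _ _
        · intro s _ hs
          rw [map_smul, LinearMap.smul_apply, map_smul, ev_orderedWord_monomial J hJ b ev x hx hbx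
            _ _ (s.2.trans htr), if_neg, smul_zero]
          rintro h
          exact hs (Subtype.ext h)
        · intro h
          exact absurd (Finset.mem_univ _) h
      · rw [h t ht (by omega), Finset.sum_eq_zero, add_zero]
        intro s _
        rw [map_smul, LinearMap.smul_apply, map_smul]
        have : ev (J (orderedWord b s.1) (t.map x).prod) = 0 :=
          filtrationPred_apply_mem J hJ (RingHom.ker ev)
            (monomial_mem_pow (RingHom.ker ev) hx t) (envWord_mem_pred (by simpa using s.2.trans_lt htr))
        rw [this, smul_zero]

end Pairing

/-! ### Smooth vector fields as differential operators -/

section VectorFields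

open VectorField Bundle

variable {𝕜 E H : Type*} [RCLike 𝕜] [NormedAddCommGroup E] [NormedSpace 𝕜 E]
  [TopologicalSpace H] {I : ModelWithCorners 𝕜 E H} {M : Type*} [TopologicalSpace M]
  [ChartedSpace H M]

variable (I) in
/-- The expression of a vector field in the extended chart at `x₀`. -/
def chartField (x₀ : M) (V : ∀ x : M, TangentSpace I x) (z : E) : E :=
  mfderiv I 𝓘(𝕜, E) (extChartAt I x₀) ((extChartAt I x₀).symm z) (V ((extChartAt I x₀).symm z))

theorem chartField_extChartAt (x₀ : M) (V : ∀ x : M, TangentSpace I x) {y : M}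
    (hy : y ∈ (chartAt H x₀).source) :
    chartField I x₀ V (extChartAt I x₀ y) = mfderiv I 𝓘(𝕜, E) (extChartAt I x₀) y (V y) := by
  rw [chartField, (extChartAt I x₀).left_inv (by rwa [extChartAt_source])]

variable [IsManifold I ∞ M]

/-- The derivative of the chart inverts that of the inverse chart. This links the chart expression
to the pull-back through which `mlieBracket` is defined. -/
theorem chartField_eq_mpullbackWithin (x₀ : M) (V : ∀ x : M, TangentSpace I x) {z : E}
    (hz : z ∈ (extChartAt I x₀).target) :
    chartField I x₀ V z =
      mpullbackWithin 𝓘(𝕜, E) I (extChartAt I x₀).symm V (Set.range I) z := by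
  rw [mpullbackWithin_apply]
  symm
  refine (ContinuousLinearMap.IsInvertible.inverse_apply_eq
    (isInvertible_mfderivWithin_extChartAt_symm hz)).2 ?_
  have := mfderivWithin_extChartAt_symm_comp_mfderiv_extChartAt (I := I) hz
  exact (congr_arg (fun T => T (V ((extChartAt I x₀).symm z))) this).symm

theorem contDiffOn_chartField [I.Boundaryless] (x₀ : M) {V : ∀ x : M, TangentSpace I x}
    (hV : ContMDiff I I.tangent ∞ fun x => (V x : TangentBundle I M)) :
    ContDiffOn 𝕜 ∞ (chartField I x₀ V) (extChartAt I x₀).target := by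
  intro z hz
  refine ContDiffAt.contDiffWithinAt ?_
  rw [← contMDiffAt_iff_contDiffAt]
  have hy : (extChartAt I x₀).symm z ∈ (chartAt H x₀).source := by
    rw [← extChartAt_source I]; exact (extChartAt I x₀).map_target hz
  have h1 : ContMDiffAt I 𝓘(𝕜, E) ∞ (fun p : M =>
      (mfderiv I 𝓘(𝕜, E) (extChartAt I x₀) p (V p) : E)) ((extChartAt I x₀).symm z) := by
    -- The derivative of the chart is the fibre coordinate of the tangent bundle in its
    -- trivialization at `x₀`.
    have h2 := ((trivializationAt E (TangentSpace I) x₀).contMDiffAt_section_iff (IB := I) (n := ∞)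
      (s := V) (x₀ := (extChartAt I x₀).symm z) (by simpa using hy)).1 (hV _)
    refine h2.congr_of_eventuallyEq ?_
    filter_upwards [(chartAt H x₀).open_source.mem_nhds hy] with p hp
    refine (congr_arg (fun T => T (V p))
      (TangentBundle.continuousLinearMapAt_trivializationAt (I := I) hp)).symm.trans ?_
    exact congrFun (Trivialization.coe_linearMapAt_of_mem (R := 𝕜)
      (trivializationAt E (TangentSpace I) x₀) (by simpa using hp)) (V p)
  exact h1.comp (I' := I) z ((contMDiffOn_extChartAt_symm x₀).contMDiffAt
      ((isOpen_extChartAt_target x₀).mem_nhds hz))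

/-- The derivative of a function along a vector field, computed in a chart. -/
theorem mfderiv_apply_eq_fderiv [I.Boundaryless] (x₀ : M) (V : ∀ x : M, TangentSpace I x)
    {f : M → 𝕜} {y : M}
    (hy : y ∈ (chartAt H x₀).source) (hf : MDifferentiableAt I 𝓘(𝕜, 𝕜) f y) :
    mfderiv I 𝓘(𝕜, 𝕜) f y (V y) =
      fderiv 𝕜 (f ∘ (extChartAt I x₀).symm) (extChartAt I x₀ y)
        (chartField I x₀ V (extChartAt I x₀ y)) := by
  have hys : y ∈ (extChartAt I x₀).source := by rwa [extChartAt_source]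
  have hsymm : MDifferentiableAt 𝓘(𝕜, E) I (extChartAt I x₀).symm (extChartAt I x₀ y) :=
    ((contMDiffOn_extChartAt_symm (n := ∞) x₀).contMDiffAt ((isOpen_extChartAt_target x₀).mem_nhds
      ((extChartAt I x₀).map_source hys))).mdifferentiableAt (by simp)
  have hleft : (extChartAt I x₀).symm (extChartAt I x₀ y) = y := (extChartAt I x₀).left_inv hys
  have hd : MDifferentiableAt 𝓘(𝕜, E) 𝓘(𝕜, 𝕜) (f ∘ (extChartAt I x₀).symm) (extChartAt I x₀ y) :=
    MDifferentiableAt.comp (I' := I) _ (by rwa [hleft]) hsymm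
  have heq : f =ᶠ[nhds y] (f ∘ (extChartAt I x₀).symm) ∘ extChartAt I x₀ := by
    filter_upwards [(isOpen_extChartAt_source (I := I) x₀).mem_nhds hys] with p hp
    rw [Function.comp_apply, Function.comp_apply, (extChartAt I x₀).left_inv hp]
  rw [heq.mfderiv_eq, mfderiv_comp (I' := 𝓘(𝕜, E)) _ hd (mdifferentiableAt_extChartAt hy),
    chartField_extChartAt x₀ V hy, mfderiv_eq_fderiv]
  rfl

omit [IsManifold I ∞ M] in
-- At the base point of its own chart the tangent space is the model space itself, so no change of
-- coordinates appears.
theorem mfderiv_apply_eq_fderiv_self [I.Boundaryless] {f : M → 𝕜} {y : M}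
    (hf : MDifferentiableAt I 𝓘(𝕜, 𝕜) f y) (v : TangentSpace I y) :
    mfderiv I 𝓘(𝕜, 𝕜) f y v = fderiv 𝕜 (f ∘ (extChartAt I y).symm) (extChartAt I y y) v := by
  have h : (mfderiv I 𝓘(𝕜, 𝕜) f y : E →L[𝕜] 𝕜) =
      fderiv 𝕜 (f ∘ (extChartAt I y).symm) (extChartAt I y y) := by
    rw [← fderivWithin_univ, ← I.range_eq_univ]
    exact hf.mfderiv
  exact DFunLike.congr_fun h v

theorem mfderiv_extChartAt_self_apply (y : M) (v : TangentSpace I y) :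
    mfderiv I 𝓘(𝕜, E) (extChartAt I y) y v = v :=
  DFunLike.congr_fun (mfderiv_extChartAt_self (I := I) (x := y)) v

omit [IsManifold I ∞ M] in
theorem mdifferentiableAt_extendZero {U : Opens M} (f : C^∞⟮I, U; 𝕜⟯) {y : M} (hy : y ∈ U) :
    MDifferentiableAt I 𝓘(𝕜, 𝕜) (extendZero f) y :=
  (contMDiffAt_extendZero f hy).mdifferentiableAt (by simp)

theorem contDiffAt_extendZero_comp [I.Boundaryless] (x₀ : M) {U : Opens M}
    (f : C^∞⟮I, U; 𝕜⟯) {y : M} (hy : y ∈ U) (hys : y ∈ (chartAt H x₀).source) :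
    ContDiffAt 𝕜 ∞ (extendZero f ∘ (extChartAt I x₀).symm) (extChartAt I x₀ y) := by
  have hW : IsOpen ((U : Set M) ∩ (chartAt H x₀).source) :=
    U.2.inter (chartAt H x₀).open_source
  exact (contDiffOn_extendZero_comp x₀ f Set.inter_subset_right Set.inter_subset_left).contDiffAt
    ((isOpen_extChartAt_image x₀ hW Set.inter_subset_right).mem_nhds ⟨y, ⟨hy, hys⟩, rfl⟩)

theorem contMDiffAt_mfderiv_apply [I.Boundaryless] {V : ∀ x : M, TangentSpace I x}
    (hV : ContMDiff I I.tangent ∞ fun x => (V x : TangentBundle I M)) {U : Opens M}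
    (f : C^∞⟮I, U; 𝕜⟯) {y : M} (hy : y ∈ U) :
    ContMDiffAt I 𝓘(𝕜, 𝕜) ∞ (fun p : M =>
      (mfderiv I 𝓘(𝕜, 𝕜) (extendZero f) p (V p) : 𝕜)) y := by
  have hys := mem_chart_source H y
  have h1 : ContDiffAt 𝕜 ∞ (fun z => fderiv 𝕜 (extendZero f ∘ (extChartAt I y).symm) z
      (chartField I y V z)) (extChartAt I y y) :=
    ((contDiffAt_extendZero_comp y f hy hys).fderiv_right (m := ∞) (by simp)).clm_apply
      ((contDiffOn_chartField y hV).contDiffAt (extChartAt_target_mem_nhds y))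
  rw [← contMDiffAt_iff_contDiffAt] at h1
  refine (h1.comp (I' := 𝓘(𝕜, E)) y contMDiffAt_extChartAt).congr_of_eventuallyEq ?_
  filter_upwards [(chartAt H y).open_source.mem_nhds hys, U.2.mem_nhds hy] with p hp hpU
  exact mfderiv_apply_eq_fderiv y V hp (mdifferentiableAt_extendZero f hpU)

/-- The operators `f ↦ V f` on smooth functions given by a smooth vector field `V`. -/
def vectorFieldOperator [I.Boundaryless] (V : ∀ x : M, TangentSpace I x)
    (hV : ContMDiff I I.tangent ∞ fun x => (V x : TangentBundle I M)) : LocalOperators I M :=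
  fun U =>
  { toFun := fun f => ⟨fun y => mfderiv I 𝓘(𝕜, 𝕜) (extendZero f) (y : M) (V y), fun y =>
      contMDiffAt_subtype_iff.2 (contMDiffAt_mfderiv_apply hV f y.2)⟩
    map_add' := fun f g => by
      ext y
      have h : extendZero (f + g) =ᶠ[nhds (y : M)] extendZero f + extendZero g := by
        filter_upwards [U.2.mem_nhds y.2] with p hp
        exact (extendZero_apply (f + g) ⟨p, hp⟩).trans (congr_arg₂ (· + ·)
          (extendZero_apply f ⟨p, hp⟩).symm (extendZero_apply g ⟨p, hp⟩).symm)
      change mfderiv I 𝓘(𝕜, 𝕜) (extendZero (f + g)) (y : M) (V y) = _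
      rw [h.mfderiv_eq, mfderiv_add (mdifferentiableAt_extendZero f y.2)
        (mdifferentiableAt_extendZero g y.2)]
      rfl
    map_smul' := fun c f => by
      ext y
      have h : extendZero (c • f) =ᶠ[nhds (y : M)] c • extendZero f := by
        filter_upwards [U.2.mem_nhds y.2] with p hp
        exact (extendZero_apply (c • f) ⟨p, hp⟩).trans (congr_arg (c • ·)
          (extendZero_apply f ⟨p, hp⟩).symm)
      change mfderiv I 𝓘(𝕜, 𝕜) (extendZero (c • f)) (y : M) (V y) = _
      rw [h.mfderiv_eq, const_smul_mfderiv (mdifferentiableAt_extendZero f y.2) c]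
      rfl }

theorem vectorFieldOperator_apply [I.Boundaryless] (V : ∀ x : M, TangentSpace I x)
    (hV : ContMDiff I I.tangent ∞ fun x => (V x : TangentBundle I M)) (U : Opens M)
    (f : C^∞⟮I, U; 𝕜⟯) (y : U) :
    vectorFieldOperator V hV U f y = mfderiv I 𝓘(𝕜, 𝕜) (extendZero f) (y : M) (V y) := rfl

theorem vectorFieldOperator_mul [I.Boundaryless] (V : ∀ x : M, TangentSpace I x)
    (hV : ContMDiff I I.tangent ∞ fun x => (V x : TangentBundle I M)) (U : Opens M)
    (f g : C^∞⟮I, U; 𝕜⟯) :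
    vectorFieldOperator V hV U (f * g) =
      f * vectorFieldOperator V hV U g + g * vectorFieldOperator V hV U f := by
  ext y
  have h : extendZero (f * g) =ᶠ[nhds (y : M)] extendZero f * extendZero g := by
    filter_upwards [U.2.mem_nhds y.2] with p hp
    exact (extendZero_apply (f * g) ⟨p, hp⟩).trans (congr_arg₂ (· * ·)
      (extendZero_apply f ⟨p, hp⟩).symm (extendZero_apply g ⟨p, hp⟩).symm)
  rw [vectorFieldOperator_apply, h.mfderiv_eq,
    ((mdifferentiableAt_extendZero f y.2).hasMFDerivAt.mul
      (mdifferentiableAt_extendZero g y.2).hasMFDerivAt).mfderiv]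
  change extendZero f (y : M) * _ + extendZero g (y : M) * _ = _
  rw [extendZero_apply, extendZero_apply]
  rfl

theorem hasOrderLE_vectorFieldOperator [I.Boundaryless] (V : ∀ x : M, TangentSpace I x)
    (hV : ContMDiff I I.tangent ∞ fun x => (V x : TangentBundle I M)) :
    HasOrderLE 1 (vectorFieldOperator V hV) := by
  intro x₀
  have himage : extChartAt I x₀ '' (chartAt H x₀).source = (extChartAt I x₀).target := by
    rw [← extChartAt_source I, PartialEquiv.image_source_eq_target]
  refine ⟨⟨(chartAt H x₀).source, (chartAt H x₀).open_source⟩, mem_chart_source H x₀, subset_rfl,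
    fun k z => match k with
      | 1 => (ContinuousLinearMap.apply 𝕜 𝕜 (chartField I x₀ V z)).comp
        (continuousMultilinearCurryFin1 𝕜 E 𝕜 : _ →L[𝕜] _)
      | _ => 0, fun k => ?_, fun U f y hy => ?_⟩
  · match k with
    | 1 =>
      refine ContDiffOn.clm_comp ?_ contDiffOn_const
      refine (ContinuousLinearMap.contDiff _).comp_contDiffOn ?_
      change ContDiffOn 𝕜 ∞ (chartField I x₀ V) (extChartAt I x₀ '' (chartAt H x₀).source)
      rw [himage]
      exact contDiffOn_chartField x₀ hV
    | 0 => exact contDiffOn_const (c := 0)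
    | _ + 2 => exact contDiffOn_const (c := 0)
  · rw [vectorFieldOperator_apply, mfderiv_apply_eq_fderiv x₀ V hy
      (mdifferentiableAt_extendZero f y.2)]
    simp [Finset.sum_range_succ]

/-- The derivative along the Lie bracket of two vector fields is the commutator. -/
theorem vectorFieldOperator_mlieBracket [I.Boundaryless] [CompleteSpace E]
    (V W : ∀ x : M, TangentSpace I x)
    (hV : ContMDiff I I.tangent ∞ fun x => (V x : TangentBundle I M))
    (hW : ContMDiff I I.tangent ∞ fun x => (W x : TangentBundle I M)) (U : Opens M)
    (f : C^∞⟮I, U; 𝕜⟯) (y : U) :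
    mfderiv I 𝓘(𝕜, 𝕜) (extendZero f) (y : M) (mlieBracket I V W (y : M)) =
      vectorFieldOperator V hV U (vectorFieldOperator W hW U f) y -
        vectorFieldOperator W hW U (vectorFieldOperator V hV U f) y := by
  have hys := mem_chart_source H (y : M)
  set z := extChartAt I (y : M) y with hz
  set g : E → 𝕜 := extendZero f ∘ (extChartAt I (y : M)).symm with hg
  have htar : (extChartAt I (y : M)).target ∈ nhds z := extChartAt_target_mem_nhds (y : M)
  have h1 : ∀ (V : ∀ x : M, TangentSpace I x)
      (hV : ContMDiff I I.tangent ∞ fun x => (V x : TangentBundle I M)),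
      extendZero (vectorFieldOperator V hV U f) ∘ (extChartAt I (y : M)).symm =ᶠ[nhds z]
        fun z => fderiv 𝕜 g z (chartField I (y : M) V z) := by
    intro V hV
    have hW : IsOpen ((U : Set M) ∩ (chartAt H (y : M)).source) :=
      U.2.inter (chartAt H (y : M)).open_source
    filter_upwards [(isOpen_extChartAt_image (I := I) (y : M) hW Set.inter_subset_right).mem_nhds
      ⟨y, ⟨y.2, hys⟩, rfl⟩]
    rintro _ ⟨p, ⟨hpU, hp⟩, rfl⟩
    rw [Function.comp_apply, (extChartAt I (y : M)).left_inv (by rwa [extChartAt_source])]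
    refine (extendZero_apply _ ⟨p, hpU⟩).trans ?_
    rw [vectorFieldOperator_apply]
    exact mfderiv_apply_eq_fderiv (y : M) V hp (mdifferentiableAt_extendZero f hpU)
  have h2 : ∀ (V W : ∀ x : M, TangentSpace I x)
      (hV : ContMDiff I I.tangent ∞ fun x => (V x : TangentBundle I M))
      (hW : ContMDiff I I.tangent ∞ fun x => (W x : TangentBundle I M)),
      vectorFieldOperator V hV U (vectorFieldOperator W hW U f) y =
        fderiv 𝕜 (fun z => fderiv 𝕜 g z (chartField I (y : M) W z)) z
          (chartField I (y : M) V z) := by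
    intro V W hV hW
    rw [vectorFieldOperator_apply, mfderiv_apply_eq_fderiv (y : M) V hys
      (mdifferentiableAt_extendZero _ y.2), (h1 W hW).fderiv_eq]
  have hdiff : ∀ (V : ∀ x : M, TangentSpace I x)
      (hV : ContMDiff I I.tangent ∞ fun x => (V x : TangentBundle I M)),
      DifferentiableAt 𝕜 (chartField I (y : M) V) z := fun V hV =>
    ((contDiffOn_chartField (y : M) hV).contDiffAt htar).differentiableAt (by simp)
  rw [h2 V W hV hW, h2 W V hW hV, ← fderiv_apply_lieBracket (n := ∞)
    (contDiffAt_extendZero_comp (y : M) f y.2 hys)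
    (by rw [minSmoothness_of_isRCLikeNormedField]; norm_cast) (hdiff W hW)
    (hdiff V hV)]
  -- The bracket on the manifold is the flat bracket of the chart expressions, carried back by the
  -- derivative of the chart, which at its own base point is the identity.
  have h3 : mlieBracket I V W (y : M) = lieBracket 𝕜 (chartField I (y : M) V)
      (chartField I (y : M) W) z := by
    have e : ∀ V : (∀ x : M, TangentSpace I x), mpullbackWithin 𝓘(𝕜, E) I
        (extChartAt I (y : M)).symm V (Set.range I) =ᶠ[nhds z] chartField I (y : M) V := fun V => by
      filter_upwards [htar] with z hz
      exact (chartField_eq_mpullbackWithin (y : M) V hz).symm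
    rw [mlieBracket, mlieBracketWithin_apply]
    refine (ContinuousLinearMap.IsInvertible.inverse_apply_eq
      (isInvertible_mfderiv_extChartAt (mem_extChartAt_source (y : M)))).2 ?_
    refine Eq.trans ?_ (mfderiv_extChartAt_self_apply (I := I) (y : M) _).symm
    have hset : (extChartAt I (y : M)).symm ⁻¹' Set.univ ∩ Set.range I = Set.univ := by
      rw [I.range_eq_univ, Set.preimage_univ, Set.univ_inter]
    rw [hset]
    have key : ∀ V' W' V W : E → E, V' =ᶠ[nhds z] V → W' =ᶠ[nhds z] W →
        lieBracketWithin 𝕜 V' W' Set.univ z = lieBracket 𝕜 V W z := fun V' W' V W h h' => by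
      rw [lieBracketWithin_univ, h.lieBracket_vectorField_eq h']
    exact key _ _ _ _ (e V) (e W)
  rw [mfderiv_apply_eq_fderiv_self (mdifferentiableAt_extendZero f y.2), h3]

end VectorFields

/-! ### Left-invariant vector fields as left-invariant differential operators -/

section InvariantFields

open VectorField

variable {𝕜 E H : Type*} [RCLike 𝕜] [NormedAddCommGroup E] [NormedSpace 𝕜 E]
  [TopologicalSpace H] {I : ModelWithCorners 𝕜 E H} {G : Type*} [TopologicalSpace G]
  [ChartedSpace H G] [Group G] [LieGroup I ∞ G]

/-- Left-invariant vector fields on a smooth Lie group are smooth. -/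
theorem contMDiff_infty_mulInvariantVectorField (v : GroupLieAlgebra I G) :
    ContMDiff I I.tangent ∞ fun g : G => (mulInvariantVectorField v g : TangentBundle I G) := by
  -- The field is a composite of smooth maps: the tangent map of multiplication applied to the zero
  -- vector at `g` and the vector `v` at the identity.
  let fg : G → TangentBundle I G := fun g => Bundle.TotalSpace.mk' E g 0
  have sfg : ContMDiff I I.tangent ∞ fg := Bundle.contMDiff_zeroSection _ _
  let fv : G → TangentBundle I G := fun _ => Bundle.TotalSpace.mk' E 1 v
  have sfv : ContMDiff I I.tangent ∞ fv := contMDiff_const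
  let F₁ : G → (TangentBundle I G × TangentBundle I G) := fun g => (fg g, fv g)
  have S₁ : ContMDiff I (I.tangent.prod I.tangent) ∞ F₁ := sfg.prodMk sfv
  let F₂ : (TangentBundle I G × TangentBundle I G) → TangentBundle (I.prod I) (G × G) :=
    (equivTangentBundleProd I G I G).symm
  have S₂ : ContMDiff (I.tangent.prod I.tangent) (I.prod I).tangent ∞ F₂ :=
    contMDiff_equivTangentBundleProd_symm
  let F₃ : TangentBundle (I.prod I) (G × G) → TangentBundle I G :=
    tangentMap (I.prod I) I (fun p : G × G => p.1 * p.2)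
  have S₃ : ContMDiff (I.prod I).tangent I.tangent ∞ F₃ :=
    (contMDiff_mul I ∞).contMDiff_tangentMap (m := ∞) (by simp)
  let S := (S₃.comp S₂).comp S₁
  convert! S with g
  · simp [F₁, F₂, F₃, fg, fv]
  · simp only [Function.comp_apply, tangentMap, F₃, F₂, F₁, fg, fv]
    rw [mfderiv_prod_eq_add_apply ((contMDiff_mul I ∞).mdifferentiableAt (by simp))]
    refine Eq.symm ?_
    refine (congrArg₂ (· + ·) (map_zero _) rfl).trans ?_
    exact zero_add _

variable [I.Boundaryless]

/-- The operator on smooth functions given by a left-invariant vector field. -/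
def invariantFieldOperator (X : GroupLieAlgebra I G) : LocalOperators I G :=
  vectorFieldOperator (mulInvariantVectorField X) (contMDiff_infty_mulInvariantVectorField X)

theorem invariantFieldOperator_apply (X : GroupLieAlgebra I G) (U : Opens G) (f : C^∞⟮I, U; 𝕜⟯)
    (y : U) : invariantFieldOperator X U f y =
      mfderiv I 𝓘(𝕜, 𝕜) (extendZero f) (y : G) (mulInvariantVectorField X (y : G)) := rfl

omit [I.Boundaryless] in
theorem mulInvariantVectorField_mul (X : GroupLieAlgebra I G) (g h : G) :
    mulInvariantVectorField X (g * h) =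
      mfderiv I I (g * ·) h (mulInvariantVectorField X h) := by
  have hd : ∀ g h : G, MDifferentiableAt I I (g * ·) h := fun g h =>
    (contMDiff_mul_left (n := ∞)).mdifferentiableAt (by simp)
  have h1 : (fun x : G => g * h * x) = (fun x => g * x) ∘ fun x => h * x := by
    ext x; simp [mul_assoc]
  rw [mulInvariantVectorField, h1, mfderiv_comp (I' := I) _ (hd _ _) (hd _ _)]
  simp only [mulInvariantVectorField]
  -- The chain rule produces the base point `h * 1`; the equation is moved to `h` across
  -- definitionally equal tangent spaces.
  have h2 : ∀ p q : G, p = q → ∀ v : E, (mfderiv I I (g * ·) p v : E) = mfderiv I I (g * ·) q v :=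
    by rintro p _ rfl v; rfl
  exact h2 _ _ (mul_one h) _

theorem invariantFieldOperator_left_invariant (X : GroupLieAlgebra I G) (g : G) :
    IsInvariantUnder (𝑳 I g) (invariantFieldOperator X) := by
  intro U f
  ext x
  have hx : g * (x : G) ∈ U := x.2
  change _ = invariantFieldOperator X U f ⟨g * (x : G), hx⟩
  rw [invariantFieldOperator_apply, invariantFieldOperator_apply]
  have h1 : extendZero (pullbackFun (𝑳 I g) U f) =ᶠ[nhds (x : G)] extendZero f ∘ (g * ·) := by
    filter_upwards [(Opens.comap ⟨𝑳 I g, (𝑳 I g).contMDiff.continuous⟩ U).2.mem_nhds x.2] with p hp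
    exact (extendZero_apply (pullbackFun (𝑳 I g) U f) ⟨p, hp⟩).trans
      (extendZero_apply f ⟨g * p, hp⟩).symm
  rw [h1.mfderiv_eq, mfderiv_comp (I' := I) _ (mdifferentiableAt_extendZero f hx)
    ((contMDiff_mul_left (n := ∞)).mdifferentiableAt (by simp)), mulInvariantVectorField_mul]
  rfl

theorem invariantFieldOperator_mem (X : GroupLieAlgebra I G) :
    invariantFieldOperator X ∈ leftInvDiffOps I G :=
  ⟨⟨1, hasOrderLE_vectorFieldOperator _ _⟩, by
    simp only [Algebra.coe_iInf, Set.mem_iInter, SetLike.mem_coe]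
    exact invariantFieldOperator_left_invariant X⟩

variable [CompleteSpace E]

section

attribute [local instance 100] LieRing.ofAssociativeRing

variable (I G) in
/-- Left-invariant vector fields as a Lie algebra homomorphism to left-invariant operators. -/
def invariantFieldHom : GroupLieAlgebra I G →ₗ⁅𝕜⁆ leftInvDiffOps I G where
  toFun X := ⟨invariantFieldOperator X, invariantFieldOperator_mem X⟩
  map_add' X Y := by
    refine Subtype.ext (funext fun U => LinearMap.ext fun f => ?_)
    ext y
    change invariantFieldOperator (X + Y) U f y =
      invariantFieldOperator X U f y + invariantFieldOperator Y U f y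
    rw [invariantFieldOperator_apply, mulInvariantVectorField_add]
    exact map_add (mfderiv I 𝓘(𝕜, 𝕜) (extendZero f) (y : G)) _ _
  map_smul' c X := by
    refine Subtype.ext (funext fun U => LinearMap.ext fun f => ?_)
    ext y
    change invariantFieldOperator (c • X) U f y = c • invariantFieldOperator X U f y
    rw [invariantFieldOperator_apply, mulInvariantVectorField_smul]
    exact map_smul (mfderiv I 𝓘(𝕜, 𝕜) (extendZero f) (y : G)) c _
  map_lie' {X Y} := by
    refine Subtype.ext (funext fun U => LinearMap.ext fun f => ?_)
    ext y
    change invariantFieldOperator ⁅X, Y⁆ U f y = invariantFieldOperator X U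
      (invariantFieldOperator Y U f) y - invariantFieldOperator Y U
      (invariantFieldOperator X U f) y
    rw [invariantFieldOperator_apply, GroupLieAlgebra.bracket_def, mulInvariantVector_mlieBracket]
    exact vectorFieldOperator_mlieBracket _ _ _ _ U f y

set_option synthInstance.maxHeartbeats 400000 in
variable (I G) in
/-- The homomorphism from the enveloping algebra to the left-invariant differential operators. -/
def envToLeftInv :
    UniversalEnvelopingAlgebra 𝕜 (GroupLieAlgebra I G) →ₐ[𝕜] leftInvDiffOps I G :=
  UniversalEnvelopingAlgebra.lift 𝕜 (invariantFieldHom I G)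

theorem envToLeftInv_ι (X : GroupLieAlgebra I G) :
    (envToLeftInv I G (UniversalEnvelopingAlgebra.ι 𝕜 X) : LocalOperators I G) =
      invariantFieldOperator X :=
  congr_arg Subtype.val (UniversalEnvelopingAlgebra.lift_ι_apply 𝕜 (invariantFieldHom I G) X)

end

theorem hasOrderLE_envToLeftInv (n : ℕ) {u : UniversalEnvelopingAlgebra 𝕜 (GroupLieAlgebra I G)}
    (hu : u ∈ envFiltration 𝕜 (GroupLieAlgebra I G) n) :
    HasOrderLE n (envToLeftInv I G u : LocalOperators I G) := by
  have hword : ∀ w : List (GroupLieAlgebra I G),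
      HasOrderLE w.length (envToLeftInv I G (envWord 𝕜 w) : LocalOperators I G) := by
    intro w
    induction w with
    | nil => simpa [envWord] using HasOrderLE.one
    | cons X w ih =>
      rw [envWord, List.map_cons, List.prod_cons, map_mul, List.length_cons, add_comm]
      refine HasOrderLE.mul (m := 1) (n := w.length) ?_ ih
      rw [envToLeftInv_ι]
      exact hasOrderLE_vectorFieldOperator _ _
  rw [envFiltration_eq_span] at hu
  induction hu using Submodule.span_induction with
  | mem u hu =>
    obtain ⟨w, hw, rfl⟩ := hu
    exact (hword w).mono hw
  | zero => rw [map_zero]; exact HasOrderLE.zero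
  | add u v _ _ hu hv => rw [map_add]; exact hu.add hv
  | smul c u _ hu => rw [map_smul]; exact hu.smul c

omit [CompleteSpace E] in
theorem leftInvDiffOps_apply {D : LocalOperators I G} (hD : D ∈ leftInvDiffOps I G) (g : G)
    (U : Opens G) (f : C^∞⟮I, U; 𝕜⟯) :
    D (Opens.comap ⟨𝑳 I g, (𝑳 I g).contMDiff.continuous⟩ U) (pullbackFun (𝑳 I g) U f) =
      pullbackFun (𝑳 I g) U (D U f) := by
  have h := hD.2
  simp only [Algebra.coe_iInf, Set.mem_iInter, SetLike.mem_coe] at h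
  exact h g U f

omit [CompleteSpace E] in
/-- A left-invariant operator is determined by its values at the identity. -/
theorem leftInvDiffOps_eq_zero {D : LocalOperators I G} (hD : D ∈ leftInvDiffOps I G)
    (h : ∀ (U : Opens G) (f : C^∞⟮I, U; 𝕜⟯) (h1 : (1 : G) ∈ U), D U f ⟨1, h1⟩ = 0) : D = 0 := by
  refine funext fun U => LinearMap.ext fun f => ?_
  ext g
  have h1 : (1 : G) ∈ Opens.comap ⟨𝑳 I (g : G), (𝑳 I (g : G)).contMDiff.continuous⟩ U := by
    change (g : G) * 1 ∈ U
    rw [mul_one]; exact g.2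
  have h2 := h _ (pullbackFun (𝑳 I (g : G)) U f) h1
  rw [leftInvDiffOps_apply hD] at h2
  have h3 : D U f ⟨(g : G) * 1, h1⟩ = 0 := h2
  have h4 : (⟨(g : G) * 1, h1⟩ : U) = g := Subtype.ext (mul_one _)
  rw [h4] at h3
  exact h3

end InvariantFields

/-! ### Symmetry of higher derivatives and Taylor polynomials -/

section Taylor

variable {𝕜 E F : Type*} [RCLike 𝕜] [NormedAddCommGroup E] [NormedSpace 𝕜 E]
  [NormedAddCommGroup F] [NormedSpace 𝕜 F]

/-- The higher derivatives of a smooth function are symmetric. -/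
theorem iteratedFDeriv_comp_perm_of_contDiffOn {V : Set E} (hV : IsOpen V) {g : E → F}
    (hg : ContDiffOn 𝕜 ∞ g V) (n : ℕ) {z : E} (hz : z ∈ V) (v : Fin n → E)
    (σ : Equiv.Perm (Fin n)) :
    iteratedFDeriv 𝕜 n g z (v ∘ σ) = iteratedFDeriv 𝕜 n g z v := by
  have hdiff : ∀ (m : ℕ) {z : E}, z ∈ V → ContDiffAt 𝕜 2 (iteratedFDeriv 𝕜 m g) z :=
    fun m z hz => (hg.contDiffAt (hV.mem_nhds hz)).iteratedFDeriv_right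
      (WithTop.coe_le_coe.2 (le_top (a := (2 : ℕ∞) + m)))
  induction n generalizing z with
  | zero => exact congr_arg _ (Subsingleton.elim _ _)
  | succ n ih =>
    -- Adjacent transpositions generate. The first is the symmetry of the second derivative of the
    -- iterated derivative two orders lower; the others fix the outermost argument and come from the
    -- induction hypothesis at nearby points.
    have hσ : σ ∈ Submonoid.closure
        (Set.range fun i : Fin n => Equiv.swap i.castSucc i.succ) := by
      rw [Equiv.Perm.mclosure_swap_castSucc_succ]; trivial
    induction hσ using Submonoid.closure_induction generalizing v with
    | one => rfl
    | mul σ τ _ _ hσ hτ =>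
      rw [Equiv.Perm.coe_mul, ← Function.comp_assoc, hτ, hσ]
    | mem σ hσ =>
      obtain ⟨i, rfl⟩ := hσ
      rcases n with _ | n
      · exact i.elim0
      induction i using Fin.cases with
      | zero =>
        have hfd : fderiv 𝕜 (iteratedFDeriv 𝕜 (n + 1) g) z =
            (((continuousMultilinearCurryLeftEquiv 𝕜 (fun _ : Fin (n + 1) => E) F).symm :
              _ →L[𝕜] _)).comp (fderiv 𝕜 (fderiv 𝕜 (iteratedFDeriv 𝕜 n g)) z) := by
          rw [iteratedFDeriv_succ_eq_comp_left]
          refine HasFDerivAt.fderiv ?_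
          exact (((continuousMultilinearCurryLeftEquiv 𝕜
            (fun _ : Fin (n + 1) => E) F).symm.hasFDerivAt).comp z (((hdiff n hz).fderiv_right
            (m := 1) (by norm_num)).differentiableAt one_ne_zero).hasFDerivAt)
        have key : ∀ v : Fin (n + 1 + 1) → E, iteratedFDeriv 𝕜 (n + 1 + 1) g z v =
            fderiv 𝕜 (fderiv 𝕜 (iteratedFDeriv 𝕜 n g)) z (v 0) (v 1) (Fin.tail (Fin.tail v)) := by
          intro v
          rw [iteratedFDeriv_succ_apply_left, hfd]
          rfl
        rw [key, key, ((hdiff n hz).isSymmSndFDerivAt (by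
          rw [minSmoothness_of_isRCLikeNormedField])) _ _]
        have h0 : (v ∘ Equiv.swap (0 : Fin (n + 1)).castSucc (0 : Fin (n + 1)).succ) 0 = v 1 := by
          simp
        have h1 : (v ∘ Equiv.swap (0 : Fin (n + 1)).castSucc (0 : Fin (n + 1)).succ) 1 = v 0 := by
          simp
        have h2 : Fin.tail (Fin.tail (v ∘ Equiv.swap (0 : Fin (n + 1)).castSucc
            (0 : Fin (n + 1)).succ)) = Fin.tail (Fin.tail v) := by
          funext j
          simp only [Fin.tail, Function.comp_apply]
          rw [Equiv.swap_apply_of_ne_of_ne]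
          · simp [Fin.ext_iff]
          · simp [Fin.ext_iff]
        rw [h0, h1, h2]
      | succ j =>
        rw [((hdiff _ hz).differentiableAt two_ne_zero).iteratedFDeriv_succ_apply_left',
          ((hdiff _ hz).differentiableAt two_ne_zero).iteratedFDeriv_succ_apply_left']
        have h0 : (v ∘ Equiv.swap j.succ.castSucc j.succ.succ) 0 = v 0 := by
          simp only [Function.comp_apply]
          rw [Equiv.swap_apply_of_ne_of_ne]
          · simp [Fin.ext_iff]
          · simp [Fin.ext_iff]
        have h1 : Fin.tail (v ∘ Equiv.swap j.succ.castSucc j.succ.succ) =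
            Fin.tail v ∘ Equiv.swap j.castSucc j.succ := by
          funext l
          simp only [Fin.tail, Function.comp_apply]
          congr 1
          rw [← Fin.succ_castSucc]
          exact ((Fin.succ_injective _).map_swap _ _ l).symm
        rw [h0, h1]
        refine congrArg (fun T : E →L[𝕜] F => T (v 0)) (Filter.EventuallyEq.fderiv_eq ?_)
        filter_upwards [hV.mem_nhds hz] with y hy
        exact ih hy _ _

/-- The Taylor polynomial of order `n` of a function at a point. -/
def taylorPolynomial (𝕜 : Type*) {E F : Type*} [RCLike 𝕜] [NormedAddCommGroup E] [NormedSpace 𝕜 E]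
    [NormedAddCommGroup F] [NormedSpace 𝕜 F] (n : ℕ) (g : E → F) (z₀ z : E) : F :=
  ∑ k ∈ Finset.range (n + 1), (k.factorial : 𝕜)⁻¹ • iteratedFDeriv 𝕜 k g z₀ fun _ => z - z₀

/-- The `k`-th derivative of a power series at its center is its `k`-th coefficient summed over all
permutations of the arguments. By symmetry these `k!` terms agree and cancel the factor `1 / k!`. -/
theorem iteratedFDeriv_taylorPolynomial [CompleteSpace F] {V : Set E} (hV : IsOpen V) {g : E → F}
    (hg : ContDiffOn 𝕜 ∞ g V) {z₀ : E} (hz : z₀ ∈ V) {n k : ℕ} (hk : k ≤ n) :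
    iteratedFDeriv 𝕜 k (taylorPolynomial 𝕜 n g z₀) z₀ = iteratedFDeriv 𝕜 k g z₀ := by
  let p : FormalMultilinearSeries 𝕜 E F := fun k =>
    if k ≤ n then (k.factorial : 𝕜)⁻¹ • iteratedFDeriv 𝕜 k g z₀ else 0
  have hp : HasFiniteFPowerSeriesOnBall (taylorPolynomial 𝕜 n g z₀) p z₀ (n + 1) ⊤ := by
    refine .mk' (fun m hm => if_neg (by omega)) (by simp) fun y _ => ?_
    refine Finset.sum_congr rfl fun k hk => ?_
    have hk' : k ≤ n := Nat.lt_succ_iff.1 (Finset.mem_range.1 hk)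
    simp only [p, if_pos hk', add_sub_cancel_left]
    rfl
  ext v
  rw [hp.toHasFPowerSeriesOnBall.iteratedFDeriv_eq_sum_of_completeSpace]
  simp only [p, if_pos hk, smul_apply]
  refine (Finset.sum_congr rfl fun σ _ => congrArg ((k.factorial : 𝕜)⁻¹ • ·)
    (iteratedFDeriv_comp_perm_of_contDiffOn hV hg k hz v σ)).trans ?_
  rw [Finset.sum_const, Finset.card_univ, Fintype.card_perm, Fintype.card_fin,
    ← Nat.cast_smul_eq_nsmul 𝕜, smul_smul, mul_inv_cancel₀ (by
      exact_mod_cast Nat.factorial_ne_zero k), one_smul]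

/-- The Taylor polynomial expanded in monomials. -/
theorem taylorPolynomial_eq_sum_monomial {ι : Type*} [Fintype ι] (b : Module.Basis ι 𝕜 E)
    (n : ℕ) (g : E → 𝕜) (z₀ z : E) :
    taylorPolynomial 𝕜 n g z₀ z = ∑ k ∈ Finset.range (n + 1), ∑ r : Fin k → ι,
      ((k.factorial : 𝕜)⁻¹ * iteratedFDeriv 𝕜 k g z₀ (b ∘ r)) *
        ∏ j, b.repr (z - z₀) (r j) := by
  classical
  refine Finset.sum_congr rfl fun k _ => ?_
  have h : (fun _ : Fin k => z - z₀) =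
      fun _ => ∑ i, b.repr (z - z₀) i • b i := by rw [b.sum_repr]
  rw [h, ContinuousMultilinearMap.map_sum, Finset.smul_sum]
  refine Finset.sum_congr rfl fun r _ => ?_
  rw [ContinuousMultilinearMap.map_smul_univ, smul_eq_mul, smul_eq_mul]
  simp only [Function.comp_def]
  ring

end Taylor

/-! ### Monomials in local coordinates -/

section Coordinates

variable {𝕜 E H : Type*} [RCLike 𝕜] [NormedAddCommGroup E] [NormedSpace 𝕜 E]
  [TopologicalSpace H] {I : ModelWithCorners 𝕜 E H} {M : Type*} [TopologicalSpace M]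
  [ChartedSpace H M]

/-- Evaluation of smooth functions at a point. -/
def evalAt {U : Opens M} (y : U) : C^∞⟮I, U; 𝕜⟯ →ₐ[𝕜] 𝕜 :=
  { ContMDiffMap.evalRingHom (I := I) (I' := 𝓘(𝕜, 𝕜)) (n := ∞) (R := 𝕜) y with
    commutes' := fun _ => rfl }

theorem evalAt_apply {U : Opens M} (y : U) (f : C^∞⟮I, U; 𝕜⟯) : evalAt y f = f y := rfl

variable (H) in
/-- The domain of the preferred chart at a point. -/
def chartDomain (x₀ : M) : Opens M := ⟨(chartAt H x₀).source, (chartAt H x₀).open_source⟩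

variable (H) in
/-- The base point of the preferred chart. -/
def chartPoint (x₀ : M) : chartDomain H x₀ := ⟨x₀, mem_chart_source H x₀⟩

variable [IsManifold I ∞ M] [FiniteDimensional 𝕜 E] {ι : Type*}

variable (I) in
/-- The coordinates, with respect to a basis of the model space, in the preferred chart at a point,
vanishing at that point. -/
def coordFun (b : Module.Basis ι 𝕜 E) (x₀ : M) (i : ι) : C^∞⟮I, chartDomain H x₀; 𝕜⟯ :=
  ⟨fun y => b.repr (extChartAt I x₀ y - extChartAt I x₀ x₀) i, fun y => by
    have h : ContDiff 𝕜 ∞ fun z : E => b.repr (z - extChartAt I x₀ x₀) i :=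
      (LinearMap.toContinuousLinearMap (b.coord i)).contDiff.comp
        (contDiff_id.sub contDiff_const)
    exact contMDiffAt_subtype_iff.2 (h.contMDiff.contMDiffAt.comp (y : M)
      (contMDiffAt_extChartAt' y.2))⟩

theorem coordFun_apply (b : Module.Basis ι 𝕜 E) (x₀ : M) (i : ι) (y : chartDomain H x₀) :
    coordFun I b x₀ i y = b.repr (extChartAt I x₀ y - extChartAt I x₀ x₀) i := rfl

/-- A differential operator of order at most `n` annihilating, at `x₀`, all monomials of degree at
most `n` in the coordinates at `x₀` annihilates all functions at `x₀`. -/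
theorem HasOrderLE.apply_eq_zero_of_monomial [I.Boundaryless] [Fintype ι]
    (b : Module.Basis ι 𝕜 E) (x₀ : M) {n : ℕ} {D : LocalOperators I M} (hD : HasOrderLE n D)
    (h : ∀ s : Multiset ι, Multiset.card s ≤ n →
      D (chartDomain H x₀) (s.map (coordFun I b x₀)).prod (chartPoint H x₀) = 0)
    (U : Opens M) (f : C^∞⟮I, U; 𝕜⟯) (hx : x₀ ∈ U) : D U f ⟨x₀, hx⟩ = 0 := by
  obtain ⟨W, hxW, hW, a, -, H0⟩ := hD x₀
  set g : E → 𝕜 := extendZero f ∘ (extChartAt I x₀).symm with hg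
  set z₀ := extChartAt I x₀ x₀ with hz₀
  -- `q` is the Taylor polynomial of `f` written in the coordinates at `x₀`. The operator has order
  -- at most `n`, hence takes the same value on `f` and on `q` there.
  let q : C^∞⟮I, chartDomain H x₀; 𝕜⟯ := ∑ k ∈ Finset.range (n + 1), ∑ r : Fin k → ι,
    ((k.factorial : 𝕜)⁻¹ * iteratedFDeriv 𝕜 k g z₀ (b ∘ r)) • ∏ j, coordFun I b x₀ (r j)
  have hq : extendZero q ∘ (extChartAt I x₀).symm =ᶠ[nhds z₀] taylorPolynomial 𝕜 n g z₀ := by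
    filter_upwards [(isOpen_extChartAt_target (I := I) x₀).mem_nhds (mem_extChartAt_target x₀)]
      with z hz
    have hz' : (extChartAt I x₀).symm z ∈ (chartAt H x₀).source := by
      rw [← extChartAt_source I]; exact (extChartAt I x₀).map_target hz
    refine (extendZero_apply q ⟨_, hz'⟩).trans ?_
    rw [taylorPolynomial_eq_sum_monomial b, ← evalAt_apply, map_sum]
    refine Finset.sum_congr rfl fun k _ => ?_
    rw [map_sum]
    refine Finset.sum_congr rfl fun r _ => ?_
    rw [map_smul, map_prod, smul_eq_mul]
    refine congrArg _ (Finset.prod_congr rfl fun j _ => ?_)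
    rw [evalAt_apply, coordFun_apply, (extChartAt I x₀).right_inv hz]
  have hWU : IsOpen ((U : Set M) ∩ (chartAt H x₀).source) :=
    U.2.inter (chartAt H x₀).open_source
  have h1 : D U f ⟨x₀, hx⟩ = D (chartDomain H x₀) q (chartPoint H x₀) := by
    rw [H0 U f ⟨x₀, hx⟩ hxW, H0 _ q (chartPoint H x₀) hxW]
    refine Finset.sum_congr rfl fun k hk => congrArg _ ?_
    refine Eq.trans ?_ (hq.iteratedFDeriv 𝕜 k).eq_of_nhds.symm
    exact (iteratedFDeriv_taylorPolynomial (isOpen_extChartAt_image x₀ hWU Set.inter_subset_right)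
      (contDiffOn_extendZero_comp x₀ f Set.inter_subset_right Set.inter_subset_left)
      ⟨x₀, ⟨hx, mem_chart_source H x₀⟩, rfl⟩ (Nat.lt_succ_iff.1 (Finset.mem_range.1 hk))).symm
  rw [h1, ← evalAt_apply, map_sum, map_sum]
  refine Finset.sum_eq_zero fun k hk => ?_
  rw [map_sum, map_sum]
  refine Finset.sum_eq_zero fun r _ => ?_
  rw [map_smul, map_smul, evalAt_apply]
  have h2 := h (Finset.univ.val.map r) (by
    simpa using Nat.lt_succ_iff.1 (Finset.mem_range.1 hk))
  rw [Multiset.map_map] at h2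
  exact (congrArg _ h2).trans (smul_zero _)

theorem evalAt_coordFun (b : Module.Basis ι 𝕜 E) (x₀ : M) (i : ι) :
    evalAt (chartPoint H x₀) (coordFun I b x₀ i) = 0 := by
  rw [evalAt_apply, coordFun_apply]
  change b.repr (extChartAt I x₀ x₀ - extChartAt I x₀ x₀) i = 0
  simp

theorem mfderiv_extendZero_coordFun [I.Boundaryless] [DecidableEq ι] (b : Module.Basis ι 𝕜 E)
    (x₀ : M) (i j : ι) :
    (mfderiv I 𝓘(𝕜, 𝕜) (extendZero (coordFun I b x₀ j)) x₀ (b i : E) : 𝕜) =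
      ((if i = j then 1 else 0 : 𝕜) : 𝕜) := by
  refine (mfderiv_apply_eq_fderiv_self (mdifferentiableAt_extendZero _
    (mem_chart_source H x₀)) _).trans ?_
  have h : extendZero (coordFun I b x₀ j) ∘ (extChartAt I x₀).symm =ᶠ[nhds (extChartAt I x₀ x₀)]
      fun z => LinearMap.toContinuousLinearMap (b.coord j) (z - extChartAt I x₀ x₀) := by
    filter_upwards [(isOpen_extChartAt_target (I := I) x₀).mem_nhds (mem_extChartAt_target x₀)]
      with z hz
    have hz' : (extChartAt I x₀).symm z ∈ (chartAt H x₀).source := by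
      rw [← extChartAt_source I]; exact (extChartAt I x₀).map_target hz
    refine (extendZero_apply (coordFun I b x₀ j) ⟨_, hz'⟩).trans ?_
    rw [coordFun_apply, (extChartAt I x₀).right_inv hz]
    rfl
  have h' : HasFDerivAt (fun z => LinearMap.toContinuousLinearMap (b.coord j)
      (z - extChartAt I x₀ x₀)) (LinearMap.toContinuousLinearMap (b.coord j))
      (extChartAt I x₀ x₀) :=
    ((LinearMap.toContinuousLinearMap (b.coord j)).hasFDerivAt.comp _
      ((hasFDerivAt_id _).sub_const _))
  refine (congrArg (fun T : E →L[𝕜] 𝕜 => T (b i)) (h.fderiv_eq.trans h'.fderiv)).trans ?_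
  change b.repr (b i) j = _
  rw [b.repr_self, Finsupp.single_apply]

end Coordinates

/-! ### The enveloping algebra as the algebra of left-invariant differential operators -/

section Isomorphism

variable {𝕜 E H : Type*} [RCLike 𝕜] [NormedAddCommGroup E] [NormedSpace 𝕜 E]
  [FiniteDimensional 𝕜 E] [CompleteSpace E]
  [TopologicalSpace H] {I : ModelWithCorners 𝕜 E H} [I.Boundaryless] {G : Type*}
  [TopologicalSpace G] [ChartedSpace H G] [Group G] [LieGroup I ∞ G]

omit [FiniteDimensional 𝕜 E] [CompleteSpace E] [I.Boundaryless] [LieGroup I ∞ G] in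
theorem mulInvariantVectorField_one (X : GroupLieAlgebra I G) :
    mulInvariantVectorField X (1 : G) = X := by
  have h : ((1 : G) * ·) = (id : G → G) := funext one_mul
  rw [mulInvariantVectorField, h, mfderiv_id]
  rfl

/-- The enveloping algebra acting on the smooth functions on an open subset. -/
def envAction (U : Opens G) :
    UniversalEnvelopingAlgebra 𝕜 (GroupLieAlgebra I G) →ₐ[𝕜] Module.End 𝕜 C^∞⟮I, U; 𝕜⟯ :=
  ((Pi.evalAlgHom 𝕜 (fun U : Opens G => Module.End 𝕜 C^∞⟮I, U; 𝕜⟯) U).comp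
    (leftInvDiffOps I G).val).comp (envToLeftInv I G)

omit [FiniteDimensional 𝕜 E] in
theorem envAction_apply (U : Opens G) (u : UniversalEnvelopingAlgebra 𝕜 (GroupLieAlgebra I G)) :
    envAction U u = (envToLeftInv I G u : LocalOperators I G) U := rfl

omit [FiniteDimensional 𝕜 E] in
theorem envAction_ι_mul (U : Opens G) (X : GroupLieAlgebra I G) (f g : C^∞⟮I, U; 𝕜⟯) :
    envAction U (UniversalEnvelopingAlgebra.ι 𝕜 X) (f * g) =
      f * envAction U (UniversalEnvelopingAlgebra.ι 𝕜 X) g +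
        g * envAction U (UniversalEnvelopingAlgebra.ι 𝕜 X) f := by
  rw [envAction_apply, envToLeftInv_ι]
  exact vectorFieldOperator_mul _ _ U f g

variable (I G) in
/-- A basis of the Lie algebra, which is the model space. -/
def lieAlgebraBasis : Module.Basis (Fin (Module.finrank 𝕜 E)) 𝕜 (GroupLieAlgebra I G) :=
  (Module.finBasis 𝕜 E : Module.Basis (Fin (Module.finrank 𝕜 E)) 𝕜 E)

/-- Since `X^L(1) = X`, the chart coordinates at the identity are dual to the basis of the Lie
algebra, as the abstract pairing requires. -/
theorem evalAt_envAction_coordFun (i j : Fin (Module.finrank 𝕜 E)) :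
    evalAt (chartPoint H (1 : G)) (envAction (chartDomain H (1 : G))
      (UniversalEnvelopingAlgebra.ι 𝕜 (lieAlgebraBasis I G i))
        (coordFun I (Module.finBasis 𝕜 E) (1 : G) j)) = if i = j then 1 else 0 := by
  rw [evalAt_apply, envAction_apply, envToLeftInv_ι, invariantFieldOperator_apply]
  refine (congrArg (mfderiv I 𝓘(𝕜, 𝕜) (extendZero (coordFun I (Module.finBasis 𝕜 E) (1 : G) j))
    (1 : G)) (mulInvariantVectorField_one (lieAlgebraBasis I G i))).trans ?_
  exact mfderiv_extendZero_coordFun (Module.finBasis 𝕜 E) (1 : G) i j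

omit [CompleteSpace E] in
theorem leftInvDiffOps_eq_zero_of_monomial {n : ℕ} {D : LocalOperators I G} (hD : D ∈ leftInvDiffOps I G)
    (hn : HasOrderLE n D)
    (h : ∀ s : Multiset (Fin (Module.finrank 𝕜 E)), Multiset.card s ≤ n →
      D (chartDomain H 1) (s.map (coordFun I (Module.finBasis 𝕜 E) (1 : G))).prod
        (chartPoint H 1) = 0) : D = 0 :=
  leftInvDiffOps_eq_zero hD fun U f h1 =>
    hn.apply_eq_zero_of_monomial (Module.finBasis 𝕜 E) 1 h U f h1

theorem envToLeftInv_injective : Function.Injective (envToLeftInv I G) := by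
  rw [injective_iff_map_eq_zero]
  intro u hu
  obtain ⟨n, hn⟩ := exists_mem_envFiltration u
  refine eq_zero_of_ev_monomial (K := 𝕜) (L := GroupLieAlgebra I G)
    (A := C^∞⟮I, chartDomain H (1 : G); 𝕜⟯) (envAction (chartDomain H (1 : G)))
    (fun X a c => envAction_ι_mul _ X a c) (lieAlgebraBasis I G) (evalAt (chartPoint H 1)) (coordFun I (Module.finBasis 𝕜 E) 1)
    (evalAt_coordFun _ _) evalAt_envAction_coordFun n hn fun s _ => ?_
  rw [envAction_apply, hu]
  rfl

/-- Choose `u` of filtration degree at most `n` with the same values as `D` on the coordinate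
monomials at the identity; the difference is left-invariant of order at most `n` and annihilates
them all. Keeping the bound on `u` gives the equality of filtrations besides surjectivity. -/
theorem exists_envToLeftInv_eq {n : ℕ} {D : LocalOperators I G} (hD : D ∈ leftInvDiffOps I G)
    (hn : HasOrderLE n D) : ∃ u ∈ envFiltration 𝕜 (GroupLieAlgebra I G) n,
      (envToLeftInv I G u : LocalOperators I G) = D := by
  obtain ⟨u, hu, h⟩ := exists_ev_monomial_eq (K := 𝕜) (L := GroupLieAlgebra I G)
    (A := C^∞⟮I, chartDomain H (1 : G); 𝕜⟯) (envAction (chartDomain H (1 : G)))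
    (fun X a c => envAction_ι_mul _ X a c) (lieAlgebraBasis I G) (evalAt (chartPoint H 1))
    (coordFun I (Module.finBasis 𝕜 E) 1) (evalAt_coordFun _ _) evalAt_envAction_coordFun n
    fun s => D (chartDomain H 1) (s.map (coordFun I (Module.finBasis 𝕜 E) (1 : G))).prod
        (chartPoint H 1)
  refine ⟨u, hu, ?_⟩
  rw [← sub_eq_zero]
  refine leftInvDiffOps_eq_zero_of_monomial (n := n) (sub_mem (envToLeftInv I G u).2 hD) ?_ fun s hs => ?_
  · rw [sub_eq_add_neg, ← neg_one_smul 𝕜 D]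
    exact (hasOrderLE_envToLeftInv n hu).add (hn.smul (-1))
  · have := h s hs
    rw [evalAt_apply, envAction_apply] at this
    exact sub_eq_zero.2 this

variable (I G) in
/-- The enveloping algebra is isomorphic to the algebra of left-invariant differential operators. -/
def envEquivLeftInv :
    UniversalEnvelopingAlgebra 𝕜 (GroupLieAlgebra I G) ≃ₐ[𝕜] leftInvDiffOps I G :=
  AlgEquiv.ofBijective (envToLeftInv I G) ⟨envToLeftInv_injective, fun D => by
    obtain ⟨n, hn⟩ := D.2.1
    obtain ⟨u, -, hu⟩ := exists_envToLeftInv_eq D.2 hn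
    exact ⟨u, Subtype.ext hu⟩⟩

theorem envEquivLeftInv_apply (u : UniversalEnvelopingAlgebra 𝕜 (GroupLieAlgebra I G)) :
    envEquivLeftInv I G u = envToLeftInv I G u := rfl

theorem map_envFiltration_envEquivLeftInv (n : ℕ) :
    (envFiltration 𝕜 (GroupLieAlgebra I G) n).map (envEquivLeftInv I G).toLinearMap =
      leftInvFiltration I G n := by
  ext D
  constructor
  · rintro ⟨u, hu, rfl⟩
    exact hasOrderLE_envToLeftInv n hu
  · intro h
    obtain ⟨u, hu, hD⟩ := exists_envToLeftInv_eq D.2 h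
    exact ⟨u, hu, Subtype.ext hD⟩

end Isomorphism

/-! ### Differentiation with respect to a parameter -/

section Parameter

variable {𝕜 E E' : Type*} [RCLike 𝕜] [NormedAddCommGroup E] [NormedSpace 𝕜 E]
  [NormedAddCommGroup E'] [NormedSpace 𝕜 E']

theorem ContDiffOn.differentiableAt_iteratedFDeriv {V : Set E} {f : E → 𝕜}
    (hf : ContDiffOn 𝕜 ∞ f V) (hV : IsOpen V) {z : E} (hz : z ∈ V) (k : ℕ) :
    DifferentiableAt 𝕜 (iteratedFDeriv 𝕜 k f) z :=
  (IsLocalDiffOp.hasFDerivAt_iteratedFDeriv hV hf hz k).differentiableAt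

/-- Higher partial derivatives in the second variable. -/
theorem iteratedFDeriv_slice {V : Set (E' × E)} (hV : IsOpen V) {F : E' × E → 𝕜}
    (hF : ContDiffOn 𝕜 ∞ F V) (k : ℕ) {w : E'} {z : E} (h : (w, z) ∈ V) (v : Fin k → E) :
    iteratedFDeriv 𝕜 k (fun z => F (w, z)) z v =
      iteratedFDeriv 𝕜 k F (w, z) fun i => ((0 : E'), v i) := by
  have hS : IsOpen {z : E | (w, z) ∈ V} := hV.preimage (by fun_prop)
  have hFS : ContDiffOn 𝕜 ∞ (fun z => F (w, z)) {z : E | (w, z) ∈ V} :=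
    hF.comp (contDiff_prodMk_right w).contDiffOn fun z hz => hz
  induction k generalizing z with
  | zero => rfl
  | succ k ih =>
    rw [(hFS.differentiableAt_iteratedFDeriv hS h k).iteratedFDeriv_succ_apply_left',
      (hF.differentiableAt_iteratedFDeriv hV h k).iteratedFDeriv_succ_apply_left']
    have h1 : (fun y => iteratedFDeriv 𝕜 k (fun z => F (w, z)) y (Fin.tail v)) =ᶠ[nhds z]
        (fun p => iteratedFDeriv 𝕜 k F p fun i => ((0 : E'), Fin.tail v i)) ∘ fun z => (w, z) := by
      filter_upwards [hS.mem_nhds h] with y hy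
      exact ih hy _
    have h2 : DifferentiableAt 𝕜
        (fun p => iteratedFDeriv 𝕜 k F p fun i => ((0 : E'), Fin.tail v i)) (w, z) :=
      (hF.differentiableAt_iteratedFDeriv hV h k).continuousMultilinear_apply_const _
    rw [h1.fderiv_eq, (h2.hasFDerivAt.comp z (hasFDerivAt_prodMk_right w z)).fderiv]
    rfl

/-- Higher derivatives of a directional derivative. -/
theorem iteratedFDeriv_fderiv_apply {V : Set E} (hV : IsOpen V) {F : E → 𝕜}
    (hF : ContDiffOn 𝕜 ∞ F V) (k : ℕ) {z : E} (hz : z ∈ V) (e : E) (v : Fin k → E) :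
    iteratedFDeriv 𝕜 k (fun z => fderiv 𝕜 F z e) z v =
      fderiv 𝕜 (iteratedFDeriv 𝕜 k F) z e v := by
  have h1 : ContDiffAt 𝕜 ∞ (fderiv 𝕜 F) z :=
    (hF.contDiffAt (hV.mem_nhds hz)).fderiv_right (by simp)
  have h2 := ContinuousLinearMap.iteratedFDeriv_comp_left (ContinuousLinearMap.apply 𝕜 𝕜 e) h1
    (i := k) (by exact_mod_cast le_top)
  have h3 : (fun z => fderiv 𝕜 F z e) = ContinuousLinearMap.apply 𝕜 𝕜 e ∘ fderiv 𝕜 F := rfl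
  rw [h3, h2]
  -- Differentiating along `e` first puts `e` in the last slot, differentiating along it last puts
  -- it in the first; symmetry identifies the two.
  have h4 : iteratedFDeriv 𝕜 (k + 1) F z (Fin.snoc (α := fun _ => E) v e) =
      iteratedFDeriv 𝕜 (k + 1) F z (Fin.cons (α := fun _ => E) e v) := by
    rw [Fin.snoc_eq_cons_rotate]
    exact iteratedFDeriv_comp_perm_of_contDiffOn hV hF (k + 1) hz _ _
  have h5 := iteratedFDeriv_succ_apply_right (𝕜 := 𝕜) (f := F) (x := z)
    (Fin.snoc (α := fun _ => E) v e)
  rw [Fin.init_snoc, Fin.snoc_last] at h5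
  exact (h5.symm.trans h4).trans (iteratedFDeriv_succ_apply_left _)

/-- Higher derivatives in one variable commute with the derivative in the other variable. -/
theorem hasFDerivAt_iteratedFDeriv_slice {V : Set (E' × E)} (hV : IsOpen V) {F : E' × E → 𝕜}
    (hF : ContDiffOn 𝕜 ∞ F V) (k : ℕ) {w₀ : E'} {z₀ : E} (h : (w₀, z₀) ∈ V) :
    ∃ T : E' →L[𝕜] E [×k]→L[𝕜] 𝕜,
      HasFDerivAt (fun w => iteratedFDeriv 𝕜 k (fun z => F (w, z)) z₀) T w₀ ∧
      ∀ y, T y = iteratedFDeriv 𝕜 k (fun z => fderiv 𝕜 (fun w => F (w, z)) w₀ y) z₀ := by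
  let C : ((E' × E) [×k]→L[𝕜] 𝕜) →L[𝕜] (E [×k]→L[𝕜] 𝕜) :=
    ContinuousMultilinearMap.compContinuousLinearMapL fun _ => ContinuousLinearMap.inr 𝕜 E' E
  -- `T` is the derivative of the full `k`-th derivative in the parameter direction, with its
  -- remaining arguments restricted to the second variable.
  refine ⟨C.comp ((fderiv 𝕜 (iteratedFDeriv 𝕜 k F) (w₀, z₀)).comp
    (ContinuousLinearMap.inl 𝕜 E' E)), ?_, fun y => ?_⟩
  · have h1 : (fun w => iteratedFDeriv 𝕜 k (fun z => F (w, z)) z₀) =ᶠ[nhds w₀]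
        fun w => C (iteratedFDeriv 𝕜 k F (w, z₀)) := by
      have hS : IsOpen {w : E' | (w, z₀) ∈ V} := hV.preimage (by fun_prop)
      filter_upwards [hS.mem_nhds h] with w hw
      ext v
      exact iteratedFDeriv_slice hV hF k hw v
    refine HasFDerivAt.congr_of_eventuallyEq ?_ h1
    exact C.hasFDerivAt.comp w₀ ((hF.differentiableAt_iteratedFDeriv hV h k).hasFDerivAt.comp w₀
      (hasFDerivAt_prodMk_left w₀ z₀))
  · ext v
    have h1 : (fun z => fderiv 𝕜 (fun w => F (w, z)) w₀ y) =ᶠ[nhds z₀]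
        fun z => fderiv 𝕜 F (w₀, z) (y, 0) := by
      have hS : IsOpen {z : E | (w₀, z) ∈ V} := hV.preimage (by fun_prop)
      filter_upwards [hS.mem_nhds h] with z hz
      have hd : DifferentiableAt 𝕜 F (w₀, z) :=
        (hF.contDiffAt (hV.mem_nhds hz)).differentiableAt (by simp)
      exact congrArg (fun T : E' →L[𝕜] 𝕜 => T y)
        (hd.hasFDerivAt.comp w₀ (hasFDerivAt_prodMk_left w₀ z)).fderiv
    rw [(h1.iteratedFDeriv 𝕜 k).eq_of_nhds,
      iteratedFDeriv_slice (F := fun p => fderiv 𝕜 F p (y, 0)) hV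
        ((hF.fderiv_of_isOpen hV (by simp)).clm_apply contDiffOn_const) k h v,
      iteratedFDeriv_fderiv_apply hV hF k h]
    rfl

end Parameter

/-! ### Differential operators at a point, and dependence on a parameter -/

section ChartFunctional

variable {𝕜 E H : Type*} [RCLike 𝕜] [NormedAddCommGroup E] [NormedSpace 𝕜 E]
  [TopologicalSpace H] {I : ModelWithCorners 𝕜 E H} {M : Type*} [TopologicalSpace M]
  [ChartedSpace H M]

variable (I) in
/-- The functional `F ↦ ∑ k ≤ n, a k (D^k F x₀)`, with the derivatives taken in the chart at
`x₀`. -/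
def chartFunctional (x₀ : M) (n : ℕ) (a : ∀ k : ℕ, (E [×k]→L[𝕜] 𝕜) →L[𝕜] 𝕜) (F : M → 𝕜) : 𝕜 :=
  ∑ k ∈ Finset.range (n + 1),
    a k (iteratedFDeriv 𝕜 k (F ∘ (extChartAt I x₀).symm) (extChartAt I x₀ x₀))

theorem chartFunctional_congr_chart (x₀ : M) (n : ℕ) (a : ∀ k : ℕ, (E [×k]→L[𝕜] 𝕜) →L[𝕜] 𝕜)
    {F F' : M → 𝕜} (h : F ∘ (extChartAt I x₀).symm =ᶠ[nhds (extChartAt I x₀ x₀)]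
      F' ∘ (extChartAt I x₀).symm) :
    chartFunctional I x₀ n a F = chartFunctional I x₀ n a F' :=
  Finset.sum_congr rfl fun k _ => congrArg _ (h.iteratedFDeriv 𝕜 k).eq_of_nhds

theorem eventually_extChartAt_symm (x₀ : M) {p : M → Prop} (h : ∀ᶠ y in nhds x₀, p y) :
    ∀ᶠ z in nhds (extChartAt I x₀ x₀), p ((extChartAt I x₀).symm z) := by
  refine (continuousAt_extChartAt_symm x₀).eventually ?_
  rwa [extChartAt_to_inv]

theorem chartFunctional_congr (x₀ : M) (n : ℕ) (a : ∀ k : ℕ, (E [×k]→L[𝕜] 𝕜) →L[𝕜] 𝕜)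
    {F F' : M → 𝕜} (h : F =ᶠ[nhds x₀] F') :
    chartFunctional I x₀ n a F = chartFunctional I x₀ n a F' :=
  chartFunctional_congr_chart x₀ n a (eventually_extChartAt_symm x₀ h)

theorem chartFunctional_add (x₀ : M) (n : ℕ) (a : ∀ k : ℕ, (E [×k]→L[𝕜] 𝕜) →L[𝕜] 𝕜)
    {F F' : M → 𝕜} (h : ContDiffAt 𝕜 ∞ (F ∘ (extChartAt I x₀).symm) (extChartAt I x₀ x₀))
    (h' : ContDiffAt 𝕜 ∞ (F' ∘ (extChartAt I x₀).symm) (extChartAt I x₀ x₀)) :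
    chartFunctional I x₀ n a (F + F') =
      chartFunctional I x₀ n a F + chartFunctional I x₀ n a F' := by
  rw [chartFunctional, chartFunctional, chartFunctional, ← Finset.sum_add_distrib]
  refine Finset.sum_congr rfl fun k _ => ?_
  rw [← map_add, ← iteratedFDeriv_add_apply (h.of_le (by exact_mod_cast le_top))
    (h'.of_le (by exact_mod_cast le_top))]
  rfl

variable [IsManifold I ∞ M] [I.Boundaryless]

omit [I.Boundaryless] in
theorem mdifferentiableAt_of_chart {x₀ : M} {f : M → 𝕜}
    (h : DifferentiableAt 𝕜 (f ∘ (extChartAt I x₀).symm) (extChartAt I x₀ x₀)) :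
    MDifferentiableAt I 𝓘(𝕜, 𝕜) f x₀ := by
  have h1 : f =ᶠ[nhds x₀] (f ∘ (extChartAt I x₀).symm) ∘ extChartAt I x₀ := by
    filter_upwards [extChartAt_source_mem_nhds (I := I) x₀] with p hp
    rw [Function.comp_apply, Function.comp_apply, (extChartAt I x₀).left_inv hp]
  exact (h.mdifferentiableAt.comp (I' := 𝓘(𝕜, E)) x₀
    (mdifferentiableAt_extChartAt (mem_chart_source H x₀))).congr_of_eventuallyEq h1

/-- Reads both variables in the chart at `x₀`, so that differentiation in a parameter becomes
calculus on an open subset of `E × E`. -/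
theorem exists_contDiffOn_chart_prod (x₀ : M) {U : Opens M} (f : C^∞⟮I, U; 𝕜⟯) {m : M × M → M}
    (hm : ContMDiff (I.prod I) I ∞ m) (hU : m (x₀, x₀) ∈ U) :
    ∃ V : Set (E × E), IsOpen V ∧ (extChartAt I x₀ x₀, extChartAt I x₀ x₀) ∈ V ∧
      ContDiffOn 𝕜 ∞ (fun p => extendZero f
        (m ((extChartAt I x₀).symm p.1, (extChartAt I x₀).symm p.2))) V := by
  set φ := extChartAt I x₀
  have hφ : IsOpen (φ.target ×ˢ φ.target) :=
    (isOpen_extChartAt_target x₀).prod (isOpen_extChartAt_target x₀)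
  have hs : ∀ p ∈ φ.target ×ˢ φ.target, ContMDiffAt 𝓘(𝕜, E × E) I ∞
      (fun p : E × E => m (φ.symm p.1, φ.symm p.2)) p := by
    intro p hp
    have h1 : ContMDiffAt 𝓘(𝕜, E × E) I ∞ (fun p : E × E => φ.symm p.1) p :=
      ((contMDiffOn_extChartAt_symm x₀).contMDiffAt ((isOpen_extChartAt_target x₀).mem_nhds
        hp.1)).comp (I' := 𝓘(𝕜, E)) p contDiff_fst.contMDiff.contMDiffAt
    have h2 : ContMDiffAt 𝓘(𝕜, E × E) I ∞ (fun p : E × E => φ.symm p.2) p :=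
      ((contMDiffOn_extChartAt_symm x₀).contMDiffAt ((isOpen_extChartAt_target x₀).mem_nhds
        hp.2)).comp (I' := 𝓘(𝕜, E)) p contDiff_snd.contMDiff.contMDiffAt
    exact hm.contMDiffAt.comp (I' := I.prod I) p (h1.prodMk h2)
  refine ⟨φ.target ×ˢ φ.target ∩ (fun p : E × E => m (φ.symm p.1, φ.symm p.2)) ⁻¹' U,
    ContinuousOn.isOpen_inter_preimage (fun p hp => (hs p hp).continuousAt.continuousWithinAt)
      hφ U.2, ⟨⟨mem_extChartAt_target x₀, mem_extChartAt_target x₀⟩, ?_⟩, fun p hp => ?_⟩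
  · change m (φ.symm (φ x₀), φ.symm (φ x₀)) ∈ U
    rwa [extChartAt_to_inv]
  · refine ContDiffAt.contDiffWithinAt ?_
    rw [← contMDiffAt_iff_contDiffAt]
    exact (contMDiffAt_extendZero f hp.2).comp (I' := I) p (hs p hp.1)

/-- Differentiation of a chart functional with respect to a parameter. -/
theorem mfderiv_chartFunctional (x₀ : M) (n : ℕ) (a : ∀ k : ℕ, (E [×k]→L[𝕜] 𝕜) →L[𝕜] 𝕜)
    {U : Opens M} (f : C^∞⟮I, U; 𝕜⟯) {m : M × M → M}
    (hm : ContMDiff (I.prod I) I ∞ m) (hU : m (x₀, x₀) ∈ U) :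
    MDifferentiableAt I 𝓘(𝕜, 𝕜)
      (fun p => chartFunctional I x₀ n a fun q => extendZero f (m (p, q))) x₀ ∧
    ∀ Y : TangentSpace I x₀,
      ContDiffAt 𝕜 ∞ ((fun q => (mfderiv I 𝓘(𝕜, 𝕜) (fun p => extendZero f (m (p, q))) x₀ Y : 𝕜)) ∘
        (extChartAt I x₀).symm) (extChartAt I x₀ x₀) ∧
      mfderiv I 𝓘(𝕜, 𝕜) (fun p => chartFunctional I x₀ n a fun q => extendZero f (m (p, q))) x₀ Y =
        chartFunctional I x₀ n a fun q =>
          (mfderiv I 𝓘(𝕜, 𝕜) (fun p => extendZero f (m (p, q))) x₀ Y : 𝕜) := by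
  obtain ⟨V, hV, h0, hF⟩ := exists_contDiffOn_chart_prod x₀ f hm hU
  set φ := extChartAt I x₀ with hφ
  set F : E × E → 𝕜 := fun p => extendZero f (m (φ.symm p.1, φ.symm p.2)) with hFdef
  choose T hT hT' using fun k => hasFDerivAt_iteratedFDeriv_slice hV hF k h0
  -- The functional is a finite sum of continuous linear forms of derivatives in `q`, so
  -- differentiation in `p` passes inside.
  have h1 : HasFDerivAt ((fun p => chartFunctional I x₀ n a fun q => extendZero f (m (p, q))) ∘
      φ.symm) (∑ k ∈ Finset.range (n + 1), (a k).comp (T k)) (φ x₀) := by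
    change HasFDerivAt (fun w => ∑ k ∈ Finset.range (n + 1),
      a k (iteratedFDeriv 𝕜 k (fun z => F (w, z)) (φ x₀))) _ _
    exact HasFDerivAt.fun_sum fun k _ => (a k).hasFDerivAt.comp (φ x₀) (hT k)
  have h2 := mdifferentiableAt_of_chart h1.differentiableAt
  refine ⟨h2, fun Y => ?_⟩
  have hS : IsOpen {z : E | (φ x₀, z) ∈ V} := hV.preimage (by fun_prop)
  have hd : ∀ z, (φ x₀, z) ∈ V → DifferentiableAt 𝕜 F (φ x₀, z) := fun z hz =>
    (hF.contDiffAt (hV.mem_nhds hz)).differentiableAt (by simp)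
  have h3 : ((fun q => (mfderiv I 𝓘(𝕜, 𝕜) (fun p => extendZero f (m (p, q))) x₀ Y : 𝕜)) ∘ φ.symm)
      =ᶠ[nhds (φ x₀)] fun z => fderiv 𝕜 (fun w => F (w, z)) (φ x₀) Y := by
    filter_upwards [hS.mem_nhds h0] with z hz
    refine mfderiv_apply_eq_fderiv_self (f := fun p => extendZero f (m (p, φ.symm z)))
      (mdifferentiableAt_of_chart ?_) Y
    exact DifferentiableAt.comp (g := F) (f := fun w => (w, z)) (φ x₀) (hd z hz)
      (hasFDerivAt_prodMk_left (φ x₀) z).differentiableAt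
  constructor
  · refine ContDiffAt.congr_of_eventuallyEq ?_ h3
    have h4 : (fun z => fderiv 𝕜 (fun w => F (w, z)) (φ x₀) Y) =ᶠ[nhds (φ x₀)]
        fun z => fderiv 𝕜 F (φ x₀, z) ((Y : E), (0 : E)) := by
      filter_upwards [hS.mem_nhds h0] with z hz
      exact congrArg (fun T : E →L[𝕜] 𝕜 => T Y)
        (HasFDerivAt.comp (g := F) (f := fun w => (w, z)) (φ x₀) (hd z hz).hasFDerivAt
          (hasFDerivAt_prodMk_left (φ x₀) z)).fderiv
    refine ContDiffAt.congr_of_eventuallyEq ?_ h4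
    have h5 : ContDiffAt 𝕜 ∞ (fun p => fderiv 𝕜 F p ((Y : E), (0 : E))) (φ x₀, φ x₀) :=
      ((hF.contDiffAt (hV.mem_nhds h0)).fderiv_right (m := ∞) (by simp)).clm_apply
        contDiffAt_const
    exact h5.comp (φ x₀) (contDiff_prodMk_right (φ x₀)).contDiffAt
  · refine (mfderiv_apply_eq_fderiv_self h2 Y).trans ?_
    refine (congrArg (fun T : E →L[𝕜] 𝕜 => T Y) h1.fderiv).trans ?_
    have h6 : ∀ y : E, (∑ k ∈ Finset.range (n + 1), (a k).comp (T k)) y =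
        ∑ k ∈ Finset.range (n + 1), a k (T k y) := fun y => by simp
    refine (h6 Y).trans ?_
    refine Finset.sum_congr rfl fun k _ => ?_
    refine congrArg (a k) ((hT' k Y).trans ?_)
    exact (h3.iteratedFDeriv 𝕜 k).eq_of_nhds.symm

/-- A function on a connected manifold with vanishing derivative is constant. -/
theorem eq_of_mfderiv_eq_zero [PreconnectedSpace M] {f : M → 𝕜}
    (hf : ∀ x, MDifferentiableAt I 𝓘(𝕜, 𝕜) f x)
    (hf' : ∀ x (v : TangentSpace I x), mfderiv I 𝓘(𝕜, 𝕜) f x v = 0) (x y : M) : f x = f y := by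
  refine IsLocallyConstant.apply_eq_of_preconnectedSpace
    ((IsLocallyConstant.iff_eventually_eq f).2 fun x₀ => ?_) x y
  obtain ⟨r, hr, hball⟩ := Metric.isOpen_iff.1 (isOpen_extChartAt_target (I := I) x₀) _
    (mem_extChartAt_target x₀)
  have hd : ∀ z ∈ Metric.ball (extChartAt I x₀ x₀) r,
      MDifferentiableAt 𝓘(𝕜, E) 𝓘(𝕜, 𝕜) (f ∘ (extChartAt I x₀).symm) z ∧
      fderiv 𝕜 (f ∘ (extChartAt I x₀).symm) z = 0 := by
    intro z hz
    have hs : MDifferentiableAt 𝓘(𝕜, E) I (extChartAt I x₀).symm z :=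
      ((contMDiffOn_extChartAt_symm (n := ∞) x₀).contMDiffAt
        ((isOpen_extChartAt_target x₀).mem_nhds (hball hz))).mdifferentiableAt (by simp)
    refine ⟨(hf _).comp (I' := I) z hs, ?_⟩
    rw [← mfderiv_eq_fderiv, mfderiv_comp (I' := I) z (hf _) hs]
    exact ContinuousLinearMap.ext fun v => hf' _ _
  filter_upwards [extChartAt_source_mem_nhds (I := I) x₀,
    (continuousAt_extChartAt x₀).preimage_mem_nhds (Metric.ball_mem_nhds (extChartAt I x₀ x₀) hr)] with p hp hpr
  -- Convexity, hence connectedness, of the ball refers to the underlying real space, also when `𝕜`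
  -- is `ℂ`.
  let _ : NormedSpace ℝ E := NormedSpace.restrictScalars ℝ 𝕜 E
  have h := Metric.isOpen_ball.is_const_of_fderiv_eq_zero (convex_ball _ r).isPreconnected
    (f := f ∘ (extChartAt I x₀).symm)
    (fun z hz => ((hd z hz).1.differentiableAt).differentiableWithinAt)
    (fun z hz => (hd z hz).2) hpr (Metric.mem_ball_self hr)
  rwa [Function.comp_apply, Function.comp_apply, extChartAt_to_inv, (extChartAt I x₀).left_inv hp]
    at h

end ChartFunctional

/-! ### Bi-invariant differential operators -/

section Conjugation

variable {𝕜 E H : Type*} [RCLike 𝕜] [NormedAddCommGroup E] [NormedSpace 𝕜 E]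
  [TopologicalSpace H] {I : ModelWithCorners 𝕜 E H} {G : Type*}
  [TopologicalSpace G] [ChartedSpace H G]

/-- The derivative of a scalar function along a tangent vector, as a scalar. -/
def scalarDeriv (F : G → 𝕜) (x : G) (v : TangentSpace I x) : 𝕜 := mfderiv I 𝓘(𝕜, 𝕜) F x v

/-- The identity is global, both sides being zero off the preimage of `U`. Translates can then be
composed without tracking domains. -/
theorem extendZero_pullbackFun (φ : C^∞⟮I, G; I, G⟯) (U : Opens G) (f : C^∞⟮I, U; 𝕜⟯) :
    extendZero (pullbackFun φ U f) = extendZero f ∘ φ := by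
  funext x
  by_cases hx : φ x ∈ U
  · exact (extendZero_apply (pullbackFun φ U f) ⟨x, hx⟩).trans
      (extendZero_apply f ⟨φ x, hx⟩).symm
  · have h1 : ¬ ∃ y : Opens.comap ⟨φ, φ.contMDiff.continuous⟩ U, (y : G) = x := by
      rintro ⟨y, rfl⟩; exact hx y.2
    have h2 : ¬ ∃ y : U, (y : G) = φ x := by
      rintro ⟨y, hy⟩; exact hx (hy ▸ y.2)
    rw [extendZero, Function.extend_apply' _ _ _ h1, Function.comp_apply, extendZero,
      Function.extend_apply' _ _ _ h2]
    rfl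

variable [Group G] [LieGroup I ∞ G]

variable (I) in
/-- Conjugation by an element of a Lie group. -/
def conjMap (h : G) : C^∞⟮I, G; I, G⟯ :=
  ⟨fun x => h * x * h⁻¹, (contMDiff_mul_right (I := I) (n := ∞) (a := h⁻¹)).comp
    (contMDiff_mul_left (I := I) (n := ∞) (a := h))⟩

theorem conjMap_apply (h x : G) : conjMap I h x = h * x * h⁻¹ := rfl

variable [I.Boundaryless]

omit [LieGroup I ∞ G] [I.Boundaryless] in
/-- A differential operator at the identity is a chart functional. -/
theorem HasOrderLE.exists_chartFunctional {D : LocalOperators I G} {n : ℕ} (hn : HasOrderLE n D) :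
    ∃ a : ∀ k : ℕ, (E [×k]→L[𝕜] 𝕜) →L[𝕜] 𝕜, ∀ (U : Opens G) (f : C^∞⟮I, U; 𝕜⟯)
      (h1 : (1 : G) ∈ U), D U f ⟨1, h1⟩ = chartFunctional I 1 n a (extendZero f) := by
  obtain ⟨W, h1W, -, a, -, h⟩ := hn 1
  exact ⟨fun k => a k (extChartAt I 1 (1 : G)), fun U f h1 => h U f ⟨1, h1⟩ h1W⟩

variable {D : LocalOperators I G} {n : ℕ} {a : ∀ k : ℕ, (E [×k]→L[𝕜] 𝕜) →L[𝕜] 𝕜}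

/-- Translating to the identity expresses the whole operator by one functional, with the point
entering only as a parameter that can be differentiated. -/
theorem leftInvDiffOps_apply_eq (hD : D ∈ leftInvDiffOps I G)
    (ha : ∀ (U : Opens G) (f : C^∞⟮I, U; 𝕜⟯) (h1 : (1 : G) ∈ U),
      D U f ⟨1, h1⟩ = chartFunctional I 1 n a (extendZero f))
    (U : Opens G) (f : C^∞⟮I, U; 𝕜⟯) (g : U) :
    D U f g = chartFunctional I 1 n a fun x => extendZero f ((g : G) * x) := by
  have h1 : (1 : G) ∈ Opens.comap ⟨𝑳 I (g : G), (𝑳 I (g : G)).contMDiff.continuous⟩ U := by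
    change (g : G) * 1 ∈ U
    rw [mul_one]; exact g.2
  have h2 := ha _ (pullbackFun (𝑳 I (g : G)) U f) h1
  rw [leftInvDiffOps_apply hD, extendZero_pullbackFun] at h2
  refine Eq.trans ?_ h2
  have h4 : (⟨(g : G) * 1, h1⟩ : U) = g := Subtype.ext (mul_one _)
  exact congrArg (D U f) h4.symm

omit [I.Boundaryless] in
-- Write `p q = (p q p⁻¹) p` and differentiate `(p, r) ↦ f (p q p⁻¹ r)` along the diagonal: the
-- first variable gives the conjugation term, the second the left-invariant field at `q`.
theorem scalarDeriv_mul_eq {U : Opens G} (f : C^∞⟮I, U; 𝕜⟯) {q : G} (hq : q ∈ U)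
    (Y : GroupLieAlgebra I G) :
    scalarDeriv (I := I) (fun p => extendZero f (p * q)) (1 : G) Y =
      scalarDeriv (I := I) (fun p => extendZero f (p * q * p⁻¹)) (1 : G) Y +
        scalarDeriv (extendZero f) q (mulInvariantVectorField Y q) := by
  let m : G × G → G := fun p => p.1 * q * p.1⁻¹ * p.2
  have hm : ContMDiff (I.prod I) I ∞ m :=
    ((contMDiff_fst.mul contMDiff_const).mul contMDiff_fst.inv).mul contMDiff_snd
  have hm1 : m (1, 1) = q := by simp [m]
  have hK : MDifferentiableAt (I.prod I) 𝓘(𝕜, 𝕜) (extendZero f ∘ m) ((1 : G), (1 : G)) :=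
    MDifferentiableAt.comp (I' := I) _ (mdifferentiableAt_extendZero f (by rwa [hm1]))
      (hm.mdifferentiableAt (by simp))
  have hdiag : MDifferentiableAt I (I.prod I) (fun p : G => (p, p)) (1 : G) :=
    mdifferentiableAt_id.prodMk mdifferentiableAt_id
  have h1 : (fun p => extendZero f (p * q)) = (extendZero f ∘ m) ∘ fun p : G => (p, p) := by
    funext p; simp [m]
  have h2 : (fun p => extendZero f (p * q * p⁻¹)) = fun z => (extendZero f ∘ m) (z, (1 : G)) := by
    funext p; simp [m]
  have h3 : extendZero f ∘ (q * ·) = fun z => (extendZero f ∘ m) ((1 : G), z) := by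
    funext p; simp [m]
  have h4 : mfderiv I (I.prod I) (fun p : G => (p, p)) (1 : G) Y = (Y, Y) := by
    have e := mfderiv_prodMk (I := I) (I' := I) (I'' := I) (f := @id G) (g := @id G) (x := (1 : G))
      mdifferentiableAt_id mdifferentiableAt_id
    rw [mfderiv_id] at e
    exact congrArg (fun T : E →L[𝕜] E × E => T Y) e
  have h5 : scalarDeriv (extendZero f) q (mulInvariantVectorField Y q) =
      scalarDeriv (I := I) (extendZero f ∘ (q * ·)) (1 : G) Y := by
    have hq1 : MDifferentiableAt I 𝓘(𝕜, 𝕜) (extendZero f) (q * 1) :=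
      mdifferentiableAt_extendZero f (by rwa [mul_one])
    rw [scalarDeriv, scalarDeriv, mfderiv_comp (I' := I) _ hq1
      ((contMDiff_mul_left (n := ∞)).mdifferentiableAt (by simp)), mulInvariantVectorField]
    have h6 : ∀ p : G, p = q → ∀ v : E, (mfderiv I 𝓘(𝕜, 𝕜) (extendZero f) q v : 𝕜) =
        mfderiv I 𝓘(𝕜, 𝕜) (extendZero f) p v := by
      rintro _ rfl v; rfl
    exact h6 _ (mul_one q) _
  rw [h5, h1, h2, h3]
  refine (mfderiv_comp_apply (I' := I.prod I) (f := fun p : G => (p, p)) (g := extendZero f ∘ m)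
    (1 : G) hK hdiag Y).trans ?_
  refine (congrArg (mfderiv (I.prod I) 𝓘(𝕜, 𝕜) (extendZero f ∘ m) ((1 : G), (1 : G))) h4).trans ?_
  exact mfderiv_prod_eq_add_apply hK

/-- The derivative at the identity of `h ↦ (D (f ∘ c_h)) 1`, where `c_h` is conjugation by `h`. -/
theorem mfderiv_chartFunctional_conj (hD : D ∈ leftInvDiffOps I G)
    (ha : ∀ (U : Opens G) (f : C^∞⟮I, U; 𝕜⟯) (h1 : (1 : G) ∈ U),
      D U f ⟨1, h1⟩ = chartFunctional I 1 n a (extendZero f))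
    (U : Opens G) (f : C^∞⟮I, U; 𝕜⟯) (h1 : (1 : G) ∈ U) :
    MDifferentiableAt I 𝓘(𝕜, 𝕜)
      (fun h : G => chartFunctional I 1 n a fun x => extendZero f (h * x * h⁻¹)) 1 ∧
    ∀ Y : GroupLieAlgebra I G,
      scalarDeriv (I := I)
        (fun h : G => chartFunctional I 1 n a fun x => extendZero f (h * x * h⁻¹)) 1 Y +
          D U (invariantFieldOperator Y U f) ⟨1, h1⟩ =
        invariantFieldOperator Y U (D U f) ⟨1, h1⟩ := by
  have hm₁ : ContMDiff (I.prod I) I ∞ fun p : G × G => p.1 * p.2 * p.1⁻¹ :=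
    (contMDiff_fst.mul contMDiff_snd).mul contMDiff_fst.inv
  have hm₂ : ContMDiff (I.prod I) I ∞ fun p : G × G => p.1 * p.2 := contMDiff_mul I ∞
  obtain ⟨hd₁, h₁⟩ := mfderiv_chartFunctional (1 : G) n a f hm₁ (by simpa using h1)
  obtain ⟨hd₂, h₂⟩ := mfderiv_chartFunctional (1 : G) n a f hm₂ (by simpa using h1)
  refine ⟨hd₁, fun Y => ?_⟩
  -- Near the identity `D f` is the functional applied to `q ↦ f (p q)`. Differentiating under the
  -- functional and splitting by `scalarDeriv_mul_eq` yields the conjugation term plus `D (Y f)`.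
  have e₂ : extendZero (D U f) =ᶠ[nhds (1 : G)]
      fun p => chartFunctional I 1 n a fun q => extendZero f (p * q) := by
    filter_upwards [U.2.mem_nhds h1] with p hp
    exact (extendZero_apply (D U f) ⟨p, hp⟩).trans (leftInvDiffOps_apply_eq hD ha U f ⟨p, hp⟩)
  have e₃ : (fun q => scalarDeriv (I := I) (fun p => extendZero f (p * q)) 1 Y) =ᶠ[nhds (1 : G)]
      (fun q => scalarDeriv (I := I) (fun p => extendZero f (p * q * p⁻¹)) 1 Y) +
        extendZero (invariantFieldOperator Y U f) := by
    filter_upwards [U.2.mem_nhds h1] with q hq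
    exact (scalarDeriv_mul_eq f hq Y).trans
      (congrArg (_ + ·) (extendZero_apply (invariantFieldOperator Y U f) ⟨q, hq⟩).symm)
  refine Eq.trans ?_ (((h₂ Y).2.symm.trans ?_ :
    _ = scalarDeriv (I := I) (extendZero (D U f)) 1 Y).trans ?_)
  · refine Eq.trans ?_ (chartFunctional_congr 1 n a e₃).symm
    rw [chartFunctional_add 1 n a
      (F := fun q => scalarDeriv (I := I) (fun p => extendZero f (p * q * p⁻¹)) 1 Y) (h₁ Y).1
      (contDiffAt_extendZero_comp 1 _ h1 (mem_chart_source H _)), ← ha U _ h1]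
    exact congrArg (· + _) (h₁ Y).2
  · have e₄ : (mfderiv I 𝓘(𝕜, 𝕜) (fun p : G => chartFunctional I 1 n a fun q =>
        extendZero f (p * q)) 1 : E →L[𝕜] 𝕜) = mfderiv I 𝓘(𝕜, 𝕜) (extendZero (D U f)) 1 :=
      e₂.mfderiv_eq.symm
    exact congrArg (fun T : E →L[𝕜] 𝕜 => T Y) e₄
  · rw [invariantFieldOperator_apply, mulInvariantVectorField_one]
    rfl

/-- A left-invariant operator commuting with the left-invariant vector fields has the same value at
the identity on a function and on its conjugates. -/
theorem chartFunctional_conj_eq [PreconnectedSpace G] (hD : D ∈ leftInvDiffOps I G)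
    (ha : ∀ (U : Opens G) (f : C^∞⟮I, U; 𝕜⟯) (h1 : (1 : G) ∈ U),
      D U f ⟨1, h1⟩ = chartFunctional I 1 n a (extendZero f))
    (hcomm : ∀ Y : GroupLieAlgebra I G, D * invariantFieldOperator Y = invariantFieldOperator Y * D)
    (U : Opens G) (f : C^∞⟮I, U; 𝕜⟯) (h1 : (1 : G) ∈ U) (h : G) :
    chartFunctional I 1 n a (fun x => extendZero f (h * x * h⁻¹)) =
      chartFunctional I 1 n a (extendZero f) := by
  have hone : ∀ (U : Opens G) (f : C^∞⟮I, U; 𝕜⟯) (h1 : (1 : G) ∈ U) (Y : GroupLieAlgebra I G),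
      scalarDeriv (I := I)
        (fun h : G => chartFunctional I 1 n a fun x => extendZero f (h * x * h⁻¹)) 1 Y = 0 := by
    intro U f h1 Y
    have h2 := (mfderiv_chartFunctional_conj hD ha U f h1).2 Y
    have h3 : D U (invariantFieldOperator Y U f) = invariantFieldOperator Y U (D U f) :=
      LinearMap.congr_fun (congrFun (hcomm Y) U) f
    rw [h3] at h2
    exact add_eq_right.1 h2
  set ψ : G → 𝕜 := fun h => chartFunctional I 1 n a fun x => extendZero f (h * x * h⁻¹) with hψ
  -- `ψ'` is the function `ψ` built from `f ∘ c_h`. It transfers the vanishing of the derivative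
  -- from the identity to `h`, which is why `hone` is stated for every `f`.
  have htrans : ∀ h : G, ∃ ψ' : G → 𝕜, MDifferentiableAt I 𝓘(𝕜, 𝕜) ψ' 1 ∧
      (∀ Y : GroupLieAlgebra I G, mfderiv I 𝓘(𝕜, 𝕜) ψ' 1 Y = 0) ∧ ψ = ψ' ∘ (h⁻¹ * ·) := by
    intro h
    have h1' : (1 : G) ∈ Opens.comap ⟨conjMap I h, (conjMap I h).contMDiff.continuous⟩ U := by
      change h * 1 * h⁻¹ ∈ U
      simpa using h1
    refine ⟨_, (mfderiv_chartFunctional_conj hD ha _ (pullbackFun (conjMap I h) U f) h1').1,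
      hone _ (pullbackFun (conjMap I h) U f) h1', funext fun k => ?_⟩
    simp only [hψ, Function.comp_apply, extendZero_pullbackFun, conjMap_apply]
    congr 1
    funext x
    congr 1
    group
  have hL : ∀ h : G, MDifferentiableAt I I (h⁻¹ * ·) h := fun h =>
    (contMDiff_mul_left (n := ∞)).mdifferentiableAt (by simp)
  have hψ1 : ψ h = ψ 1 := by
    refine eq_of_mfderiv_eq_zero (I := I) (fun h => ?_) (fun h v => ?_) h 1
    · obtain ⟨ψ', hd, -, he⟩ := htrans h
      rw [he]
      exact MDifferentiableAt.comp (I' := I) h (by rwa [inv_mul_cancel]) (hL h)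
    · obtain ⟨ψ', hd, h0, he⟩ := htrans h
      rw [he, mfderiv_comp (I' := I) h (by rwa [inv_mul_cancel]) (hL h)]
      have h5 : ∀ p : G, p = 1 → ∀ v : E, mfderiv I 𝓘(𝕜, 𝕜) ψ' p v = 0 := by
        rintro _ rfl v; exact h0 v
      exact h5 _ (inv_mul_cancel h) _
  refine hψ1.trans ?_
  simp only [hψ]
  congr 1
  funext x
  simp

theorem mem_biInvDiffOps_iff : D ∈ biInvDiffOps I G ↔
    D ∈ leftInvDiffOps I G ∧ ∀ g : G, IsInvariantUnder (𝑹 I g) D := by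
  have h : D ∈ biInvDiffOps I G ↔
    D ∈ leftInvDiffOps I G ∧ D ∈ ⨅ g : G, invariantOperators (𝑹 I g) := Iff.rfl
  rw [h, Algebra.mem_iInf]
  rfl

/-- On a connected group, a left-invariant operator is bi-invariant if and only if it commutes with
the left-invariant vector fields. -/
theorem mem_biInvDiffOps_iff_commute [PreconnectedSpace G] (hD : D ∈ leftInvDiffOps I G) :
    D ∈ biInvDiffOps I G ↔
      ∀ Y : GroupLieAlgebra I G, D * invariantFieldOperator Y = invariantFieldOperator Y * D := by
  obtain ⟨n, hn⟩ := hD.1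
  obtain ⟨a, ha⟩ := hn.exists_chartFunctional
  rw [mem_biInvDiffOps_iff]
  constructor
  · rintro ⟨-, hR⟩ Y
    rw [← sub_eq_zero]
    refine leftInvDiffOps_eq_zero (sub_mem (mul_mem hD (invariantFieldOperator_mem Y))
      (mul_mem (invariantFieldOperator_mem Y) hD)) fun U f h1 => ?_
    have h2 := (mfderiv_chartFunctional_conj hD ha U f h1).2 Y
    -- The functional of `x ↦ f (h x h⁻¹)` is the value at `h` of `D` on the right translate of `f`
    -- by `h⁻¹`; right-invariance turns it into `(D f)(1)`.
    have h3 : (fun h : G => chartFunctional I 1 n a fun x => extendZero f (h * x * h⁻¹)) =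
        fun _ => chartFunctional I 1 n a (extendZero f) := by
      funext h
      have hh : h ∈ Opens.comap ⟨𝑹 I h⁻¹, (𝑹 I h⁻¹).contMDiff.continuous⟩ U := by
        change h * h⁻¹ ∈ U
        simpa using h1
      have h5 := leftInvDiffOps_apply_eq hD ha _ (pullbackFun (𝑹 I h⁻¹) U f) ⟨h, hh⟩
      rw [hR h⁻¹ U f, extendZero_pullbackFun] at h5
      refine h5.symm.trans ?_
      rw [← ha U f h1]
      exact congrArg (D U f) (Subtype.ext (mul_inv_cancel h))
    rw [h3, scalarDeriv, mfderiv_const] at h2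
    have h4 : D U (invariantFieldOperator Y U f) ⟨1, h1⟩ =
      invariantFieldOperator Y U (D U f) ⟨1, h1⟩ := (zero_add _).symm.trans h2
    exact sub_eq_zero.2 h4
  · intro hcomm
    refine ⟨hD, fun g U f => ?_⟩
    ext x
    have hx : (x : G) * g ∈ U := x.2
    refine Eq.trans ?_ (leftInvDiffOps_apply_eq hD ha U f ⟨(x : G) * g, hx⟩).symm
    rw [leftInvDiffOps_apply_eq hD ha, extendZero_pullbackFun]
    have h1 : (1 : G) ∈ Opens.comap ⟨𝑳 I ((x : G) * g),
        (𝑳 I ((x : G) * g)).contMDiff.continuous⟩ U := by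
      change (x : G) * g * 1 ∈ U
      rwa [mul_one]
    -- Conjugating `y ↦ f (x g y)` by `g⁻¹` gives `y ↦ f (x y g)`, the function that computes `D` on
    -- the right translate at `x`.
    have h2 := chartFunctional_conj_eq hD ha hcomm _ (pullbackFun (𝑳 I ((x : G) * g)) U f) h1 g⁻¹
    rw [extendZero_pullbackFun] at h2
    refine Eq.trans ?_ h2
    congr 1
    funext y
    change extendZero f ((x : G) * y * g) = extendZero f ((x : G) * g * (g⁻¹ * y * g⁻¹⁻¹))
    congr 1
    group

end Conjugation

/-! ### The center of the enveloping algebra -/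

section Center

/-- The image of the Lie algebra generates, so commuting with it suffices; this is the form that
matches commutation with left-invariant vector fields. -/
theorem mem_center_enveloping_iff {R L : Type*} [CommRing R] [LieRing L] [LieAlgebra R L]
    (u : UniversalEnvelopingAlgebra R L) :
    u ∈ Subalgebra.center R (UniversalEnvelopingAlgebra R L) ↔
      ∀ X : L, u * UniversalEnvelopingAlgebra.ι R X = UniversalEnvelopingAlgebra.ι R X * u := by
  rw [Subalgebra.mem_center_iff]
  refine ⟨fun h X => (h _).symm, fun h v => ?_⟩
  obtain ⟨n, hv⟩ := exists_mem_envFiltration v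
  rw [envFiltration_eq_span] at hv
  induction hv using Submodule.span_induction with
  | mem v hv =>
    obtain ⟨w, -, rfl⟩ := hv
    induction w with
    | nil => simp [envWord]
    | cons X w ih =>
      have e : envWord R (X :: w) = UniversalEnvelopingAlgebra.ι R X * envWord R w := by
        simp [envWord]
      rw [e, mul_assoc, ih, ← mul_assoc, ← h X, mul_assoc]
  | zero => simp
  | add v w _ _ hv hw => rw [add_mul, mul_add, hv, hw]
  | smul c v _ hv => rw [smul_mul_assoc, mul_smul_comm, hv]

variable {𝕜 E H : Type*} [RCLike 𝕜] [NormedAddCommGroup E] [NormedSpace 𝕜 E]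
  [FiniteDimensional 𝕜 E] [CompleteSpace E]
  [TopologicalSpace H] {I : ModelWithCorners 𝕜 E H} [I.Boundaryless] {G : Type*}
  [TopologicalSpace G] [ChartedSpace H G] [Group G] [LieGroup I ∞ G]

theorem envToLeftInv_mem_biInvDiffOps_iff [PreconnectedSpace G]
    (u : UniversalEnvelopingAlgebra 𝕜 (GroupLieAlgebra I G)) :
    (envToLeftInv I G u : LocalOperators I G) ∈ biInvDiffOps I G ↔
      u ∈ Subalgebra.center 𝕜 (UniversalEnvelopingAlgebra 𝕜 (GroupLieAlgebra I G)) := by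
  rw [mem_biInvDiffOps_iff_commute (envToLeftInv I G u).2, mem_center_enveloping_iff]
  refine forall_congr' fun Y => ?_
  rw [← envToLeftInv_ι, ← envToLeftInv_injective.eq_iff, map_mul, map_mul, Subtype.ext_iff]
  rfl

theorem map_center_envEquivLeftInv [PreconnectedSpace G] :
    (Subalgebra.center 𝕜 (UniversalEnvelopingAlgebra 𝕜 (GroupLieAlgebra I G))).map
      ((leftInvDiffOps I G).val.comp (envEquivLeftInv I G : _ →ₐ[𝕜] leftInvDiffOps I G)) =
        biInvDiffOps I G := by
  ext D
  constructor
  · rintro ⟨u, hu, rfl⟩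
    exact (envToLeftInv_mem_biInvDiffOps_iff u).2 hu
  · intro hD
    obtain ⟨u, hu⟩ := (envEquivLeftInv I G).surjective ⟨D, hD.1⟩
    have hu' : (envToLeftInv I G u : LocalOperators I G) = D := congrArg Subtype.val hu
    exact ⟨u, (envToLeftInv_mem_biInvDiffOps_iff u).1 (hu' ▸ hD), hu'⟩

end Center

end

theorem mainTheorem9 {𝕜 : Type*} [RCLike 𝕜]
    {E : Type*} [NormedAddCommGroup E] [NormedSpace 𝕜 E] [FiniteDimensional 𝕜 E] [CompleteSpace E]
    {H : Type*} [TopologicalSpace H] (I : ModelWithCorners 𝕜 E H) [I.Boundaryless]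
    (G : Type*) [TopologicalSpace G] [ChartedSpace H G] [Group G] [LieGroup I ∞ G] :
    (∃ j : UniversalEnvelopingAlgebra 𝕜 (GroupLieAlgebra I G) ≃ₐ[𝕜] leftInvDiffOps I G,
      (∀ (X : GroupLieAlgebra I G) (U : Opens G) (f : C^∞⟮I, U; 𝕜⟯) (x : U),
        (j (UniversalEnvelopingAlgebra.ι 𝕜 X) : LocalOperators I G) U f x =
          mfderiv I 𝓘(𝕜, 𝕜) (extendZero f) (x : G) (mulInvariantVectorField X (x : G))) ∧
      (∀ n : ℕ, (envFiltration 𝕜 (GroupLieAlgebra I G) n).map j.toLinearMap =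
        leftInvFiltration I G n) ∧
      (ConnectedSpace G →
        (Subalgebra.center 𝕜 (UniversalEnvelopingAlgebra 𝕜 (GroupLieAlgebra I G))).map
          ((leftInvDiffOps I G).val.comp (j : _ →ₐ[𝕜] leftInvDiffOps I G)) =
            biInvDiffOps I G)) ∧
    (∀ (L : Type*) [LieRing L] [LieAlgebra 𝕜 L],
      ∃ Φ : SymmetricAlgebra 𝕜 L ≃ₐ[𝕜] AssociatedGraded (envFiltration 𝕜 L),
        ∀ X : L, Φ (SymmetricAlgebra.ι 𝕜 L X) = grι 𝕜 L X) := by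
  refine ⟨⟨envEquivLeftInv I G, fun X U f x => ?_, map_envFiltration_envEquivLeftInv,
    fun _ => map_center_envEquivLeftInv⟩, fun L _ _ => ⟨AlgEquiv.ofBijective
      (symmetricToGraded 𝕜 L) (symmetricToGraded_bijective 𝕜 L), fun X => symmetricToGraded_ι X⟩⟩
  rw [envEquivLeftInv_apply, envToLeftInv_ι]
  rfl
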